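/- **Setting.** Let $d,m_0\ge1$, $\beta>0$, let $\mathcal V\in C^\infty_c(\mathbb R^d)$ be real-valued, $\hat{\mathcal V}(q)=\int_{\mathbb R^d}e^{-iq\cdot x}\mathcal V(x)\,dx$, $C_0^{\mathcal V}:=\int_{\mathbb R^d}|q|\,|\hat{\mathcal V}(q)|^2dq$, and $M(v)=(\frac\beta{2\pi})^{d/2}e^{-\frac\beta2|v|^2}$. Let $\kappa>0$, $N\in\mathbb N$ with $N\ge1$, $t_N>0$, $\alpha\in\mathbb R$. For $m\ge0$ write $v_{[m]}=(v_0,\dots,v_m)\in(\mathbb R^d)^{m+1}$, and for momenta $k_{[m]}=(k_0,\dots,k_m)\in(\mathbb R^d)^{m+1}$ with $\sum_{j=0}^m k_j=0$ let $\langle\cdot,\cdot\rangle_k$ and $\|\cdot\|_k$ be the inner product and norm of $L^2((\mathbb R^d)^{m+1};\mathbb C)$ in the velocities $v_{[m]}$ at fixed momenta $k_{[m]}$; $|k_{[m]}|$ is the Euclidean norm, $\langle k_{[m]}\rangle=(1+|k_{[m]}|^2)^{1/2}$, and $\langle\nabla\rangle=(1-\triangle)^{1/2}$. **Renormalized propagators.**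 For each $k_{[m]}$ define operators $W_m=W_m(k_{[m]})$ on $L^2((\mathbb R^d)^{m+1})$, by downward recursion, by $W_m:=0$ for $m>m_0$ and, for $0\le m\le m_0$, $$W_m:=\Big(\tfrac{1+i\alpha}{t_N}+i\sum_{j=0}^m k_j\cdot v_j-\tfrac\kappa N\triangle_{v_{[m]}}+\tfrac1N\sum_{j=0}^m\hat S^{m,+}_{j,m+1}W_{m+1}\hat S^{m+1,-}_{j,m+1}\Big)^{-1},$$ where the last sum is the (renormalized hat) operator given, for $h,g\in H^1((\mathbb R^d)^{m+1})$, by $$\Big\langle h,\sum_{j=0}^m\hat S^{m,+}_{j,m+1}W_{m+1}\hat S^{m+1,-}_{j,m+1}g\Big\rangle_k=\sum_{j=0}^m\int_{\mathbb R^d}|\hat{\mathcal V}(q)|^2\Big\langle \sqrt M(v_{m+1})\,q\cdot\nabla_{v_j}h\,,\,W_{m+1}(k^{j,q})\,\sqrt M(v_{m+1})\,q\cdot\nabla_{v_j}g\Big\rangle_{L^2((\mathbb R^d)^{m+2})}\frac{dq}{(2\pi)^d},$$ with $k^{j,q}:=(k_0,\dots,k_{j-1},k_j-q,k_{j+1},\dots,k_m,q)$.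 The inverse is understood weakly: $h=W_mf$ means that $h\in H^1$ solves the corresponding equation tested against all Schwartz functions. **Proposition.** There is a constant $K>0$ depending only on $d,\beta,m_0$ such that the following holds. Let $\mathcal V$ be as above, let $\kappa_0>0$ with $\kappa_0\ge K\,C_0^{\mathcal V}$, and let $\ell\ge0$. There is a constant $C>0$ depending only on $d,\beta,m_0,\mathcal V,\kappa_0,\ell$ such that, for all $\kappa\ge\kappa_0$, $N\ge1$, $t_N>0$, $\alpha\in\mathbb R$, $0\le m\le m_0$, and all $k_{[m]}$ with $\sum_jk_j=0$: 1. $W_m$ is well defined: it is a bounded operator on $L^2((\mathbb R^d)^{m+1})$, and for all $f,h\in L^2$ one has $W_mf=h$ if and only if $h$ is a weak solution in $H^1$ of the above resolvent equation with right-hand side $f$; 2. if $k_{[m]}\ne0$, then for every $g\in C^\infty_c((\mathbb R^d)^{m+1};\mathbb C)$ the weak derivatives of order $\ell$ of $W_mg$ exist in $L^2$ and $$\|\nabla^\ell_{v_{[m]}}W_m\,g\|_k\;\le\;C\,|k_{[m]}|^{-2}\langle k_{[m]}\rangle^{\ell+4}\sum_{s=0}^{\max(\ell-1,2)}N^{\frac{\ell+1-s}3}\,\|\langle\nabla_{v_{[m]}}\rangle^sg\|_k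 .$$ -/

import Mathlib

open MeasureTheory SchwartzMap TemperedDistribution
open scoped ContDiff LineDeriv SchwartzMap

namespace RenormalizedHierarchy

noncomputable section

/-- Velocities `v_{[m]} = (v_0, …, v_m) ∈ (ℝ^d)^{m+1}` with the Euclidean structure and Lebesgue
measure; `v (j, i)` is the `i`-th component of `v_j`. The momenta `k_{[m]}` live in the same
space. -/
abbrev Config (d m : ℕ) : Type := EuclideanSpace ℝ (Fin (m + 1) × Fin d)

/-- The complex Hilbert space `L²((ℝ^d)^{m+1})`, with inner product and norm `⟨·,·⟩_k`, `‖·‖_k`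
(velocity variables at fixed momenta). -/
abbrev L2 (d m : ℕ) : Type := Lp ℂ 2 (volume : Measure (Config d m))

/-- The unit vector in the direction of the `i`-th component of `v_j`, for `e = (j, i)`. -/
def unitVec {d m : ℕ} (e : Fin (m + 1) × Fin d) : Config d m := EuclideanSpace.single e 1

/-- The parameters of the model: inverse temperature `β`, diffusion constant `κ`, particle
number `N`, timescale `t_N`, Laplace variable `α`, and interaction potential `𝒱`. -/
structure Params (d : ℕ) where
  β : ℝ
  β_pos : 0 < β
  κ : ℝ
  N : ℕ
  tN : ℝ
  α : ℝ
  V : EuclideanSpace ℝ (Fin d) → ℝ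

/-- The Maxwellian density `M(v) = (β / 2π)^{d/2} exp(-β |v|² / 2)`. -/
def maxwellian {d : ℕ} (β : ℝ) (v : EuclideanSpace ℝ (Fin d)) : ℝ :=
  (β / (2 * Real.pi)) ^ ((d : ℝ) / 2) * Real.exp (-(β / 2) * ‖v‖ ^ 2)

/-- `V̂(q) = ∫ e^{-i q·x} V(x) dx`. -/
def potentialHat {d : ℕ} (V : EuclideanSpace ℝ (Fin d) → ℝ) (q : EuclideanSpace ℝ (Fin d)) : ℂ :=
  ∫ x, Complex.exp (-(Complex.I * ((inner ℝ q x : ℝ) : ℂ))) * ((V x : ℝ) : ℂ)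

/-- `C_0^V = ∫ |q| |V̂(q)|² dq`. -/
def potentialConst {d : ℕ} (V : EuclideanSpace ℝ (Fin d) → ℝ) : ℝ :=
  ∫ q, ‖q‖ * ‖potentialHat V q‖ ^ 2

/-- The bracket `⟨k⟩ = (1 + |k|²)^{1/2}`. -/
def bracket {d m : ℕ} (k : Config d m) : ℝ := Real.sqrt (1 + ‖k‖ ^ 2)

/-- The first `m + 1` velocities `(v_0, …, v_m)` of `(v_0, …, v_{m+1})`. -/
def initVel {d m : ℕ} (v : Config d (m + 1)) : Config d m :=
  WithLp.toLp 2 fun p => v (p.1.castSucc, p.2)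

/-- The last velocity `v_{m+1}` of `(v_0, …, v_{m+1})`. -/
def lastVel {d m : ℕ} (v : Config d (m + 1)) : EuclideanSpace ℝ (Fin d) :=
  WithLp.toLp 2 fun i => v (Fin.last (m + 1), i)

/-- The momenta `(k_0, …, k_j - q, …, k_m, q)` after particle `m + 1` has been given the
momentum `q` in a collision with particle `j`. -/
def transferMomentum {d m : ℕ} (k : Config d m) (j : Fin (m + 1))
    (q : EuclideanSpace ℝ (Fin d)) : Config d (m + 1) :=
  WithLp.toLp 2 fun p =>
    Fin.lastCases (motive := fun _ => ℝ) (q p.2)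
      (fun l => k (l, p.2) - if l = j then q p.2 else 0) p.1

theorem splitIndex_bijective (d m : ℕ) : Function.Bijective
    (Sum.elim (fun p : Fin (m + 1) × Fin d => (p.1.castSucc, p.2))
      (fun i : Fin d => (Fin.last (m + 1), i))) := by
  constructor
  · rintro (⟨a, i⟩ | i) (⟨b, j⟩ | j) h
    · simpa using h
    · exact absurd (congrArg Prod.fst h) (Fin.castSucc_lt_last a).ne
    · exact absurd (congrArg Prod.fst h) (Fin.castSucc_lt_last b).ne'
    · simpa using h
  · rintro ⟨a, i⟩
    induction a using Fin.lastCases with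
    | last => exact ⟨Sum.inr i, rfl⟩
    | cast a => exact ⟨Sum.inl (a, i), rfl⟩

theorem measurePreserving_split (d m : ℕ) :
    MeasurePreserving (fun v : Config d (m + 1) => (initVel v, lastVel v))
      volume (volume.prod volume) := by
  have h1 := PiLp.volume_preserving_ofLp (Fin (m + 2) × Fin d)
  have h2 := (volume_measurePreserving_piCongrLeft (fun _ => ℝ)
    (Equiv.ofBijective _ (splitIndex_bijective d m))).symm
  have h3 := volume_measurePreserving_sumPiEquivProdPi
    (fun _ : (Fin (m + 1) × Fin d) ⊕ Fin d => ℝ)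
  have h4 := (PiLp.volume_preserving_toLp (Fin (m + 1) × Fin d)).prod
    (PiLp.volume_preserving_toLp (Fin d))
  exact h4.comp (h3.comp (h2.comp h1))

theorem memLp_sqrt_maxwellian {d : ℕ} {β : ℝ} (hβ : 0 < β) :
    MemLp (fun v : EuclideanSpace ℝ (Fin d) => ((Real.sqrt (maxwellian β v) : ℝ) : ℂ)) 2
      volume := by
  have hc : Continuous (fun v : EuclideanSpace ℝ (Fin d) => maxwellian β v) := by
    unfold maxwellian; fun_prop
  rw [memLp_two_iff_integrable_sq_norm
    (by exact (Complex.continuous_ofReal.comp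
      (Real.continuous_sqrt.comp hc)).aestronglyMeasurable)]
  have hint : Integrable (fun v : EuclideanSpace ℝ (Fin d) => maxwellian β v) := by
    have h := (GaussianFourier.integrable_cexp_neg_mul_sq_norm_add (b := ((β / 2 : ℝ) : ℂ))
      (by simpa using hβ) 0 (0 : EuclideanSpace ℝ (Fin d))).re
    refine (h.const_mul ((β / (2 * Real.pi)) ^ ((d : ℝ) / 2))).congr ?_
    refine Filter.Eventually.of_forall fun v => ?_
    have : (-((β / 2 : ℝ) : ℂ) * (‖v‖ : ℂ) ^ 2 + 0 * ((inner ℝ 0 v : ℝ) : ℂ))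
        = ((-(β / 2) * ‖v‖ ^ 2 : ℝ) : ℂ) := by push_cast; ring
    simp only [maxwellian, this]
    rw [← Complex.ofReal_exp]
    rfl
  refine hint.congr (Filter.Eventually.of_forall fun v => ?_)
  have h0 : 0 ≤ maxwellian β v := by unfold maxwellian; positivity
  simp [Real.sq_sqrt h0]

theorem memLp_mul_prod {X Y : Type*} [MeasureSpace X] [MeasureSpace Y]
    [SFinite (volume : Measure X)] [SFinite (volume : Measure Y)] {f : X → ℂ} {g : Y → ℂ}
    (hf : MemLp f 2 volume) (hg : MemLp g 2 volume) :
    MemLp (fun z : X × Y => g z.2 * f z.1) 2 (volume.prod volume) := by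
  have hmeas : AEStronglyMeasurable (fun z : X × Y => g z.2 * f z.1) (volume.prod volume) :=
    hg.1.comp_snd.mul hf.1.comp_fst
  rw [memLp_two_iff_integrable_sq_norm hmeas]
  refine (((memLp_two_iff_integrable_sq_norm hf.1).1 hf).mul_prod
    ((memLp_two_iff_integrable_sq_norm hg.1).1 hg)).congr ?_
  refine Filter.Eventually.of_forall fun z => ?_
  simp only [norm_mul, mul_pow]
  ring

theorem memLp_tensor_of_memLp {d m : ℕ} {f : Config d m → ℂ}
    {g : EuclideanSpace ℝ (Fin d) → ℂ} (hf : MemLp f 2 volume) (hg : MemLp g 2 volume) :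
    MemLp (fun v : Config d (m + 1) => g (lastVel v) * f (initVel v)) 2 volume := by
  have h1 := memLp_mul_prod hf hg
  have h2 := h1.comp_measurePreserving (measurePreserving_split d m)
  exact h2

theorem memLp_tensor {d m : ℕ} {β : ℝ} (hβ : 0 < β) (f : L2 d m) :
    MemLp (fun v : Config d (m + 1) =>
      ((Real.sqrt (maxwellian β (lastVel v)) : ℝ) : ℂ) * f (initVel v)) 2 volume := by
  have h1 := memLp_sqrt_maxwellian (d := d) hβ
  have h2 := Lp.memLp f
  have h3 := memLp_tensor_of_memLp h2 h1
  exact h3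

/-- `f ↦ √M(v_{m+1}) f(v_0, …, v_m)`, from `L²((ℝ^d)^{m+1})` to `L²((ℝ^d)^{m+2})`. -/
def tensorSqrtMaxwellian {d m : ℕ} {β : ℝ} (hβ : 0 < β) (f : L2 d m) : L2 d (m + 1) :=
  (memLp_tensor hβ f).toLp _

/-- The family `w` in `L²` is the weak velocity gradient of `h ∈ L²`; the existence of such a
`w` means `h ∈ H¹`. -/
def IsWeakGradient {d m : ℕ} (h : L2 d m) (w : Fin (m + 1) × Fin d → L2 d m) : Prop :=
  ∀ e, ∂_{unitVec e} (h : 𝓢'(Config d m, ℂ)) = (w e : 𝓢'(Config d m, ℂ))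

/-- The velocity gradient of a Schwartz function, as a family in `L²`. -/
def schwartzGradient {d m : ℕ} (φ : 𝓢(Config d m, ℂ)) (e : Fin (m + 1) × Fin d) : L2 d m :=
  (∂_{unitVec e} φ).toLp 2

/-- The creation-type collision operator `Ŝ^{m+1,-}_{j,m+1}` at fixed momenta, where `q` is the
momentum of particle `m + 1`, as a function of the velocity gradient `w` of its argument:
`-(m+1)^{-1/2} √M(v_{m+1}) V̂(-q) q · w_j(v_0, …, v_m)`. Here `V̂(-q)` is the conjugate of `V̂(q)`,
as `V` is real, and it equals `V̂(q)` if `V` is even. -/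
def collisionMinus {d : ℕ} (P : Params d) {m : ℕ} (j : Fin (m + 1))
    (q : EuclideanSpace ℝ (Fin d)) (w : Fin (m + 1) × Fin d → L2 d m) : L2 d (m + 1) :=
  (-((1 / Real.sqrt (m + 1) : ℝ) : ℂ) * (starRingEnd ℂ) (potentialHat P.V q)) •
    tensorSqrtMaxwellian P.β_pos (∑ i, ((q i : ℝ) : ℂ) • w (j, i))

/-- The form `⟨φ, (∑_j Ŝ^{m,+}_{j,m+1} W Ŝ^{m+1,-}_{j,m+1}) h⟩_k` at momenta `k`, where `W`
acts on `L²((ℝ^d)^{m+2})` for each value of the momenta, in terms of the velocity gradients `a`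
of `φ` and `w` of `h`.
The operator
`Ŝ^{m,+}_{j,m+1} G = (m+1)^{1/2} ∫ √M(v_{m+1}) V̂(q) q · ∇_{v_j} G_q dv_{m+1} dq / (2π)^d`
is written with `∇_{v_j}` integrated by parts onto `φ`, that is,
`⟨φ, Ŝ^{m,+}_{j,m+1} G⟩ = (m+1) ∫ ⟨Ŝ^{m+1,-}_{j,m+1} φ, G_q⟩ dq / (2π)^d`. -/
def hatForm {d : ℕ} (P : Params d) {m : ℕ}
    (W : Config d (m + 1) → (L2 d (m + 1) →L[ℂ] L2 d (m + 1))) (k : Config d m)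
    (a w : Fin (m + 1) × Fin d → L2 d m) : ℂ :=
  ∑ j : Fin (m + 1), ((m : ℂ) + 1) * ((((2 * Real.pi) ^ d)⁻¹ : ℝ) : ℂ) *
    ∫ q : EuclideanSpace ℝ (Fin d),
      inner ℂ (collisionMinus P j q a) (W (transferMomentum k j q) (collisionMinus P j q w))

/-- `h ∈ H¹` is a weak solution of
`((1 + iα)/t_N + i ∑_j k_j · v_j - (κ/N) ∑_j Δ_{v_j} + (1/N) ∑_j Ŝ^{m,+}_{j,m+1} W Ŝ^{m+1,-}_{j,m+1}) h = f`. -/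
def IsResolventSolution {d : ℕ} (P : Params d) {m : ℕ}
    (W : Config d (m + 1) → (L2 d (m + 1) →L[ℂ] L2 d (m + 1))) (k : Config d m)
    (f h : L2 d m) : Prop :=
  ∃ w : Fin (m + 1) × Fin d → L2 d m, IsWeakGradient h w ∧
    ∀ φ : 𝓢(Config d m, ℂ),
      ((1 + Complex.I * ((P.α : ℝ) : ℂ)) / ((P.tN : ℝ) : ℂ)) * inner ℂ (φ.toLp 2) h
        + Complex.I * (∫ v, (starRingEnd ℂ) (φ v) * ((inner ℝ k v : ℝ) : ℂ) * h v)
        + (((P.κ / P.N : ℝ)) : ℂ) * (∑ e, inner ℂ (schwartzGradient φ e) (w e))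
        + ((1 / P.N : ℝ) : ℂ) * hatForm P W k (schwartzGradient φ) w
      = inner ℂ (φ.toLp 2) f

open scoped Classical in
/-- The bounded inverse of the (unbounded, linear) operator `A` on `L²` with graph
`{(h, f) | S f h}`, that is, the bounded operator `R` with `R f = h ↔ A h = f`; by convention it
is `0` if there is no such `R`. -/
def boundedInverse {d m : ℕ} (S : L2 d m → L2 d m → Prop) : L2 d m →L[ℂ] L2 d m :=
  if hR : ∃ R : L2 d m →L[ℂ] L2 d m, ∀ f h, R f = h ↔ S f h then hR.choose else 0

/-- The renormalized propagator on `m + 1` particles at momenta `k`, when `n` further levels of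
the hierarchy (including the present one) remain below the truncation. -/
def propagatorAux {d : ℕ} (P : Params d) :
    (n m : ℕ) → Config d m → (L2 d m →L[ℂ] L2 d m)
  | 0, _, _ => 0
  | n + 1, m, k => boundedInverse (IsResolventSolution P (propagatorAux P n (m + 1)) k)

/-- The renormalized propagator on `m + 1` particles at momenta `k_{[m]} = k` for the hierarchy
truncated at order `m₀`: it is `0` for `m > m₀`, and for `m ≤ m₀` it is the resolvent
`((1 + iα)/t_N + i L̂_m + (κ/N) D̂_m + (1/N) ∑_j Ŝ^{m,+}_{j,m+1} W Ŝ^{m+1,-}_{j,m+1})⁻¹`,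
where `W` is the renormalized propagator on `m + 2` particles. -/
def propagator {d : ℕ} (P : Params d) (m₀ m : ℕ) (k : Config d m) : L2 d m →L[ℂ] L2 d m :=
  propagatorAux P (m₀ + 1 - m) m k

/-- The family `u` in `L²` is the full tensor of weak derivatives `∇^ℓ_{v_{[m]}} h`. -/
def IsWeakIteratedGradient {d m : ℕ} (ℓ : ℕ) (h : L2 d m)
    (u : (Fin ℓ → Fin (m + 1) × Fin d) → L2 d m) : Prop :=
  ∀ I, ∂^{fun r => unitVec (I r)} (h : 𝓢'(Config d m, ℂ)) = (u I : 𝓢'(Config d m, ℂ))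

/-- The `L²` norm of a tensor field of order `ℓ`. -/
def tensorNorm {d m ℓ : ℕ} (u : (Fin ℓ → Fin (m + 1) × Fin d) → L2 d m) : ℝ :=
  Real.sqrt (∑ I, ‖u I‖ ^ 2)

/-- `‖⟨∇_v⟩^s g‖` with `⟨∇_v⟩ = (1 - Δ_v)^{1/2}`; Mathlib's Fourier transform is normalised such
that `∇_v` has the symbol `2πiξ`. -/
def besselNorm {d m : ℕ} (s : ℕ) (g : 𝓢(Config d m, ℂ)) : ℝ :=
  ‖(SchwartzMap.fourierMultiplierCLM ℂ
    (fun ξ : Config d m => (((1 + (2 * Real.pi * ‖ξ‖) ^ 2) ^ ((s : ℝ) / 2) : ℝ) : ℂ)) g).toLp 2‖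

end

end RenormalizedHierarchy

/-! Put ν = κ/N. Weakly, the resolvent equation reads (z + i k·v - νΔ - div B∇) h = f with Re z > 0,
where B is the bounded operator on gradient fields that represents N⁻¹ times the collision form. The
proof hinges on ‖B‖ ≤ ν/10: the collision term is then absorbed by the dissipation, whatever its
sign.

The basic tool is a commutator. In Fourier variables multiplication by k·v is (i/2π)∂_k, so testing
the equation with ρ(ξ)ĥ for a real symbol ρ produces the term (1/4π)∫ ∂_kρ |ĥ|². The choice ρ = 3 +
arctan⟨ξ, y⟩, which lies between 1 and 5, keeps the dissipation and adds control of (1 + ⟨ξ,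
y⟩²)^(-1/2) ĥ with factor ⟨k, y⟩/(4π) (`IsSol.energy`). Two choices of y matter. With y parallel to
k and of length 1/R, where νR³ = |k|, one obtains the hypoelliptic bound R‖h‖ + ‖∇h‖ ≤
(160/ν)(‖r₀‖/R + ‖r₁‖) for data r₀ - div r₁ (`IsSol.norm_le`). With y = n the unit vector along the
last momentum q, placed in the last velocity, one obtains a bound of order 1/|q|, uniform in ν and
z, for data with one derivative in direction n (`IsSol.weighted_norm_le`).

The functions √M(v_{m+1}) f have such a derivative, so ⟨√M φ, W √M f⟩ is O(1/|q|)‖φ‖‖f‖. Against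
|q|²|V̂(q)|² this integrates to a multiple of C_0^V, hence ‖B‖ ≤ const·C_0^V/N, and this is at most
ν/10 once κ₀ ≥ K C_0^V. The constant is the same at every level of the hierarchy, so the downward
recursion closes with one K.

Derivatives are replaced by differences of translates. Translating by x turns z into z + i k·x and B
into its conjugate `conjTrans x B`; iterated differences of solutions then solve the equation at
frozen x, with data of lower order given by a discrete Leibniz rule. This needs differences of B,
hence of the propagator one level up, and only in the form ⟨√M φ, · √M f⟩. `IsRegularFamily` is the
corresponding induction hypothesis, and `IsRegularFamily.next` passes it down one level. Letting the
differences tend to zero gives the weak derivatives; counting powers of |k|, ⟨k⟩ and ν gives the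
stated bound.

Well-posedness follows from Lions' theorem on pairs (h, ∇h): the energy estimate gives uniqueness,
hence density of the range of the formal adjoint on Schwartz functions. The integrals over q also
require weak measurability of W in k, which is carried along in the induction. -/

namespace RenormalizedHierarchy

open scoped BoundedContinuousFunction FourierTransform ComplexConjugate
open Filter Topology

noncomputable section

set_option linter.unusedSectionVars false

/-! ### Multiplication operators and Fourier multipliers on `L²` -/

section Multipliers

variable {E : Type*} [NormedAddCommGroup E] [InnerProductSpace ℝ E] [FiniteDimensional ℝ E]
  [MeasurableSpace E] [BorelSpace E]

/-- Multiplication by a bounded continuous function on `L²`. -/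
def mulOp (θ : E →ᵇ ℂ) : Lp ℂ 2 (volume : Measure E) →L[ℂ] Lp ℂ 2 (volume : Measure E) :=
  (ContinuousLinearMap.lsmul ℂ ℂ : ℂ →L[ℂ] ℂ →L[ℂ] ℂ).holderL volume ⊤ 2 2
    ((θ.memLp_top (μ := volume)).toLp _)

theorem coeFn_mulOp (θ : E →ᵇ ℂ) (f : Lp ℂ 2 (volume : Measure E)) :
    mulOp θ f =ᵐ[volume] fun x => θ x * f x := by
  have h := ContinuousLinearMap.coeFn_holder (r := 2)
    (ContinuousLinearMap.lsmul ℂ ℂ : ℂ →L[ℂ] ℂ →L[ℂ] ℂ)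
    ((θ.memLp_top (μ := volume)).toLp _) f
  filter_upwards [h, (θ.memLp_top (μ := volume)).coeFn_toLp] with x h1 h2
  have : (mulOp θ f) x = _ := h1
  rw [this, h2]
  simp

theorem norm_mulOp_le {θ : E →ᵇ ℂ} {C : ℝ} (hC : ∀ x, ‖θ x‖ ≤ C)
    (f : Lp ℂ 2 (volume : Measure E)) : ‖mulOp θ f‖ ≤ C * ‖f‖ := by
  have hC0 : 0 ≤ C := (norm_nonneg _).trans (hC 0)
  refine Lp.norm_le_mul_norm_of_ae_le_mul ?_
  filter_upwards [coeFn_mulOp θ f] with x hx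
  rw [hx, norm_mul]
  gcongr
  exact hC x

theorem mulOp_eq_of_ae {θ : E →ᵇ ℂ} {f g : Lp ℂ 2 (volume : Measure E)}
    (h : (fun x => θ x * f x) =ᵐ[volume] g) : mulOp θ f = g :=
  Lp.ext ((coeFn_mulOp θ f).trans h)

theorem mulOp_mulOp (θ η : E →ᵇ ℂ) (f : Lp ℂ 2 (volume : Measure E)) :
    mulOp θ (mulOp η f) = mulOp (θ * η) f := by
  refine mulOp_eq_of_ae ?_
  filter_upwards [coeFn_mulOp η f, coeFn_mulOp (θ * η) f] with x h1 h2
  rw [h1, h2]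
  simp [mul_assoc]

theorem mulOp_add (θ η : E →ᵇ ℂ) (f : Lp ℂ 2 (volume : Measure E)) :
    mulOp (θ + η) f = mulOp θ f + mulOp η f := by
  refine mulOp_eq_of_ae ?_
  filter_upwards [coeFn_mulOp η f, coeFn_mulOp θ f, Lp.coeFn_add (mulOp θ f) (mulOp η f)]
    with x h1 h2 h3
  rw [h3, Pi.add_apply, h1, h2]
  simp [add_mul]

theorem mulOp_smul (c : ℂ) (θ : E →ᵇ ℂ) (f : Lp ℂ 2 (volume : Measure E)) :
    mulOp (c • θ) f = c • mulOp θ f := by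
  refine mulOp_eq_of_ae ?_
  filter_upwards [coeFn_mulOp θ f, Lp.coeFn_smul c (mulOp θ f)] with x h1 h2
  rw [h2, Pi.smul_apply, h1]
  simp [mul_assoc]

theorem mulOp_one (f : Lp ℂ 2 (volume : Measure E)) : mulOp 1 f = f :=
  mulOp_eq_of_ae (Eventually.of_forall fun x => by simp)

theorem inner_mulOp_left (θ : E →ᵇ ℂ) (f g : Lp ℂ 2 (volume : Measure E)) :
    inner ℂ (mulOp θ f) g = inner ℂ f (mulOp (star θ) g) := by
  rw [L2.inner_def, L2.inner_def]
  refine integral_congr_ae ?_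
  filter_upwards [coeFn_mulOp θ f, coeFn_mulOp (star θ) g] with x h1 h2
  rw [h1, h2]
  simp
  ring

theorem mulOp_toLp {θ : E →ᵇ ℂ} (hθ : (θ : E → ℂ).HasTemperateGrowth) (φ : 𝓢(E, ℂ)) :
    mulOp θ (φ.toLp 2) = (SchwartzMap.smulLeftCLM ℂ (θ : E → ℂ) φ).toLp 2 := by
  refine mulOp_eq_of_ae ?_
  filter_upwards [φ.coeFn_toLp 2 volume,
    (SchwartzMap.smulLeftCLM ℂ (θ : E → ℂ) φ).coeFn_toLp 2 volume] with x h1 h2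
  rw [h1, h2, SchwartzMap.smulLeftCLM_apply_apply hθ, smul_eq_mul]

/-- The Fourier multiplier with bounded continuous symbol on `L²`. -/
def fmul (ρ : E →ᵇ ℂ) : Lp ℂ 2 (volume : Measure E) →L[ℂ] Lp ℂ 2 (volume : Measure E) :=
  ((Lp.fourierTransformₗᵢ E ℂ).symm.toContinuousLinearEquiv : _ →L[ℂ] _) ∘L mulOp ρ ∘L
    ((Lp.fourierTransformₗᵢ E ℂ).toContinuousLinearEquiv : _ →L[ℂ] _)

theorem fmul_apply (ρ : E →ᵇ ℂ) (f : Lp ℂ 2 (volume : Measure E)) :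
    fmul ρ f = 𝓕⁻ (mulOp ρ (𝓕 f)) := rfl

theorem fourier_fmul (ρ : E →ᵇ ℂ) (f : Lp ℂ 2 (volume : Measure E)) :
    𝓕 (fmul ρ f) = mulOp ρ (𝓕 f) := by
  rw [fmul_apply, FourierTransform.fourier_fourierInv_eq]

theorem fourier_injective_L2 {f g : Lp ℂ 2 (volume : Measure E)} (h : 𝓕 f = 𝓕 g) : f = g :=
  (Lp.fourierTransformₗᵢ E ℂ).injective h

theorem norm_fmul_le {ρ : E →ᵇ ℂ} {C : ℝ} (hC : ∀ x, ‖ρ x‖ ≤ C)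
    (f : Lp ℂ 2 (volume : Measure E)) : ‖fmul ρ f‖ ≤ C * ‖f‖ := by
  rw [← Lp.norm_fourier_eq (fmul ρ f), fourier_fmul, ← Lp.norm_fourier_eq f]
  exact norm_mulOp_le hC _

theorem fmul_fmul (ρ σ : E →ᵇ ℂ) (f : Lp ℂ 2 (volume : Measure E)) :
    fmul ρ (fmul σ f) = fmul (ρ * σ) f :=
  fourier_injective_L2 (by simp only [fourier_fmul, mulOp_mulOp])

theorem fmul_comm (ρ σ : E →ᵇ ℂ) (f : Lp ℂ 2 (volume : Measure E)) :
    fmul ρ (fmul σ f) = fmul σ (fmul ρ f) := by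
  rw [fmul_fmul, fmul_fmul, mul_comm]

theorem fmul_one (f : Lp ℂ 2 (volume : Measure E)) : fmul 1 f = f :=
  fourier_injective_L2 (by simp only [fourier_fmul, mulOp_one])

theorem fmul_add (ρ σ : E →ᵇ ℂ) (f : Lp ℂ 2 (volume : Measure E)) :
    fmul (ρ + σ) f = fmul ρ f + fmul σ f :=
  fourier_injective_L2 (by rw [FourierTransform.fourier_add]; simp only [fourier_fmul, mulOp_add])

theorem fmul_smul (c : ℂ) (ρ : E →ᵇ ℂ) (f : Lp ℂ 2 (volume : Measure E)) :
    fmul (c • ρ) f = c • fmul ρ f :=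
  fourier_injective_L2 (by rw [FourierTransform.fourier_smul]; simp only [fourier_fmul, mulOp_smul])

theorem inner_fmul_left (ρ : E →ᵇ ℂ) (f g : Lp ℂ 2 (volume : Measure E)) :
    inner ℂ (fmul ρ f) g = inner ℂ f (fmul (star ρ) g) := by
  rw [← Lp.inner_fourier_eq, fourier_fmul, inner_mulOp_left, ← fourier_fmul, Lp.inner_fourier_eq]

theorem fmul_toLp {ρ : E →ᵇ ℂ} (hρ : (ρ : E → ℂ).HasTemperateGrowth) (φ : 𝓢(E, ℂ)) :
    fmul ρ (φ.toLp 2) = (SchwartzMap.fourierMultiplierCLM ℂ (ρ : E → ℂ) φ).toLp 2 := by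
  rw [fmul_apply, SchwartzMap.toLp_fourier_eq, mulOp_toLp hρ, SchwartzMap.toLp_fourierInv_eq]
  rfl

/-! ### Weak derivatives -/

/-- `w` is the weak derivative of `h` in the direction `y`. -/
def IsWeakDeriv (y : E) (h w : Lp ℂ 2 (volume : Measure E)) : Prop :=
  ∂_{y} (h : 𝓢'(E, ℂ)) = (w : 𝓢'(E, ℂ))

theorem ae_eq_of_forall_integral_schwartz {f g : E → ℂ} (hf : LocallyIntegrable f)
    (hg : LocallyIntegrable g) (h : ∀ φ : 𝓢(E, ℂ), ∫ x, φ x * f x = ∫ x, φ x * g x) :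
    f =ᵐ[volume] g := by
  refine ae_eq_of_integral_contDiff_smul_eq hf hg fun u hu hc => ?_
  have hg₁ : HasCompactSupport (Complex.ofRealCLM ∘ u) := hc.comp_left rfl
  have hg₂ : ContDiff ℝ ∞ (Complex.ofRealCLM ∘ u) := by fun_prop
  simpa using h (hg₁.toSchwartzMap hg₂)

/-- Reduces weak derivatives to pointwise multiplication on the Fourier side; uniqueness,
commutation with multipliers and integration by parts all follow from it. -/
theorem isWeakDeriv_iff_fourier (y : E) (h w : Lp ℂ 2 (volume : Measure E)) :
    IsWeakDeriv y h w ↔ (𝓕 w : Lp ℂ 2 (volume : Measure E)) =ᵐ[volume]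
      fun ξ => (2 * Real.pi * Complex.I * (inner ℝ ξ y : ℝ)) * (𝓕 h : Lp ℂ 2 volume) ξ := by
  have hT : (fun ξ : E => ((inner ℝ ξ y : ℝ) : ℂ)).HasTemperateGrowth := by fun_prop
  have key : IsWeakDeriv y h w ↔ ∀ φ : 𝓢(E, ℂ),
      ∫ ξ, φ ξ * ((2 * Real.pi * Complex.I * (inner ℝ ξ y : ℝ)) * (𝓕 h : Lp ℂ 2 volume) ξ)
        = ∫ ξ, φ ξ * (𝓕 w : Lp ℂ 2 (volume : Measure E)) ξ := by
    have e1 : IsWeakDeriv y h w ↔ 𝓕 (∂_{y} (h : 𝓢'(E, ℂ))) = 𝓕 (w : 𝓢'(E, ℂ)) := by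
      refine ⟨fun hh => congrArg _ hh, fun hh => ?_⟩
      have := congrArg (fun T : 𝓢'(E, ℂ) => 𝓕⁻ T) hh
      simp only [FourierTransform.fourierInv_fourier_eq] at this
      exact this
    rw [e1, TemperedDistribution.fourier_lineDerivOp_eq, Lp.fourier_toTemperedDistribution_eq,
      Lp.fourier_toTemperedDistribution_eq]
    have e2 : ∀ φ : 𝓢(E, ℂ), ((2 * Real.pi * Complex.I) •
        TemperedDistribution.smulLeftCLM ℂ (fun ξ : E => ((inner ℝ ξ y : ℝ) : ℂ))
          ((𝓕 h : Lp ℂ 2 (volume : Measure E)) : 𝓢'(E, ℂ))) φ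
        = ∫ ξ, φ ξ * ((2 * Real.pi * Complex.I * (inner ℝ ξ y : ℝ)) *
            (𝓕 h : Lp ℂ 2 volume) ξ) := by
      intro φ
      change (2 * Real.pi * Complex.I) • (((𝓕 h : Lp ℂ 2 (volume : Measure E)) : 𝓢'(E, ℂ))
        (SchwartzMap.smulLeftCLM ℂ (fun ξ : E => ((inner ℝ ξ y : ℝ) : ℂ)) φ)) = _
      rw [Lp.toTemperedDistribution_apply, ← integral_smul]
      refine integral_congr_ae (Eventually.of_forall fun ξ => ?_)
      simp only [SchwartzMap.smulLeftCLM_apply_apply hT, smul_eq_mul]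
      ring
    constructor
    · intro hh φ
      rw [← e2, hh, Lp.toTemperedDistribution_apply]
      rfl
    · intro hh
      ext φ
      rw [e2, hh, Lp.toTemperedDistribution_apply]
      rfl
  rw [key]
  have l1 : LocallyIntegrable (𝓕 w : Lp ℂ 2 (volume : Measure E)) :=
    (Lp.memLp _).locallyIntegrable (by norm_num)
  have l2 : LocallyIntegrable (fun ξ : E => (2 * Real.pi * Complex.I * (inner ℝ ξ y : ℝ)) *
      (𝓕 h : Lp ℂ 2 (volume : Measure E)) ξ) := by
    have l3 : LocallyIntegrable (𝓕 h : Lp ℂ 2 (volume : Measure E)) :=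
      (Lp.memLp _).locallyIntegrable (by norm_num)
    have := l3.locallyIntegrableOn Set.univ
    rw [← locallyIntegrableOn_univ] at *
    exact this.continuousOn_mul (by fun_prop) isOpen_univ.isLocallyClosed
  constructor
  · intro hh
    exact (ae_eq_of_forall_integral_schwartz l2 l1 hh).symm
  · intro hh φ
    refine integral_congr_ae ?_
    filter_upwards [hh] with ξ hξ
    rw [hξ]

theorem isWeakDeriv_toLp (y : E) (φ : 𝓢(E, ℂ)) :
    IsWeakDeriv y (φ.toLp 2) ((∂_{y} φ).toLp 2) := by
  unfold IsWeakDeriv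
  rw [Lp.toTemperedDistribution_toLp_eq, Lp.toTemperedDistribution_toLp_eq,
    TemperedDistribution.lineDerivOp_toTemperedDistributionCLM_eq]

theorem IsWeakDeriv.fmul {y : E} {h w : Lp ℂ 2 (volume : Measure E)} (hw : IsWeakDeriv y h w)
    (ρ : E →ᵇ ℂ) : IsWeakDeriv y (fmul ρ h) (fmul ρ w) := by
  rw [isWeakDeriv_iff_fourier] at *
  simp only [fourier_fmul]
  filter_upwards [hw, coeFn_mulOp ρ (𝓕 w), coeFn_mulOp ρ (𝓕 h)] with ξ h1 h2 h3
  rw [h2, h3, h1]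
  ring

theorem IsWeakDeriv.add {y : E} {h w h' w' : Lp ℂ 2 (volume : Measure E)}
    (hw : IsWeakDeriv y h w) (hw' : IsWeakDeriv y h' w') : IsWeakDeriv y (h + h') (w + w') := by
  unfold IsWeakDeriv at *
  have := congrArg₂ (· + ·) hw hw'
  simp only [← Lp.toTemperedDistributionCLM_apply] at *
  rw [map_add, map_add, ← this, LineDeriv.lineDerivOp_add]

theorem IsWeakDeriv.smul {y : E} {h w : Lp ℂ 2 (volume : Measure E)}
    (hw : IsWeakDeriv y h w) (c : ℂ) : IsWeakDeriv y (c • h) (c • w) := by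
  unfold IsWeakDeriv at *
  simp only [← Lp.toTemperedDistributionCLM_apply] at *
  rw [map_smul, map_smul, ← hw, LineDeriv.lineDerivOp_smul]

theorem IsWeakDeriv.sub {y : E} {h w h' w' : Lp ℂ 2 (volume : Measure E)}
    (hw : IsWeakDeriv y h w) (hw' : IsWeakDeriv y h' w') : IsWeakDeriv y (h - h') (w - w') := by
  have := hw.add (hw'.smul (-1))
  simpa [sub_eq_add_neg] using this

theorem IsWeakDeriv.unique {y : E} {h w w' : Lp ℂ 2 (volume : Measure E)}
    (hw : IsWeakDeriv y h w) (hw' : IsWeakDeriv y h w') : w = w' := by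
  rw [isWeakDeriv_iff_fourier] at *
  exact fourier_injective_L2 (Lp.ext (hw.trans hw'.symm))

theorem isClosed_isWeakDeriv (y : E) :
    IsClosed {p : Lp ℂ 2 (volume : Measure E) × Lp ℂ 2 (volume : Measure E) |
      IsWeakDeriv y p.1 p.2} := by
  have : {p : Lp ℂ 2 (volume : Measure E) × Lp ℂ 2 (volume : Measure E) |
      IsWeakDeriv y p.1 p.2} = ⋂ φ : 𝓢(E, ℂ),
      {p | Lp.toTemperedDistributionCLM ℂ volume 2 p.1 (-∂_{y} φ)
        = Lp.toTemperedDistributionCLM ℂ volume 2 p.2 φ} := by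
    ext p
    simp only [Set.mem_ofPred_eq, Set.mem_iInter]
    exact ⟨fun h φ => DFunLike.congr_fun h φ, fun h => by ext φ; exact h φ⟩
  rw [this]
  refine isClosed_iInter fun φ => isClosed_eq ?_ ?_
  · exact (continuous_eval_const _).comp
      ((Lp.toTemperedDistributionCLM ℂ volume 2).continuous.comp continuous_fst)
  · exact (continuous_eval_const _).comp
      ((Lp.toTemperedDistributionCLM ℂ volume 2).continuous.comp continuous_snd)

end Multipliers

/-! ### Strong convergence of multiplication operators and the transport commutator. -/

section Strong

variable {E : Type*} [NormedAddCommGroup E] [InnerProductSpace ℝ E] [FiniteDimensional ℝ E]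
  [MeasurableSpace E] [BorelSpace E]

/-- Dominated convergence for the squared norm. Only strong convergence can be expected: the cutoffs
used below do not converge uniformly. -/
theorem tendsto_mulOp_const {θ : ℕ → E →ᵇ ℂ} {η : E →ᵇ ℂ} {C : ℝ} (hC : ∀ n x, ‖θ n x‖ ≤ C)
    (hθ : ∀ x, Tendsto (fun n => θ n x) atTop (𝓝 (η x))) (f : Lp ℂ 2 (volume : Measure E)) :
    Tendsto (fun n => mulOp (θ n) f) atTop (𝓝 (mulOp η f)) := by
  have hη : ∀ x, ‖η x‖ ≤ C := fun x =>
    le_of_tendsto (hθ x).norm (Eventually.of_forall fun n => hC n x)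
  have hsq : ∀ n, ‖mulOp (θ n) f - mulOp η f‖ ^ 2 = ∫ x, (‖θ n x - η x‖ * ‖f x‖) ^ 2 := by
    intro n
    have h1 : mulOp (θ n) f - mulOp η f = mulOp (θ n - η) f := by
      have := mulOp_add (θ n - η) η f
      rw [sub_add_cancel] at this
      rw [this, add_sub_cancel_right]
    rw [h1, ← @inner_self_eq_norm_sq ℂ, L2.inner_def]
    have : ∀ᵐ x, inner ℂ ((mulOp (θ n - η) f) x) ((mulOp (θ n - η) f) x)
        = (((‖θ n x - η x‖ * ‖f x‖) ^ 2 : ℝ) : ℂ) := by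
      filter_upwards [coeFn_mulOp (θ n - η) f] with x hx
      rw [hx, inner_self_eq_norm_sq_to_K, norm_mul]
      simp
    rw [integral_congr_ae this, integral_complex_ofReal]
    simp [-Complex.ofReal_pow, -Complex.ofReal_mul]
  have hlim : Tendsto (fun n => ∫ x, (‖θ n x - η x‖ * ‖f x‖) ^ 2) atTop
      (𝓝 (∫ x : E, (0 : ℝ))) := by
    have hf2 := (memLp_two_iff_integrable_sq_norm (Lp.memLp f).1).1 (Lp.memLp f)
    refine tendsto_integral_of_dominated_convergence (fun x => (2 * C) ^ 2 * ‖f x‖ ^ 2) ?_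
      (hf2.const_mul _) ?_ ?_
    · intro n
      exact (((θ n).continuous.sub η.continuous).norm.aestronglyMeasurable.mul
        (Lp.memLp f).1.norm).pow 2
    · intro n
      refine Eventually.of_forall fun x => ?_
      rw [Real.norm_eq_abs, abs_of_nonneg (by positivity), mul_pow]
      gcongr
      calc ‖θ n x - η x‖ ≤ ‖θ n x‖ + ‖η x‖ := norm_sub_le _ _
        _ ≤ 2 * C := by linarith [hC n x, hη x]
    · refine Eventually.of_forall fun x => ?_
      have : Tendsto (fun n => θ n x - η x) atTop (𝓝 0) := by
        simpa using (hθ x).sub_const (η x)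
      simpa using (this.norm.mul_const ‖f x‖).pow 2
  rw [tendsto_iff_norm_sub_tendsto_zero]
  have h2 : Tendsto (fun n => ‖mulOp (θ n) f - mulOp η f‖ ^ 2) atTop (𝓝 0) := by
    simp only [hsq]
    simpa using hlim
  have h3 := h2.sqrt
  simpa [Real.sqrt_sq] using h3

theorem tendsto_mulOp {θ : ℕ → E →ᵇ ℂ} {η : E →ᵇ ℂ} {C : ℝ} (hC : ∀ n x, ‖θ n x‖ ≤ C)
    (hθ : ∀ x, Tendsto (fun n => θ n x) atTop (𝓝 (η x)))
    {f : ℕ → Lp ℂ 2 (volume : Measure E)} {g : Lp ℂ 2 (volume : Measure E)}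
    (hf : Tendsto f atTop (𝓝 g)) :
    Tendsto (fun n => mulOp (θ n) (f n)) atTop (𝓝 (mulOp η g)) := by
  have h1 := tendsto_mulOp_const hC hθ g
  have h2 : Tendsto (fun n => mulOp (θ n) (f n - g)) atTop (𝓝 0) := by
    refine squeeze_zero_norm (fun n => norm_mulOp_le (hC n) _) ?_
    have : Tendsto (fun n => f n - g) atTop (𝓝 0) := by simpa using hf.sub_const g
    simpa using this.norm.const_mul C
  simpa using h2.add h1

theorem IsWeakDeriv.inner_left {y : E} {h w h' w' : Lp ℂ 2 (volume : Measure E)}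
    (hw : IsWeakDeriv y h w) (hw' : IsWeakDeriv y h' w') :
    inner ℂ w h' = -inner ℂ h w' := by
  rw [isWeakDeriv_iff_fourier] at *
  rw [← Lp.inner_fourier_eq w, ← Lp.inner_fourier_eq h, L2.inner_def, L2.inner_def,
    ← integral_neg]
  refine integral_congr_ae ?_
  filter_upwards [hw, hw'] with ξ h1 h2
  have hc : (starRingEnd ℂ) 2 = 2 := Complex.conj_ofNat 2
  rw [h1, h2]
  simp [hc]
  ring

theorem mulOp_lineDeriv {θ dθ : E →ᵇ ℂ} {y : E} (hθ : (θ : E → ℂ).HasTemperateGrowth)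
    (hd : ∀ x, HasLineDerivAt ℝ θ (dθ x) x y) (φ : 𝓢(E, ℂ)) :
    (∂_{y} (SchwartzMap.smulLeftCLM ℂ (θ : E → ℂ) φ)).toLp 2
      = mulOp dθ (φ.toLp 2) + mulOp θ ((∂_{y} φ).toLp 2) := by
  refine Lp.ext ?_
  filter_upwards [(∂_{y} (SchwartzMap.smulLeftCLM ℂ (θ : E → ℂ) φ)).coeFn_toLp 2 volume,
    Lp.coeFn_add (mulOp dθ (φ.toLp 2)) (mulOp θ ((∂_{y} φ).toLp 2)),
    coeFn_mulOp dθ (φ.toLp 2), coeFn_mulOp θ ((∂_{y} φ).toLp 2), φ.coeFn_toLp 2 volume,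
    (∂_{y} φ).coeFn_toLp 2 volume] with x h1 h2 h3 h4 h5 h6
  rw [h1, h2, Pi.add_apply, h3, h4, h5, h6, SchwartzMap.lineDerivOp_apply]
  have h7 : HasLineDerivAt ℝ φ (∂_{y} φ x) x y := by
    rw [SchwartzMap.lineDerivOp_apply]
    exact (φ.differentiableAt.lineDifferentiableAt).hasLineDerivAt
  have h8 : HasLineDerivAt ℝ (fun v => θ v * φ v) (dθ x * φ x + θ x * ∂_{y} φ x) x y := by
    unfold HasLineDerivAt at *
    have := HasDerivAt.mul (hd x) h7
    simp only [zero_smul, add_zero] at this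
    exact this
  have h9 : (SchwartzMap.smulLeftCLM ℂ (θ : E → ℂ) φ : E → ℂ) = fun v => θ v * φ v := by
    ext v
    rw [SchwartzMap.smulLeftCLM_apply_apply hθ, smul_eq_mul]
  rw [h9, h8.lineDeriv]

/-- Since ∂_k is antisymmetric and ρ is real, the real part is half of a commutator, and the
commutator of ρ with ∂_k is multiplication by -∂_kρ. -/
theorem re_inner_mulOp_lineDeriv {ρ dρ : E →ᵇ ℂ} {k : E} (hρ : (ρ : E → ℂ).HasTemperateGrowth)
    (hs : star ρ = ρ) (hd : ∀ x, HasLineDerivAt ℝ ρ (dρ x) x k) (Y : 𝓢(E, ℂ)) :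
    (inner ℂ (mulOp ρ (Y.toLp 2 volume)) ((∂_{k} Y).toLp 2 volume)).re
      = -(1 / 2) * (inner ℂ (Y.toLp 2 volume) (mulOp dρ (Y.toLp 2 volume))).re := by
  have h1 : mulOp ρ ((∂_{k} Y).toLp 2 volume)
      = (∂_{k} (SchwartzMap.smulLeftCLM ℂ (ρ : E → ℂ) Y)).toLp 2 - mulOp dρ (Y.toLp 2 volume) := by
    rw [mulOp_lineDeriv hρ hd, add_sub_cancel_left]
  have h2 := (isWeakDeriv_toLp k Y).inner_left
    (isWeakDeriv_toLp k (SchwartzMap.smulLeftCLM ℂ (ρ : E → ℂ) Y))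
  rw [← mulOp_toLp hρ] at h2
  have h3 : inner ℂ (mulOp ρ (Y.toLp 2 volume)) ((∂_{k} Y).toLp 2 volume)
      = -inner ℂ ((∂_{k} Y).toLp 2 volume) (mulOp ρ (Y.toLp 2 volume))
        - inner ℂ (Y.toLp 2 volume) (mulOp dρ (Y.toLp 2 volume)) := by
    rw [inner_mulOp_left, hs, h1, inner_sub_right, h2]
    ring
  have h4 : (inner ℂ ((∂_{k} Y).toLp 2 volume) (mulOp ρ (Y.toLp 2 volume))).re
      = (inner ℂ (mulOp ρ (Y.toLp 2 volume)) ((∂_{k} Y).toLp 2 volume)).re := by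
    rw [← inner_conj_symm, Complex.conj_re]
  have h5 := congrArg Complex.re h3
  rw [Complex.sub_re, Complex.neg_re, h4] at h5
  linarith

/-- The commutator of a Fourier multiplier with the transport term, on Schwartz functions. -/
theorem re_inner_fmul_transport {ρ dρ : E →ᵇ ℂ} {k : E} (hρ : (ρ : E → ℂ).HasTemperateGrowth)
    (hs : star ρ = ρ) (hd : ∀ x, HasLineDerivAt ℝ ρ (dρ x) x k) (y : 𝓢(E, ℂ)) :
    (Complex.I * inner ℂ (fmul ρ (y.toLp 2 volume))
      ((SchwartzMap.smulLeftCLM ℂ (fun v : E => ((inner ℝ v k : ℝ) : ℂ)) y).toLp 2 volume)).re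
    = (1 / (4 * Real.pi)) * (inner ℂ (y.toLp 2 volume) (fmul dρ (y.toLp 2 volume))).re := by
  set Y : 𝓢(E, ℂ) := 𝓕 y with hY
  have e1 : 𝓕 ((SchwartzMap.smulLeftCLM ℂ (fun v : E => ((inner ℝ v k : ℝ) : ℂ)) y).toLp 2 volume)
      = (Complex.I / (2 * Real.pi)) • (∂_{k} Y).toLp 2 := by
    have hc : (Complex.I / (2 * Real.pi)) * (-(2 * Real.pi * Complex.I)) = 1 := by
      have : (Real.pi : ℂ) ≠ 0 := by exact_mod_cast Real.pi_ne_zero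
      field_simp
      linear_combination -Complex.I_sq
    rw [SchwartzMap.toLp_fourier_eq (SchwartzMap.smulLeftCLM ℂ _ y), hY,
      SchwartzMap.lineDerivOp_fourier_eq]
    have h2 : ∀ a : 𝓢(E, ℂ), (Complex.I / (2 * Real.pi)) •
        (𝓕 ((-(2 * Real.pi * Complex.I)) • a) : 𝓢(E, ℂ)).toLp 2 (volume : Measure E)
        = (𝓕 a : 𝓢(E, ℂ)).toLp 2 volume := by
      intro a
      rw [FourierTransform.fourier_smul]
      have := (SchwartzMap.toLpCLM ℂ ℂ 2 (volume : Measure E)).map_smul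
        (-(2 * Real.pi * Complex.I)) (𝓕 a)
      rw [SchwartzMap.toLpCLM_apply, SchwartzMap.toLpCLM_apply] at this
      rw [this, smul_smul, hc, one_smul]
    have h3 : SchwartzMap.smulLeftCLM ℂ (fun v : E => ((inner ℝ v k : ℝ) : ℂ)) y
        = SchwartzMap.smulLeftCLM ℂ (fun v : E => inner ℝ v k) y :=
      SchwartzMap.smulLeftCLM_ofReal ℂ (Function.hasTemperateGrowth_inner_left k) y
    rw [h2, h3]
  rw [← Lp.inner_fourier_eq, fourier_fmul, e1, ← Lp.inner_fourier_eq (y.toLp 2 volume), fourier_fmul,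
    SchwartzMap.toLp_fourier_eq, inner_smul_right]
  have e2 := re_inner_mulOp_lineDeriv hρ hs hd Y
  have e3 : Complex.I * (Complex.I / (2 * Real.pi) *
      inner ℂ (mulOp ρ (Y.toLp 2 volume)) ((∂_{k} Y).toLp 2 volume))
      = ((-(1 / (2 * Real.pi)) : ℝ) : ℂ) * inner ℂ (mulOp ρ (Y.toLp 2 volume)) ((∂_{k} Y).toLp 2 volume) := by
    push_cast
    linear_combination (inner ℂ (mulOp ρ (Y.toLp 2 volume)) ((∂_{k} Y).toLp 2 volume) / (2 * Real.pi))
      * Complex.I_sq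
  rw [e3, Complex.re_ofReal_mul, e2]
  field_simp
  ring

end Strong

/-! ### Velocity cutoffs. -/

section Cutoff

variable {E : Type*} [NormedAddCommGroup E] [InnerProductSpace ℝ E]

theorem cutoff_pos (ε : ℝ) (v : E) : 0 < 1 + ‖ε • v‖ ^ 2 := by positivity

theorem norm_smul_div_cutoff_le (ε : ℝ) (v : E) : ‖ε • v‖ / (1 + ‖ε • v‖ ^ 2) ≤ 1 := by
  rw [div_le_one (cutoff_pos ε v)]
  nlinarith [sq_nonneg (‖ε • v‖ - 1)]

/-- The position cutoff `(1 + ε² |v|²)⁻¹`. -/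
def cutoff (ε : ℝ) : E →ᵇ ℂ :=
  BoundedContinuousFunction.ofNormedAddCommGroup
    (fun v => (((1 + ‖ε • v‖ ^ 2)⁻¹ : ℝ) : ℂ))
    (Complex.continuous_ofReal.comp (Continuous.inv₀ (by fun_prop)
      fun v => (cutoff_pos ε v).ne')) 1 (fun v => by
      rw [Complex.norm_real, Real.norm_eq_abs, abs_of_pos (inv_pos.2 (cutoff_pos ε v))]
      exact inv_le_one_of_one_le₀ (by linarith [sq_nonneg ‖ε • v‖]))

theorem cutoff_apply (ε : ℝ) (v : E) : cutoff ε v = (((1 + ‖ε • v‖ ^ 2)⁻¹ : ℝ) : ℂ) := rfl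

theorem norm_cutoff_le (ε : ℝ) (v : E) : ‖cutoff ε v‖ ≤ 1 := by
  rw [cutoff_apply, Complex.norm_real, Real.norm_eq_abs, abs_of_pos (inv_pos.2 (cutoff_pos ε v))]
  exact inv_le_one_of_one_le₀ (by linarith [sq_nonneg ‖ε • v‖])

theorem cutoff_hasTemperateGrowth (ε : ℝ) : (cutoff ε : E → ℂ).HasTemperateGrowth := by
  have h1 : (fun x : E => ((1 + ‖x‖ ^ 2) ^ (-1 : ℝ) : ℝ)).HasTemperateGrowth :=
    Function.hasTemperateGrowth_one_add_norm_sq_rpow E (-1)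
  have h2 : (fun x : E => ε • x).HasTemperateGrowth :=
    (ε • ContinuousLinearMap.id ℝ E).hasTemperateGrowth
  have h3 := Function.HasTemperateGrowth.comp Function.Complex.hasTemperateGrowth_ofReal
    (Function.HasTemperateGrowth.comp h1 h2)
  have h4 : (cutoff ε : E → ℂ) = Complex.ofReal ∘ (fun x : E => ((1 + ‖x‖ ^ 2) ^ (-1 : ℝ) : ℝ)) ∘
      fun x : E => ε • x := by
    funext v
    simp [cutoff_apply, Real.rpow_neg_one]
  rw [h4]
  exact h3

/-- The product of the transport multiplier `k · v` with the cutoff. -/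
def transportCutoff (k : E) {ε : ℝ} (hε : 0 < ε) : E →ᵇ ℂ :=
  BoundedContinuousFunction.ofNormedAddCommGroup
    (fun v => ((inner ℝ v k : ℝ) : ℂ) * cutoff ε v)
    ((Complex.continuous_ofReal.comp (by fun_prop)).mul (cutoff ε).continuous) (‖k‖ / ε)
    (fun v => by
      have h := norm_smul_div_cutoff_le ε v
      rw [norm_smul, Real.norm_eq_abs, abs_of_pos hε] at h
      rw [norm_mul, cutoff_apply, Complex.norm_real, Complex.norm_real, Real.norm_eq_abs,
        Real.norm_eq_abs, abs_of_pos (inv_pos.2 (cutoff_pos ε v)), norm_smul, Real.norm_eq_abs,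
        abs_of_pos hε]
      calc |inner ℝ v k| * (1 + (ε * ‖v‖) ^ 2)⁻¹
          ≤ (‖v‖ * ‖k‖) * (1 + (ε * ‖v‖) ^ 2)⁻¹ := by
            gcongr; exact abs_real_inner_le_norm v k
        _ = (‖k‖ / ε) * (ε * ‖v‖ / (1 + (ε * ‖v‖) ^ 2)) := by field_simp
        _ ≤ (‖k‖ / ε) * 1 := by gcongr
        _ = ‖k‖ / ε := mul_one _)

/-- The derivative of the cutoff in the direction `y`. -/
def cutoffDeriv (y : E) (ε : ℝ) : E →ᵇ ℂ :=
  BoundedContinuousFunction.ofNormedAddCommGroup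
    (fun v => ((-(2 * ε ^ 2 * inner ℝ v y) * ((1 + ‖ε • v‖ ^ 2)⁻¹) ^ 2 : ℝ) : ℂ))
    (Complex.continuous_ofReal.comp (Continuous.mul (by fun_prop) (Continuous.pow
      (Continuous.inv₀ (by fun_prop) fun v => (cutoff_pos ε v).ne') 2))) (2 * |ε| * ‖y‖)
    (fun v => by
      have h := norm_smul_div_cutoff_le ε v
      have h1 : (1 + ‖ε • v‖ ^ 2)⁻¹ ≤ 1 :=
        inv_le_one_of_one_le₀ (by linarith [sq_nonneg ‖ε • v‖])
      have h0 := inv_pos.2 (cutoff_pos ε v)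
      rw [Complex.norm_real, Real.norm_eq_abs, abs_mul, abs_neg, abs_mul, abs_pow _ 2,
        abs_of_pos h0, abs_mul, abs_pow, abs_two]
      calc 2 * |ε| ^ 2 * |inner ℝ v y| * ((1 + ‖ε • v‖ ^ 2)⁻¹) ^ 2
          ≤ 2 * |ε| ^ 2 * (‖v‖ * ‖y‖) * ((1 + ‖ε • v‖ ^ 2)⁻¹ * 1) := by
            rw [sq (1 + ‖ε • v‖ ^ 2)⁻¹]
            gcongr
            exact abs_real_inner_le_norm v y
        _ = 2 * |ε| * ‖y‖ * (‖ε • v‖ / (1 + ‖ε • v‖ ^ 2)) := by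
            rw [norm_smul, Real.norm_eq_abs]; field_simp
        _ ≤ 2 * |ε| * ‖y‖ * 1 := by gcongr
        _ = 2 * |ε| * ‖y‖ := mul_one _)

theorem norm_cutoffDeriv_le (y : E) (ε : ℝ) (v : E) : ‖cutoffDeriv y ε v‖ ≤ 2 * |ε| * ‖y‖ :=
  ((cutoffDeriv y ε).norm_coe_le_norm v).trans
    (BoundedContinuousFunction.norm_ofNormedAddCommGroup_le _ (by positivity) _)

theorem hasLineDerivAt_cutoff (y : E) (ε : ℝ) (v : E) :
    HasLineDerivAt ℝ (cutoff ε : E → ℂ) (cutoffDeriv y ε v) v y := by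
  unfold HasLineDerivAt
  have h0 : HasDerivAt (fun t : ℝ => 1 + ‖ε • (v + t • y)‖ ^ 2)
      (2 * ε ^ 2 * inner ℝ v y) 0 := by
    have h1 : (fun t : ℝ => 1 + ‖ε • (v + t • y)‖ ^ 2)
        = fun t : ℝ => 1 + ε ^ 2 * (‖v‖ ^ 2 + 2 * (t * inner ℝ v y) + t ^ 2 * ‖y‖ ^ 2) := by
      ext t
      rw [norm_smul, mul_pow, Real.norm_eq_abs, sq_abs, @norm_add_sq_real, norm_smul, mul_pow,
        Real.norm_eq_abs, sq_abs, inner_smul_right]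
    rw [h1]
    have h2 : HasDerivAt (fun t : ℝ => ‖v‖ ^ 2 + 2 * (t * inner ℝ v y) + t ^ 2 * ‖y‖ ^ 2)
        (2 * inner ℝ v y) 0 := by
      have a := ((hasDerivAt_id (0 : ℝ)).mul_const (inner ℝ v y)).const_mul 2
      have b := ((hasDerivAt_id (0 : ℝ)).pow 2).mul_const (‖y‖ ^ 2)
      have c := (a.const_add (‖v‖ ^ 2)).add b
      refine (c.congr_deriv ?_)
      simp
    refine ((h2.const_mul (ε ^ 2)).const_add 1).congr_deriv ?_
    ring
  have h2 := (h0.inv (cutoff_pos ε _).ne').ofReal_comp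
  have h3 : (fun t : ℝ => (cutoff ε : E → ℂ) (v + t • y))
      = fun t : ℝ => ((((fun t : ℝ => 1 + ‖ε • (v + t • y)‖ ^ 2)⁻¹ t : ℝ)) : ℂ) := by
    ext t; rfl
  rw [h3]
  refine h2.congr_deriv ?_
  change _ = ((-(2 * ε ^ 2 * inner ℝ v y) * ((1 + ‖ε • v‖ ^ 2)⁻¹) ^ 2 : ℝ) : ℂ)
  congr 1
  simp [div_eq_mul_inv]

theorem tendsto_cutoff (v : E) :
    Tendsto (fun n : ℕ => cutoff (1 / ((n : ℝ) + 1)) v) atTop (𝓝 1) := by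
  have h1 : Tendsto (fun n : ℕ => (1 / ((n : ℝ) + 1)) • v) atTop (𝓝 ((0 : ℝ) • v)) :=
    tendsto_one_div_add_atTop_nhds_zero_nat.smul_const v
  have h2 : Tendsto (fun n : ℕ => (1 + ‖(1 / ((n : ℝ) + 1)) • v‖ ^ 2)⁻¹) atTop (𝓝 1) := by
    have := ((h1.norm.pow 2).const_add 1).inv₀ (by simp)
    simpa using this
  have := (Complex.continuous_ofReal.tendsto _).comp h2
  simpa [Function.comp_def, cutoff_apply] using this

end Cutoff

/-! ### Weak gradients, density of Schwartz functions in H¹, and the energy identity. -/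

section Gradient

variable {ι : Type*} [Fintype ι] [DecidableEq ι]

/-- The family `w` is the weak gradient of `h ∈ L²(ℝ^ι)`. -/
def HasGrad (h : Lp ℂ 2 (volume : Measure (EuclideanSpace ℝ ι)))
    (w : ι → Lp ℂ 2 (volume : Measure (EuclideanSpace ℝ ι))) : Prop :=
  ∀ e, IsWeakDeriv (EuclideanSpace.single e (1 : ℝ)) h (w e)

theorem hasGrad_toLp (φ : 𝓢(EuclideanSpace ℝ ι, ℂ)) :
    HasGrad (φ.toLp 2 volume)
      (fun e => (∂_{EuclideanSpace.single e (1 : ℝ)} φ).toLp 2 volume) :=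
  fun _ => isWeakDeriv_toLp _ φ

variable {h h' : Lp ℂ 2 (volume : Measure (EuclideanSpace ℝ ι))}
  {w w' : ι → Lp ℂ 2 (volume : Measure (EuclideanSpace ℝ ι))}

theorem HasGrad.add (hw : HasGrad h w) (hw' : HasGrad h' w') : HasGrad (h + h') (w + w') :=
  fun e => (hw e).add (hw' e)

theorem HasGrad.sub (hw : HasGrad h w) (hw' : HasGrad h' w') : HasGrad (h - h') (w - w') :=
  fun e => (hw e).sub (hw' e)

theorem HasGrad.smul (hw : HasGrad h w) (c : ℂ) : HasGrad (c • h) (c • w) :=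
  fun e => (hw e).smul c

theorem HasGrad.map_fmul (hw : HasGrad h w) (ρ : EuclideanSpace ℝ ι →ᵇ ℂ) :
    HasGrad (fmul ρ h) (fun e => fmul ρ (w e)) :=
  fun e => (hw e).fmul ρ

theorem one_add_norm_sq_rpow_le_one {E : Type*} [NormedAddCommGroup E] (x : E) :
    (1 + ‖x‖ ^ 2) ^ (-1 / 2 : ℝ) ≤ 1 :=
  Real.rpow_le_one_of_one_le_of_nonpos (by nlinarith [sq_nonneg ‖x‖]) (by norm_num)

theorem norm_mul_one_add_norm_sq_rpow_le_one {E : Type*} [NormedAddCommGroup E] (x : E) :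
    ‖x‖ * (1 + ‖x‖ ^ 2) ^ (-1 / 2 : ℝ) ≤ 1 := by
  have h0 : 0 < 1 + ‖x‖ ^ 2 := by positivity
  rw [show (-1 / 2 : ℝ) = -(1 / 2) by norm_num, Real.rpow_neg h0.le, ← Real.sqrt_eq_rpow,
    ← div_eq_mul_inv, div_le_one (Real.sqrt_pos.2 h0)]
  exact Real.le_sqrt_of_sq_le (by linarith)

/-- The symbol `(1 + |ξ|²)^{-1/2}`. -/
def besselSymbol (E : Type*) [NormedAddCommGroup E] : E →ᵇ ℂ :=
  BoundedContinuousFunction.ofNormedAddCommGroup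
    (fun x => (((1 + ‖x‖ ^ 2) ^ (-1 / 2 : ℝ) : ℝ) : ℂ))
    (Complex.continuous_ofReal.comp (Continuous.rpow_const (by fun_prop)
      fun x => Or.inl (by positivity))) 1 (fun x => by
      rw [Complex.norm_real, Real.norm_eq_abs, abs_of_nonneg (by positivity)]
      exact one_add_norm_sq_rpow_le_one x)

/-- The symbol `2πi ⟨ξ, y⟩ (1 + |ξ|²)^{-1/2}`. -/
def besselDerivSymbol {E : Type*} [NormedAddCommGroup E] [InnerProductSpace ℝ E] (y : E) :
    E →ᵇ ℂ :=
  BoundedContinuousFunction.ofNormedAddCommGroup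
    (fun x => 2 * Real.pi * Complex.I * (inner ℝ x y : ℝ) *
      (((1 + ‖x‖ ^ 2) ^ (-1 / 2 : ℝ) : ℝ) : ℂ))
    (Continuous.mul (by fun_prop)
      (Complex.continuous_ofReal.comp (Continuous.rpow_const (by fun_prop)
      fun x => Or.inl (by positivity)))) (2 * Real.pi * ‖y‖) (fun x => by
      have h1 := norm_mul_one_add_norm_sq_rpow_le_one x
      have h0 : 0 ≤ (1 + ‖x‖ ^ 2) ^ (-1 / 2 : ℝ) := by positivity
      simp only [norm_mul, Complex.norm_I, mul_one, Complex.norm_real, Real.norm_eq_abs,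
        abs_of_nonneg h0, Complex.norm_ofNat, abs_of_pos Real.pi_pos]
      calc 2 * Real.pi * |inner ℝ x y| * (1 + ‖x‖ ^ 2) ^ (-1 / 2 : ℝ)
          ≤ 2 * Real.pi * (‖x‖ * ‖y‖) * (1 + ‖x‖ ^ 2) ^ (-1 / 2 : ℝ) := by
            gcongr; exact abs_real_inner_le_norm x y
        _ = 2 * Real.pi * ‖y‖ * (‖x‖ * (1 + ‖x‖ ^ 2) ^ (-1 / 2 : ℝ)) := by ring
        _ ≤ 2 * Real.pi * ‖y‖ * 1 := by gcongr
        _ = 2 * Real.pi * ‖y‖ := mul_one _)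

theorem besselSymbol_hasTemperateGrowth (E : Type*) [NormedAddCommGroup E]
    [InnerProductSpace ℝ E] : (besselSymbol E : E → ℂ).HasTemperateGrowth := by
  change (fun x : E => (((1 + ‖x‖ ^ 2) ^ (-1 / 2 : ℝ) : ℝ) : ℂ)).HasTemperateGrowth
  fun_prop

theorem isWeakDeriv_besselSymbol {E : Type*} [NormedAddCommGroup E] [InnerProductSpace ℝ E]
    [FiniteDimensional ℝ E] [MeasurableSpace E] [BorelSpace E] (y : E)
    (f : Lp ℂ 2 (volume : Measure E)) :
    IsWeakDeriv y (fmul (besselSymbol E) f) (fmul (besselDerivSymbol y) f) := by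
  rw [isWeakDeriv_iff_fourier]
  simp only [fourier_fmul]
  filter_upwards [coeFn_mulOp (besselSymbol E) (𝓕 f), coeFn_mulOp (besselDerivSymbol y) (𝓕 f)]
    with ξ h1 h2
  rw [h1, h2]
  change 2 * Real.pi * Complex.I * (inner ℝ ξ y : ℝ) *
      (((1 + ‖ξ‖ ^ 2) ^ (-1 / 2 : ℝ) : ℝ) : ℂ) * _ = _ * ((((1 + ‖ξ‖ ^ 2) ^ (-1 / 2 : ℝ) : ℝ) : ℂ) * _)
  ring

/-- The Fourier transform of the preimage is (1 + |ξ|²)^(1/2) ĥ, square integrable because |ξ|²|ĥ|²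
is a multiple of the sum of the squares of the transformed derivatives. Density in H¹ is thereby
reduced to density in L². -/
theorem HasGrad.exists_eq_fmul_besselSymbol (hw : HasGrad h w) :
    ∃ g, fmul (besselSymbol (EuclideanSpace ℝ ι)) g = h := by
  set F : Lp ℂ 2 (volume : Measure (EuclideanSpace ℝ ι)) := 𝓕 h with hF
  have hmem : MemLp (fun ξ => (((1 + ‖ξ‖ ^ 2) ^ (1 / 2 : ℝ) : ℝ) : ℂ) * F ξ) 2 volume := by
    have hm : AEStronglyMeasurable (fun ξ : EuclideanSpace ℝ ι =>
        (((1 + ‖ξ‖ ^ 2) ^ (1 / 2 : ℝ) : ℝ) : ℂ) * F ξ) volume :=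
      (Complex.continuous_ofReal.comp (Continuous.rpow_const (by fun_prop)
        fun x => Or.inl (by positivity))).aestronglyMeasurable.mul (Lp.memLp F).1
    rw [memLp_two_iff_integrable_sq_norm hm]
    have i1 := (memLp_two_iff_integrable_sq_norm (Lp.memLp F).1).1 (Lp.memLp F)
    have i2 : ∀ e, Integrable
        (fun ξ => ‖(𝓕 (w e) : Lp ℂ 2 (volume : Measure (EuclideanSpace ℝ ι))) ξ‖ ^ 2) := fun e =>
      (memLp_two_iff_integrable_sq_norm (Lp.memLp _).1).1 (Lp.memLp _)
    have i3 := i1.add ((integrable_finsetSum Finset.univ fun e _ => i2 e).const_mul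
      ((2 * Real.pi) ^ 2)⁻¹)
    refine i3.congr ?_
    have hall : ∀ᵐ ξ, ∀ e, (𝓕 (w e) : Lp ℂ 2 (volume : Measure (EuclideanSpace ℝ ι))) ξ
        = (2 * Real.pi * Complex.I * (inner ℝ ξ (EuclideanSpace.single e (1 : ℝ)) : ℝ)) * F ξ :=
      ae_all_iff.2 fun e => (isWeakDeriv_iff_fourier _ _ _).1 (hw e)
    filter_upwards [hall] with ξ hξ
    have h0 : 0 ≤ 1 + ‖ξ‖ ^ 2 := by positivity
    simp only [Pi.add_apply, hξ, norm_mul, mul_pow, Complex.norm_real, Real.norm_eq_abs, sq_abs,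
      Complex.norm_I, Complex.norm_ofNat, EuclideanSpace.inner_single_right]
    rw [← Real.sqrt_eq_rpow, Real.sq_sqrt h0]
    simp only [EuclideanSpace.norm_sq_eq, one_mul, conj_trivial, one_pow, mul_one, Real.norm_eq_abs,
      sq_abs, ← Finset.sum_mul, ← Finset.mul_sum]
    have := Real.pi_ne_zero
    field_simp
  refine ⟨𝓕⁻ (hmem.toLp _), fourier_injective_L2 ?_⟩
  rw [fourier_fmul, FourierTransform.fourier_fourierInv_eq]
  refine mulOp_eq_of_ae ?_
  filter_upwards [hmem.coeFn_toLp] with ξ hξ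
  rw [hξ]
  change (((1 + ‖ξ‖ ^ 2) ^ (-1 / 2 : ℝ) : ℝ) : ℂ) * _ = F ξ
  rw [← mul_assoc, ← Complex.ofReal_mul, ← Real.rpow_add (by positivity)]
  norm_num

/-- Schwartz functions are dense in `H¹`. -/
theorem HasGrad.exists_schwartz_tendsto (hw : HasGrad h w) :
    ∃ ψ : ℕ → 𝓢(EuclideanSpace ℝ ι, ℂ),
      Tendsto (fun n => (ψ n).toLp 2 volume) atTop (𝓝 h) ∧
      ∀ e, Tendsto (fun n => (∂_{EuclideanSpace.single e (1 : ℝ)} (ψ n)).toLp 2 volume) atTop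
        (𝓝 (w e)) := by
  obtain ⟨g, hg⟩ := hw.exists_eq_fmul_besselSymbol
  have hd := SchwartzMap.denseRange_toLpCLM (E := EuclideanSpace ℝ ι) (F := ℂ) (p := 2)
    (μ := volume) ENNReal.ofNat_ne_top
  obtain ⟨u, hu, hlim⟩ := mem_closure_iff_seq_limit.1 (hd g)
  choose ψ hψ using hu
  have hψ' : ∀ n, (ψ n).toLp 2 volume = u n := hψ
  have hT := besselSymbol_hasTemperateGrowth (EuclideanSpace ℝ ι)
  have e1 : ∀ n, (SchwartzMap.fourierMultiplierCLM ℂ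
      (besselSymbol (EuclideanSpace ℝ ι) : _ → ℂ) (ψ n)).toLp 2 volume
      = fmul (besselSymbol (EuclideanSpace ℝ ι)) (u n) := fun n => by
    rw [← fmul_toLp hT, hψ']
  refine ⟨fun n => SchwartzMap.fourierMultiplierCLM ℂ
    (besselSymbol (EuclideanSpace ℝ ι) : _ → ℂ) (ψ n), ?_, fun e => ?_⟩
  · simp only [e1]
    rw [← hg]
    exact ((fmul _).continuous.tendsto _).comp hlim
  · have e2 : ∀ n, (∂_{EuclideanSpace.single e (1 : ℝ)} (SchwartzMap.fourierMultiplierCLM ℂ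
        (besselSymbol (EuclideanSpace ℝ ι) : _ → ℂ) (ψ n))).toLp 2 volume
        = fmul (besselDerivSymbol (EuclideanSpace.single e (1 : ℝ))) (u n) := fun n => by
      have h1 := isWeakDeriv_toLp (EuclideanSpace.single e (1 : ℝ))
        (SchwartzMap.fourierMultiplierCLM ℂ (besselSymbol (EuclideanSpace ℝ ι) : _ → ℂ) (ψ n))
      rw [e1] at h1
      exact h1.unique (isWeakDeriv_besselSymbol _ _)
    have e3 : w e = fmul (besselDerivSymbol (EuclideanSpace.single e (1 : ℝ))) g := by
      have h1 := hw e
      rw [← hg] at h1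
      exact h1.unique (isWeakDeriv_besselSymbol _ _)
    simp only [e2]
    rw [e3]
    exact ((fmul _).continuous.tendsto _).comp hlim

/-! ### The transport equation -/

/-- The weak form of `i k · v h + p - div s = 0`. -/
def TransportEq (k : EuclideanSpace ℝ ι) (h p : Lp ℂ 2 (volume : Measure (EuclideanSpace ℝ ι)))
    (s : ι → Lp ℂ 2 (volume : Measure (EuclideanSpace ℝ ι))) : Prop :=
  ∀ φ : 𝓢(EuclideanSpace ℝ ι, ℂ),
    Complex.I * inner ℂ
        ((SchwartzMap.smulLeftCLM ℂ (fun v => ((inner ℝ v k : ℝ) : ℂ)) φ).toLp 2 volume) h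
      + inner ℂ (φ.toLp 2 volume) p
      + ∑ e, inner ℂ ((∂_{EuclideanSpace.single e (1 : ℝ)} φ).toLp 2 volume) (s e) = 0

variable {k : EuclideanSpace ℝ ι} {p : Lp ℂ 2 (volume : Measure (EuclideanSpace ℝ ι))}
  {s : ι → Lp ℂ 2 (volume : Measure (EuclideanSpace ℝ ι))}

theorem transportCutoff_toLp {E : Type*} [NormedAddCommGroup E] [InnerProductSpace ℝ E]
    [FiniteDimensional ℝ E] [MeasurableSpace E] [BorelSpace E] (k : E) {ε : ℝ} (hε : 0 < ε)
    (ψ : 𝓢(E, ℂ)) :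
    (SchwartzMap.smulLeftCLM ℂ (fun v => ((inner ℝ v k : ℝ) : ℂ))
      (SchwartzMap.smulLeftCLM ℂ (cutoff ε : E → ℂ) ψ)).toLp 2 volume
      = mulOp (transportCutoff k hε) (ψ.toLp 2 volume) := by
  have h1 : (fun v : E => ((inner ℝ v k : ℝ) : ℂ)).HasTemperateGrowth := by fun_prop
  have h2 := cutoff_hasTemperateGrowth (E := E) ε
  have h3 : (transportCutoff k hε : E → ℂ).HasTemperateGrowth := h1.mul h2
  rw [SchwartzMap.smulLeftCLM_smulLeftCLM_apply h1 h2, mulOp_toLp h3]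
  rfl

/-- The transport equation tested against `θ M_ρ (θ h)` for a cutoff `θ`. -/
theorem TransportEq.test_cutoff (ht : TransportEq k h p s) (hw : HasGrad h' w')
    {ρ : EuclideanSpace ℝ ι →ᵇ ℂ} (hρ : (ρ : _ → ℂ).HasTemperateGrowth) {ε : ℝ} (hε : 0 < ε) :
    Complex.I * inner ℂ (mulOp (transportCutoff k hε) (fmul ρ (mulOp (cutoff ε) h'))) h
      + inner ℂ (mulOp (cutoff ε) (fmul ρ (mulOp (cutoff ε) h'))) p
      + ∑ e, inner ℂ (mulOp (cutoffDeriv (EuclideanSpace.single e (1 : ℝ)) ε)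
            (fmul ρ (mulOp (cutoff ε) h')) + mulOp (cutoff ε) (fmul ρ
          (mulOp (cutoffDeriv (EuclideanSpace.single e (1 : ℝ)) ε) h'
            + mulOp (cutoff ε) (w' e)))) (s e) = 0 := by
  obtain ⟨ψ, h1, h2⟩ := hw.exists_schwartz_tendsto
  have hθ := cutoff_hasTemperateGrowth (E := EuclideanSpace ℝ ι) ε
  have key : ∀ n, Complex.I * inner ℂ (mulOp (transportCutoff k hε)
        (fmul ρ (mulOp (cutoff ε) ((ψ n).toLp 2 volume)))) h
      + inner ℂ (mulOp (cutoff ε) (fmul ρ (mulOp (cutoff ε) ((ψ n).toLp 2 volume)))) p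
      + ∑ e, inner ℂ (mulOp (cutoffDeriv (EuclideanSpace.single e (1 : ℝ)) ε)
            (fmul ρ (mulOp (cutoff ε) ((ψ n).toLp 2 volume))) + mulOp (cutoff ε) (fmul ρ
          (mulOp (cutoffDeriv (EuclideanSpace.single e (1 : ℝ)) ε) ((ψ n).toLp 2 volume)
            + mulOp (cutoff ε)
              ((∂_{EuclideanSpace.single e (1 : ℝ)} (ψ n)).toLp 2 volume)))) (s e) = 0 := by
    intro n
    -- The test function θ M_ρ θ ψ is again Schwartz, because θ and ρ have temperate growth.
    -- Afterwards ψ is replaced by its H¹ limit, every operator involved being bounded on L².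
    have ha := ht (SchwartzMap.smulLeftCLM ℂ (cutoff ε : _ → ℂ)
      (SchwartzMap.fourierMultiplierCLM ℂ (ρ : _ → ℂ)
        (SchwartzMap.smulLeftCLM ℂ (cutoff ε : _ → ℂ) (ψ n))))
    have hd : ∀ e, (∂_{EuclideanSpace.single e (1 : ℝ)}
        (SchwartzMap.fourierMultiplierCLM ℂ (ρ : _ → ℂ)
          (SchwartzMap.smulLeftCLM ℂ (cutoff ε : _ → ℂ) (ψ n)))).toLp 2 volume
        = fmul ρ (mulOp (cutoffDeriv (EuclideanSpace.single e (1 : ℝ)) ε) ((ψ n).toLp 2 volume)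
            + mulOp (cutoff ε)
              ((∂_{EuclideanSpace.single e (1 : ℝ)} (ψ n)).toLp 2 volume)) := by
      intro e
      have h3 := isWeakDeriv_toLp (EuclideanSpace.single e (1 : ℝ))
        (SchwartzMap.fourierMultiplierCLM ℂ (ρ : _ → ℂ)
          (SchwartzMap.smulLeftCLM ℂ (cutoff ε : _ → ℂ) (ψ n)))
      have h4 := (isWeakDeriv_toLp (EuclideanSpace.single e (1 : ℝ))
        (SchwartzMap.smulLeftCLM ℂ (cutoff ε : _ → ℂ) (ψ n))).fmul ρ
      rw [fmul_toLp hρ] at h4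
      rw [h3.unique h4, mulOp_lineDeriv hθ (hasLineDerivAt_cutoff _ ε)]
    simp only [transportCutoff_toLp k hε, ← mulOp_toLp hθ,
      mulOp_lineDeriv hθ (hasLineDerivAt_cutoff _ ε), hd, ← fmul_toLp hρ] at ha
    exact ha
  have hf : ∀ T : Lp ℂ 2 (volume : Measure (EuclideanSpace ℝ ι)) →L[ℂ]
      Lp ℂ 2 (volume : Measure (EuclideanSpace ℝ ι)),
      Tendsto (fun n => T ((ψ n).toLp 2 volume)) atTop (𝓝 (T h')) := fun T =>
    (T.continuous.tendsto _).comp h1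
  have hg : ∀ e, ∀ T : Lp ℂ 2 (volume : Measure (EuclideanSpace ℝ ι)) →L[ℂ]
      Lp ℂ 2 (volume : Measure (EuclideanSpace ℝ ι)),
      Tendsto (fun n => T ((∂_{EuclideanSpace.single e (1 : ℝ)} (ψ n)).toLp 2 volume)) atTop
        (𝓝 (T (w' e))) := fun e T =>
    (T.continuous.tendsto _).comp (h2 e)
  refine tendsto_nhds_unique (f := fun _ : ℕ => (0 : ℂ)) (l := atTop) ?_ tendsto_const_nhds
  refine Tendsto.congr key ?_
  simp only [map_add]
  refine ((((hf (mulOp (transportCutoff k hε) ∘L fmul ρ ∘L mulOp (cutoff ε))).inner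
    tendsto_const_nhds).const_mul _).add ((hf (mulOp (cutoff ε) ∘L fmul ρ ∘L
      mulOp (cutoff ε))).inner tendsto_const_nhds)).add (tendsto_finsetSum _ fun e _ => ?_)
  refine Tendsto.inner ?_ tendsto_const_nhds
  exact (hf (mulOp (cutoffDeriv (EuclideanSpace.single e (1 : ℝ)) ε) ∘L fmul ρ ∘L
    mulOp (cutoff ε))).add ((hf (mulOp (cutoff ε) ∘L fmul ρ ∘L
      mulOp (cutoffDeriv (EuclideanSpace.single e (1 : ℝ)) ε))).add
      (hg e (mulOp (cutoff ε) ∘L fmul ρ ∘L mulOp (cutoff ε))))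

/-- Placing a cutoff on both sides of M_ρ makes this the commutator identity for the single function
θf. With k·v θ bounded, both sides are continuous in f, so Schwartz functions suffice. -/
theorem re_inner_transportCutoff {E : Type*} [NormedAddCommGroup E] [InnerProductSpace ℝ E]
    [FiniteDimensional ℝ E] [MeasurableSpace E] [BorelSpace E] {k : E}
    {ρ dρ : E →ᵇ ℂ} (hρ : (ρ : E → ℂ).HasTemperateGrowth)
    (hs : star ρ = ρ) (hd : ∀ x, HasLineDerivAt ℝ ρ (dρ x) x k) {ε : ℝ} (hε : 0 < ε)
    (f : Lp ℂ 2 (volume : Measure E)) :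
    (Complex.I * inner ℂ (mulOp (transportCutoff k hε) (fmul ρ (mulOp (cutoff ε) f))) f).re
      = (1 / (4 * Real.pi)) *
        (inner ℂ (mulOp (cutoff ε) f) (fmul dρ (mulOp (cutoff ε) f))).re := by
  have hθ := cutoff_hasTemperateGrowth (E := E) ε
  have hstar : star (transportCutoff k hε) = transportCutoff k hε := by
    ext v
    change conj (((inner ℝ v k : ℝ) : ℂ) * (((1 + ‖ε • v‖ ^ 2)⁻¹ : ℝ) : ℂ))
      = ((inner ℝ v k : ℝ) : ℂ) * (((1 + ‖ε • v‖ ^ 2)⁻¹ : ℝ) : ℂ)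
    rw [map_mul, Complex.conj_ofReal, Complex.conj_ofReal]
  have hden := SchwartzMap.denseRange_toLpCLM (E := E) (F := ℂ) (p := 2)
    (μ := volume) ENNReal.ofNat_ne_top
  refine hden.induction_on (p := fun f => (Complex.I * inner ℂ (mulOp (transportCutoff k hε)
    (fmul ρ (mulOp (cutoff ε) f))) f).re = (1 / (4 * Real.pi)) *
        (inner ℂ (mulOp (cutoff ε) f) (fmul dρ (mulOp (cutoff ε) f))).re) f ?_ ?_
  · refine isClosed_eq ?_ ?_ <;> fun_prop
  · intro ψ
    rw [SchwartzMap.toLpCLM_apply, inner_mulOp_left, hstar, ← transportCutoff_toLp k hε,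
      mulOp_toLp hθ]
    exact re_inner_fmul_transport hρ hs hd _

/-- The energy identity with a Fourier multiplier for weak solutions of the transport equation. -/
theorem TransportEq.energy (ht : TransportEq k h p s) (hw : HasGrad h w)
    {ρ dρ : EuclideanSpace ℝ ι →ᵇ ℂ} (hρ : (ρ : _ → ℂ).HasTemperateGrowth)
    (hs : star ρ = ρ) (hd : ∀ x, HasLineDerivAt ℝ ρ (dρ x) x k) :
    (inner ℂ (fmul ρ h) p + ∑ e, inner ℂ (fmul ρ (w e)) (s e)).re
      + (1 / (4 * Real.pi)) * (inner ℂ h (fmul dρ h)).re = 0 := by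
  have hε : ∀ n : ℕ, (0 : ℝ) < 1 / ((n : ℝ) + 1) := fun n => by positivity
  have key : ∀ n : ℕ, (inner ℂ (mulOp (cutoff (1 / ((n : ℝ) + 1))) (fmul ρ
      (mulOp (cutoff (1 / ((n : ℝ) + 1))) h))) p
      + ∑ e, inner ℂ (mulOp (cutoffDeriv (EuclideanSpace.single e (1 : ℝ)) (1 / ((n : ℝ) + 1)))
            (fmul ρ (mulOp (cutoff (1 / ((n : ℝ) + 1))) h)) +
            mulOp (cutoff (1 / ((n : ℝ) + 1))) (fmul ρ
          (mulOp (cutoffDeriv (EuclideanSpace.single e (1 : ℝ)) (1 / ((n : ℝ) + 1))) h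
            + mulOp (cutoff (1 / ((n : ℝ) + 1))) (w e)))) (s e)).re
      + (1 / (4 * Real.pi)) * (inner ℂ (mulOp (cutoff (1 / ((n : ℝ) + 1))) h)
        (fmul dρ (mulOp (cutoff (1 / ((n : ℝ) + 1))) h))).re = 0 := by
    intro n
    have h1 := (congrArg Complex.re (ht.test_cutoff hw hρ (hε n))).trans Complex.zero_re
    rw [← re_inner_transportCutoff hρ hs hd (hε n), ← Complex.add_re]
    refine Eq.trans ?_ h1
    congr 1
    ring
  have c1 : ∀ {f : ℕ → Lp ℂ 2 (volume : Measure (EuclideanSpace ℝ ι))}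
      {g : Lp ℂ 2 (volume : Measure (EuclideanSpace ℝ ι))}, Tendsto f atTop (𝓝 g) →
      Tendsto (fun n : ℕ => mulOp (cutoff (1 / ((n : ℝ) + 1))) (f n)) atTop (𝓝 g) := by
    intro f g hf
    have := tendsto_mulOp (θ := fun n : ℕ => cutoff (1 / ((n : ℝ) + 1))) (η := 1) (C := 1)
      (fun n x => norm_cutoff_le _ x) (fun x => by simpa using tendsto_cutoff x) hf
    rwa [mulOp_one] at this
  -- The derivative of the cutoff is O(ε) uniformly, so the terms where it appears vanish in the
  -- limit.
  have c2 : ∀ (y : EuclideanSpace ℝ ι) {f : ℕ → Lp ℂ 2 (volume : Measure (EuclideanSpace ℝ ι))}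
      {g : Lp ℂ 2 (volume : Measure (EuclideanSpace ℝ ι))}, Tendsto f atTop (𝓝 g) →
      Tendsto (fun n : ℕ => mulOp (cutoffDeriv y (1 / ((n : ℝ) + 1))) (f n)) atTop (𝓝 0) := by
    intro y f g hf
    refine squeeze_zero_norm (fun n => norm_mulOp_le (norm_cutoffDeriv_le y _) _) ?_
    have h1 : Tendsto (fun n : ℕ => 2 * |1 / ((n : ℝ) + 1)| * ‖y‖) atTop (𝓝 (2 * |0| * ‖y‖)) :=
      (tendsto_one_div_add_atTop_nhds_zero_nat.abs.const_mul 2).mul_const _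
    simpa using h1.mul hf.norm
  have c3 : ∀ (σ : EuclideanSpace ℝ ι →ᵇ ℂ)
      {f : ℕ → Lp ℂ 2 (volume : Measure (EuclideanSpace ℝ ι))}
      {g : Lp ℂ 2 (volume : Measure (EuclideanSpace ℝ ι))}, Tendsto f atTop (𝓝 g) →
      Tendsto (fun n : ℕ => fmul σ (f n)) atTop (𝓝 (fmul σ g)) := fun σ f g hf =>
    ((fmul σ).continuous.tendsto _).comp hf
  have hc : ∀ f : Lp ℂ 2 (volume : Measure (EuclideanSpace ℝ ι)),
      Tendsto (fun _ : ℕ => f) atTop (𝓝 f) := fun f => tendsto_const_nhds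
  refine tendsto_nhds_unique (f := fun _ : ℕ => (0 : ℝ)) (l := atTop) ?_ tendsto_const_nhds
  refine Tendsto.congr key ?_
  refine Tendsto.add ((Complex.continuous_re.tendsto _).comp ?_)
    (((Complex.continuous_re.tendsto _).comp ((c1 (hc h)).inner (c3 dρ (c1 (hc h))))).const_mul _)
  refine ((c1 (c3 ρ (c1 (hc h)))).inner (hc p)).add (tendsto_finsetSum _ fun e _ => ?_)
  have := ((c2 (EuclideanSpace.single e (1 : ℝ)) (c3 ρ (c1 (hc h)))).add (c1 (c3 ρ
    ((c2 (EuclideanSpace.single e (1 : ℝ)) (hc h)).add (c1 (hc (w e))))))).inner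
    (𝕜 := ℂ) (hc (s e))
  simpa only [zero_add] using this

end Gradient

/-! ### Symbols -/

section Symbols

variable {E : Type*} [NormedAddCommGroup E] [InnerProductSpace ℝ E]

theorem norm_three_add_arctan_le (t : ℝ) : ‖((3 + Real.arctan t : ℝ) : ℂ)‖ ≤ 5 := by
  have h1 := Real.arctan_lt_pi_div_two t
  have h2 := Real.neg_pi_div_two_lt_arctan t
  have h3 := Real.pi_lt_four
  rw [Complex.norm_real, Real.norm_eq_abs, abs_le]
  constructor <;> linarith

/-- The symbol `3 + arctan ⟨ξ, y⟩`. -/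
def arctanSymbol (y : E) : E →ᵇ ℂ :=
  BoundedContinuousFunction.ofNormedAddCommGroup
    (fun v => ((3 + Real.arctan (inner ℝ v y) : ℝ) : ℂ))
    (Complex.continuous_ofReal.comp (continuous_const.add
      (Real.continuous_arctan.comp (by fun_prop)))) 5 (fun _ => norm_three_add_arctan_le _)

/-- The symbol `(1 + ⟨ξ, y⟩²)⁻¹`. -/
def weightSymbol (y : E) : E →ᵇ ℂ :=
  BoundedContinuousFunction.ofNormedAddCommGroup
    (fun v => (((1 + (inner ℝ v y) ^ 2)⁻¹ : ℝ) : ℂ))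
    (Complex.continuous_ofReal.comp (Continuous.inv₀ (by fun_prop)
      fun v => (by positivity : (0 : ℝ) < 1 + (inner ℝ v y) ^ 2).ne')) 1 (fun v => by
      rw [Complex.norm_real, Real.norm_eq_abs, abs_of_pos (by positivity)]
      exact inv_le_one_of_one_le₀ (by linarith [sq_nonneg (inner ℝ v y)]))

theorem norm_one_add_I_mul_sq (t : ℝ) : ‖(1 + Complex.I * t : ℂ)‖ ^ 2 = 1 + t ^ 2 := by
  rw [← Complex.normSq_eq_norm_sq, Complex.normSq_apply]
  simp
  ring

theorem one_le_norm_one_add_I_mul (t : ℝ) : 1 ≤ ‖(1 + Complex.I * t : ℂ)‖ := by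
  have := norm_one_add_I_mul_sq t
  nlinarith [norm_nonneg (1 + Complex.I * t : ℂ), sq_nonneg t]

/-- The symbol `(1 + i ⟨ξ, y⟩)⁻¹`. -/
def resolventSymbol (y : E) : E →ᵇ ℂ :=
  BoundedContinuousFunction.ofNormedAddCommGroup
    (fun v => (1 + Complex.I * (inner ℝ v y : ℝ))⁻¹)
    (Continuous.inv₀ (by fun_prop) fun v => norm_pos_iff.1
      (zero_lt_one.trans_le (one_le_norm_one_add_I_mul _))) 1 (fun v => by
      rw [norm_inv]
      exact inv_le_one_of_one_le₀ (one_le_norm_one_add_I_mul _))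

theorem resolventSymbol_apply (y v : E) :
    resolventSymbol y v = (1 + Complex.I * (inner ℝ v y : ℝ))⁻¹ := rfl

theorem norm_arctanSymbol_le (y v : E) : ‖arctanSymbol y v‖ ≤ 5 := norm_three_add_arctan_le _

theorem star_arctanSymbol (y : E) : star (arctanSymbol y) = arctanSymbol y := by
  ext v
  exact Complex.conj_ofReal _

theorem resolventSymbol_mul_star (y : E) :
    resolventSymbol y * star (resolventSymbol y) = weightSymbol y := by
  ext v
  change (1 + Complex.I * (inner ℝ v y : ℝ))⁻¹ * conj ((1 + Complex.I * (inner ℝ v y : ℝ))⁻¹)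
    = (((1 + (inner ℝ v y) ^ 2)⁻¹ : ℝ) : ℂ)
  rw [Complex.mul_conj, Complex.normSq_eq_norm_sq, norm_inv, inv_pow, norm_one_add_I_mul_sq]

theorem arctanSymbol_hasTemperateGrowth (y : E) :
    (arctanSymbol y : E → ℂ).HasTemperateGrowth := by
  have h1 : (fun t : ℝ => (1 / (1 + t ^ 2) : ℝ)).HasTemperateGrowth := by
    have := Function.hasTemperateGrowth_one_add_norm_sq_rpow ℝ (-1)
    have h2 : (fun t : ℝ => (1 / (1 + t ^ 2) : ℝ))
        = fun t : ℝ => ((1 + ‖t‖ ^ 2) ^ (-1 : ℝ) : ℝ) := by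
      ext t
      rw [Real.rpow_neg_one, Real.norm_eq_abs, sq_abs, one_div]
    rw [h2]
    exact this
  have h2 : Real.arctan.HasTemperateGrowth := by
    refine Function.HasTemperateGrowth.of_fderiv (k := 0) (C := 2) ?_
      Real.differentiable_arctan ?_
    · have h3 : fderiv ℝ Real.arctan = fun t =>
          ContinuousLinearMap.mul ℝ ℝ (1 / (1 + t ^ 2)) := by
        ext t
        simp
      rw [h3]
      exact Function.HasTemperateGrowth.comp (ContinuousLinearMap.hasTemperateGrowth _) h1
    · intro t
      have h1 := Real.arctan_lt_pi_div_two t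
      have h2 := Real.neg_pi_div_two_lt_arctan t
      have h3 := Real.pi_lt_four
      rw [Real.norm_eq_abs, pow_zero, mul_one, abs_le]
      constructor <;> linarith
  have h3 : (fun v : E => inner ℝ v y).HasTemperateGrowth :=
    Function.hasTemperateGrowth_inner_left y
  have h4 := Function.HasTemperateGrowth.comp Function.Complex.hasTemperateGrowth_ofReal
    ((Function.HasTemperateGrowth.const (3 : ℝ)).add (Function.HasTemperateGrowth.comp h2 h3))
  exact h4

theorem hasLineDerivAt_arctanSymbol (y k v : E) :
    HasLineDerivAt ℝ (arctanSymbol y : E → ℂ)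
      ((((inner ℝ k y : ℝ) : ℂ) • weightSymbol y) v) v k := by
  unfold HasLineDerivAt
  have h1 : HasDerivAt (fun t : ℝ => inner ℝ (v + t • k) y) (inner ℝ k y) 0 := by
    have : (fun t : ℝ => inner ℝ (v + t • k) y)
        = fun t : ℝ => inner ℝ v y + t * inner ℝ k y := by
      ext t
      rw [inner_add_left, real_inner_smul_left]
    rw [this]
    exact (((hasDerivAt_id (0 : ℝ)).mul_const (inner ℝ k y)).const_add (inner ℝ v y)).congr_deriv
      (one_mul _)
  have h2 := ((h1.arctan).const_add 3).ofReal_comp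
  refine h2.congr_deriv ?_
  change _ = ((inner ℝ k y : ℝ) : ℂ) * (((1 + (inner ℝ v y) ^ 2)⁻¹ : ℝ) : ℂ)
  rw [← Complex.ofReal_mul]
  congr 1
  simp
  ring

end Symbols

/-! ### Quadratic forms of Fourier multipliers. -/

section FourierNorms

variable {E : Type*} [NormedAddCommGroup E] [InnerProductSpace ℝ E] [FiniteDimensional ℝ E]
  [MeasurableSpace E] [BorelSpace E]

theorem integrable_norm_sq_fourier (f : Lp ℂ 2 (volume : Measure E)) :
    Integrable (fun ξ => ‖(𝓕 f : Lp ℂ 2 (volume : Measure E)) ξ‖ ^ 2) :=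
  (memLp_two_iff_integrable_sq_norm (Lp.memLp _).1).1 (Lp.memLp _)

theorem norm_sq_eq_integral (f : Lp ℂ 2 (volume : Measure E)) :
    ‖f‖ ^ 2 = ∫ ξ, ‖f ξ‖ ^ 2 := by
  rw [← @inner_self_eq_norm_sq ℂ, L2.inner_def]
  have : ∀ ξ, inner ℂ (f ξ) (f ξ) = ((‖f ξ‖ ^ 2 : ℝ) : ℂ) := fun ξ => by
    rw [inner_self_eq_norm_sq_to_K]; simp
  simp only [this]
  rw [integral_complex_ofReal]
  simp [-Complex.ofReal_pow]

theorem norm_sq_eq_integral_fourier (f : Lp ℂ 2 (volume : Measure E)) :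
    ‖f‖ ^ 2 = ∫ ξ, ‖(𝓕 f : Lp ℂ 2 (volume : Measure E)) ξ‖ ^ 2 := by
  rw [← Lp.norm_fourier_eq, norm_sq_eq_integral]

theorem integrable_re_mul_norm_sq_fourier (ρ : E →ᵇ ℂ) (f : Lp ℂ 2 (volume : Measure E)) :
    Integrable (fun ξ => (ρ ξ).re * ‖(𝓕 f : Lp ℂ 2 (volume : Measure E)) ξ‖ ^ 2) :=
  (integrable_norm_sq_fourier f).bdd_mul
    (Complex.continuous_re.comp ρ.continuous).aestronglyMeasurable
    (Eventually.of_forall fun ξ => (Complex.abs_re_le_norm _).trans (ρ.norm_coe_le_norm ξ))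

theorem re_inner_fmul (ρ : E →ᵇ ℂ) (f : Lp ℂ 2 (volume : Measure E)) :
    (inner ℂ f (fmul ρ f)).re
      = ∫ ξ, (ρ ξ).re * ‖(𝓕 f : Lp ℂ 2 (volume : Measure E)) ξ‖ ^ 2 := by
  rw [← Lp.inner_fourier_eq, fourier_fmul, L2.inner_def]
  have h1 : ∀ᵐ ξ, inner ℂ ((𝓕 f : Lp ℂ 2 (volume : Measure E)) ξ) ((mulOp ρ (𝓕 f)) ξ)
      = ρ ξ * ((‖(𝓕 f : Lp ℂ 2 (volume : Measure E)) ξ‖ ^ 2 : ℝ) : ℂ) := by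
    filter_upwards [coeFn_mulOp ρ (𝓕 f)] with ξ hξ
    rw [hξ, ← smul_eq_mul, inner_smul_right, inner_self_eq_norm_sq_to_K]
    simp
  have h2 := (integral_re (𝕜 := ℂ)
    (L2.integrable_inner (𝕜 := ℂ) (𝓕 f : Lp ℂ 2 (volume : Measure E)) (mulOp ρ (𝓕 f))))
  refine h2.symm.trans (integral_congr_ae ?_)
  filter_upwards [h1] with ξ hξ
  rw [hξ]
  simp [-Complex.ofReal_pow]

theorem le_re_inner_fmul {ρ : E →ᵇ ℂ} {a : ℝ} (ha : ∀ ξ, a ≤ (ρ ξ).re)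
    (f : Lp ℂ 2 (volume : Measure E)) : a * ‖f‖ ^ 2 ≤ (inner ℂ f (fmul ρ f)).re := by
  rw [re_inner_fmul, norm_sq_eq_integral_fourier, ← integral_const_mul]
  refine integral_mono ((integrable_norm_sq_fourier f).const_mul a)
    (integrable_re_mul_norm_sq_fourier ρ f) fun ξ => ?_
  simp only
  gcongr
  exact ha ξ

theorem one_le_re_arctanSymbol (y v : E) : 1 ≤ (arctanSymbol y v).re := by
  change 1 ≤ 3 + Real.arctan (inner ℝ v y)
  have h1 := Real.neg_pi_div_two_lt_arctan (inner ℝ v y)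
  have h2 := Real.pi_lt_four
  linarith

theorem re_inner_weightSymbol (y : E) (f : Lp ℂ 2 (volume : Measure E)) :
    (inner ℂ f (fmul (weightSymbol y) f)).re = ‖fmul (star (resolventSymbol y)) f‖ ^ 2 := by
  rw [← resolventSymbol_mul_star, ← fmul_fmul, ← @inner_self_eq_norm_sq ℂ,
    inner_fmul_left (star _), star_star]
  rfl

end FourierNorms

/-! ### Energy, hypoelliptic and directional estimates. -/

section Estimates

variable {ι : Type*} [Fintype ι] [DecidableEq ι]

/-- `L²(ℝ^ι)`. -/
abbrev L2E (ι : Type*) [Fintype ι] : Type _ :=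
  Lp ℂ 2 (volume : Measure (EuclideanSpace ℝ ι))

/-- Square integrable vector fields on `ℝ^ι`. -/
abbrev Grad (ι : Type*) [Fintype ι] : Type _ := PiLp 2 (fun _ : ι => L2E ι)

/-- With t = ⟨ξ, y⟩ one has 1 ≤ (1 + t²)⁻¹ + t² and t² ≤ |ξ|²|y|². The weighted norm thus misses
only what the gradient controls at cost |y|². -/
theorem HasGrad.norm_sq_le {h : L2E ι} {w : Grad ι} (hw : HasGrad h w)
    (y : EuclideanSpace ℝ ι) :
    ‖h‖ ^ 2 ≤ ‖fmul (star (resolventSymbol y)) h‖ ^ 2 + ‖y‖ ^ 2 * ‖w‖ ^ 2 := by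
  have hall : ∀ᵐ ξ, ∀ e, (𝓕 (w e) : L2E ι) ξ
      = (2 * Real.pi * Complex.I * (inner ℝ ξ (EuclideanSpace.single e (1 : ℝ)) : ℝ)) *
        (𝓕 h : L2E ι) ξ :=
    ae_all_iff.2 fun e => (isWeakDeriv_iff_fourier _ _ _).1 (hw e)
  have hi : Integrable (fun ξ => ∑ e, ‖(𝓕 (w e) : L2E ι) ξ‖ ^ 2) :=
    integrable_finsetSum _ fun e _ => integrable_norm_sq_fourier (w e)
  have hw2 : ‖w‖ ^ 2 = ∫ ξ, ∑ e, ‖(𝓕 (w e) : L2E ι) ξ‖ ^ 2 := by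
    rw [PiLp.norm_sq_eq_of_L2, integral_finsetSum _ fun e _ => integrable_norm_sq_fourier (w e)]
    simp only [norm_sq_eq_integral_fourier]
  rw [← re_inner_weightSymbol, re_inner_fmul, norm_sq_eq_integral_fourier, hw2,
    ← integral_const_mul, ← integral_add (integrable_re_mul_norm_sq_fourier _ h)
      (hi.const_mul _)]
  refine integral_mono_ae (integrable_norm_sq_fourier h)
    ((integrable_re_mul_norm_sq_fourier _ h).add (hi.const_mul _)) ?_
  filter_upwards [hall] with ξ hξ
  simp only [hξ, norm_mul, mul_pow, Complex.norm_real, Real.norm_eq_abs, sq_abs,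
      Complex.norm_I, Complex.norm_ofNat, EuclideanSpace.inner_single_right, one_mul, conj_trivial,
      mul_one]
  rw [← Finset.sum_mul, ← Finset.mul_sum]
  have e1 : ∑ e, ξ e ^ 2 = ‖ξ‖ ^ 2 := by
    rw [EuclideanSpace.norm_sq_eq]; simp
  have e2 : (inner ℝ ξ y) ^ 2 ≤ ‖ξ‖ ^ 2 * ‖y‖ ^ 2 := by
    rw [← mul_pow]
    exact sq_le_sq' (by linarith [neg_le_of_abs_le (abs_real_inner_le_norm ξ y)])
      (real_inner_le_norm ξ y)
  have e3 : (weightSymbol y ξ).re = (1 + (inner ℝ ξ y) ^ 2)⁻¹ := rfl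
  rw [e1, e3, ← mul_assoc, ← add_mul]
  refine le_mul_of_one_le_left (sq_nonneg _) ?_
  have e4 : 1 ≤ (1 + (inner ℝ ξ y) ^ 2)⁻¹ + (inner ℝ ξ y) ^ 2 := by
    have : 0 < 1 + (inner ℝ ξ y) ^ 2 := by positivity
    rw [← sub_nonneg]
    have : (1 + (inner ℝ ξ y) ^ 2)⁻¹ + (inner ℝ ξ y) ^ 2 - 1
        = (inner ℝ ξ y) ^ 4 / (1 + (inner ℝ ξ y) ^ 2) := by field_simp; ring
    rw [this]
    positivity
  have e5 : 1 ≤ 2 ^ 2 * Real.pi ^ 2 := by nlinarith [Real.pi_gt_three]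
  have e6 : ‖ξ‖ ^ 2 * ‖y‖ ^ 2 ≤ ‖y‖ ^ 2 * (2 ^ 2 * Real.pi ^ 2 * ‖ξ‖ ^ 2) := by
    have : 0 ≤ ‖ξ‖ ^ 2 * ‖y‖ ^ 2 := by positivity
    nlinarith
  linarith

/-- The Fourier multiplier on vector fields. -/
def gmul (ρ : EuclideanSpace ℝ ι →ᵇ ℂ) (w : Grad ι) : Grad ι :=
  WithLp.toLp 2 fun e => fmul ρ (w e)

theorem norm_gmul_le {ρ : EuclideanSpace ℝ ι →ᵇ ℂ} {C : ℝ} (hC : ∀ x, ‖ρ x‖ ≤ C) (w : Grad ι) :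
    ‖gmul ρ w‖ ≤ C * ‖w‖ := by
  have hC0 : 0 ≤ C := (norm_nonneg _).trans (hC 0)
  refine le_of_sq_le_sq ?_ (by positivity)
  rw [mul_pow, PiLp.norm_sq_eq_of_L2, PiLp.norm_sq_eq_of_L2, Finset.mul_sum]
  refine Finset.sum_le_sum fun e _ => ?_
  rw [← mul_pow]
  exact pow_le_pow_left₀ (norm_nonneg _) (norm_fmul_le hC _) 2

theorem le_re_inner_gmul {ρ : EuclideanSpace ℝ ι →ᵇ ℂ} {a : ℝ} (ha : ∀ ξ, a ≤ (ρ ξ).re)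
    (hs : star ρ = ρ) (w : Grad ι) : a * ‖w‖ ^ 2 ≤ (inner ℂ (gmul ρ w) w).re := by
  rw [PiLp.inner_apply, PiLp.norm_sq_eq_of_L2, Finset.mul_sum, Complex.re_sum]
  refine Finset.sum_le_sum fun e _ => ?_
  change _ ≤ (inner ℂ (fmul ρ (w e)) (w e)).re
  rw [inner_fmul_left, hs]
  exact le_re_inner_fmul ha _

/-- `h ∈ H¹` with gradient `w` is a weak solution of
`(z + i k · v - ν Δ - div B ∇) h = r₀ - div r₁`. -/
structure IsSol (z : ℂ) (k : EuclideanSpace ℝ ι) (ν : ℝ) (B : Grad ι →L[ℂ] Grad ι)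
    (h : L2E ι) (w : Grad ι) (r₀ : L2E ι) (r₁ : Grad ι) : Prop where
  grad : HasGrad h w
  eq : TransportEq k h (z • h - r₀) (fun e => (ν : ℂ) • w e + (B w) e - r₁ e)

/-- The right-hand side of the energy identity with symbol `3 + arctan ⟨ξ, y⟩`. -/
def energyRhs (y : EuclideanSpace ℝ ι) (h : L2E ι) (w : Grad ι) (r₀ : L2E ι) (r₁ : Grad ι) : ℂ :=
  inner ℂ (fmul (arctanSymbol y) h) r₀ + inner ℂ (gmul (arctanSymbol y) w) r₁

variable {z : ℂ} {k : EuclideanSpace ℝ ι} {ν : ℝ} {B : Grad ι →L[ℂ] Grad ι}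
  {h r₀ : L2E ι} {w r₁ : Grad ι}

/-- The symbol is at least 1, which preserves the damping and the dissipation. Its derivative along
k is ⟨k, y⟩(1 + ⟨ξ, y⟩²)⁻¹, which gives the extra term on the left. -/
theorem IsSol.energy (hs : IsSol z k ν B h w r₀ r₁) (hz : 0 ≤ z.re) (hν : 0 ≤ ν)
    (hB : ‖B‖ ≤ ν / 10) (y : EuclideanSpace ℝ ι) :
    z.re * ‖h‖ ^ 2 + ν / 2 * ‖w‖ ^ 2
      + inner ℝ k y / (4 * Real.pi) * ‖fmul (star (resolventSymbol y)) h‖ ^ 2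
      ≤ ‖energyRhs y h w r₀ r₁‖ := by
  have h1 := hs.eq.energy hs.grad (arctanSymbol_hasTemperateGrowth y) (star_arctanSymbol y)
    (fun v => hasLineDerivAt_arctanSymbol y k v)
  have h2 : (inner ℂ h (fmul (((inner ℝ k y : ℝ) : ℂ) • weightSymbol y) h)).re
      = inner ℝ k y * ‖fmul (star (resolventSymbol y)) h‖ ^ 2 := by
    rw [fmul_smul, inner_smul_right, Complex.re_ofReal_mul, re_inner_weightSymbol]
  have h3 : inner ℂ (fmul (arctanSymbol y) h) (z • h - r₀)
      + ∑ e, inner ℂ (fmul (arctanSymbol y) (w e)) ((ν : ℂ) • w e + (B w) e - r₁ e)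
      = z * inner ℂ (fmul (arctanSymbol y) h) h + ((ν : ℂ) * inner ℂ (gmul (arctanSymbol y) w) w
        + inner ℂ (gmul (arctanSymbol y) w) (B w)) - energyRhs y h w r₀ r₁ := by
    simp only [energyRhs, PiLp.inner_apply, inner_sub_right, inner_add_right, inner_smul_right,
      Finset.sum_sub_distrib, Finset.sum_add_distrib, Finset.mul_sum, gmul]
    ring
  rw [h3, h2] at h1
  simp only [Complex.sub_re, Complex.add_re, Complex.mul_re, Complex.ofReal_re, Complex.ofReal_im,
    zero_mul, sub_zero] at h1
  have him : (inner ℂ (fmul (arctanSymbol y) h) h).im = 0 := by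
    have : conj (inner ℂ (fmul (arctanSymbol y) h) h) = inner ℂ (fmul (arctanSymbol y) h) h := by
      rw [inner_conj_symm, inner_fmul_left, star_arctanSymbol]
    exact Complex.conj_eq_iff_im.1 this
  have hre : ‖h‖ ^ 2 ≤ (inner ℂ (fmul (arctanSymbol y) h) h).re := by
    rw [inner_fmul_left, star_arctanSymbol]
    simpa using le_re_inner_fmul (one_le_re_arctanSymbol y) h
  have hgw : ‖w‖ ^ 2 ≤ (inner ℂ (gmul (arctanSymbol y) w) w).re := by
    simpa using le_re_inner_gmul (one_le_re_arctanSymbol y) (star_arctanSymbol y) w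
  -- Since the symbol is at most 5, B costs at most 5·ν/10 = ν/2 of the dissipation. This fixes the
  -- threshold ν/10.
  have hBw : -(ν / 2 * ‖w‖ ^ 2) ≤ (inner ℂ (gmul (arctanSymbol y) w) (B w)).re := by
    have a1 : ‖inner ℂ (gmul (arctanSymbol y) w) (B w)‖ ≤ (5 * ‖w‖) * (ν / 10 * ‖w‖) :=
      (norm_inner_le_norm _ _).trans (mul_le_mul (norm_gmul_le (norm_arctanSymbol_le y) w)
        (B.le_of_opNorm_le hB w) (norm_nonneg _) (by positivity))
    have a2 := (abs_le.1 (Complex.abs_re_le_norm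
      (inner ℂ (gmul (arctanSymbol y) w) (B w)))).1
    nlinarith
  have hrhs := Complex.re_le_norm (energyRhs y h w r₀ r₁)
  rw [him, mul_zero, sub_zero] at h1
  have b1 := mul_le_mul_of_nonneg_left hre hz
  have b2 := mul_le_mul_of_nonneg_left hgw hν
  have b3 : inner ℝ k y / (4 * Real.pi) * ‖fmul (star (resolventSymbol y)) h‖ ^ 2
      = 1 / (4 * Real.pi) * (inner ℝ k y * ‖fmul (star (resolventSymbol y)) h‖ ^ 2) := by ring
  rw [b3]
  linarith

theorem norm_energyRhs_le (y : EuclideanSpace ℝ ι) {R : ℝ} (hR : 0 < R) :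
    ‖energyRhs y h w r₀ r₁‖ ≤ 5 * (R * ‖h‖ + ‖w‖) * (R⁻¹ * ‖r₀‖ + ‖r₁‖) := by
  have h1 : ‖inner ℂ (fmul (arctanSymbol y) h) r₀‖ ≤ 5 * ‖h‖ * ‖r₀‖ :=
    (norm_inner_le_norm _ _).trans (by gcongr; exact norm_fmul_le (norm_arctanSymbol_le y) h)
  have h2 : ‖inner ℂ (gmul (arctanSymbol y) w) r₁‖ ≤ 5 * ‖w‖ * ‖r₁‖ :=
    (norm_inner_le_norm _ _).trans (by gcongr; exact norm_gmul_le (norm_arctanSymbol_le y) w)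
  have h3 := norm_add_le (inner ℂ (fmul (arctanSymbol y) h) r₀)
    (inner ℂ (gmul (arctanSymbol y) w) r₁)
  have h4 : R * ‖h‖ * (R⁻¹ * ‖r₀‖) = ‖h‖ * ‖r₀‖ := by field_simp
  have h5 : 0 ≤ R * ‖h‖ * ‖r₁‖ := by positivity
  have h6 : 0 ≤ ‖w‖ * (R⁻¹ * ‖r₀‖) := by positivity
  unfold energyRhs
  nlinarith

/-- Hypoelliptic estimate, in terms of the energy. -/
theorem IsSol.norm_sq_le (hs : IsSol z k ν B h w r₀ r₁) (hz : 0 ≤ z.re) (hν : 0 < ν)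
    (hB : ‖B‖ ≤ ν / 10) (hk : k ≠ 0) {R : ℝ} (hR : 0 < R) (hRk : ν * R ^ 3 = ‖k‖) :
    (R * ‖h‖ + ‖w‖) ^ 2 ≤ 32 / ν * ‖energyRhs ((‖k‖ * R)⁻¹ • k) h w r₀ r₁‖ := by
  have hk0 : 0 < ‖k‖ := norm_pos_iff.2 hk
  have h1 := hs.energy hz hν.le hB ((‖k‖ * R)⁻¹ • k)
  have h2 := hs.grad.norm_sq_le ((‖k‖ * R)⁻¹ • k)
  -- The vector y has length 1/R along k. Then ⟨k, y⟩ = |k|/R = νR², so transport and dissipation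
  -- are balanced exactly by νR³ = |k|.
  have h3 : inner ℝ k ((‖k‖ * R)⁻¹ • k) = ν * R ^ 2 := by
    rw [real_inner_smul_right, real_inner_self_eq_norm_sq, ← hRk]
    field_simp
  have h4 : ‖(‖k‖ * R)⁻¹ • k‖ = R⁻¹ := by
    rw [norm_smul, norm_inv, norm_mul, norm_norm, Real.norm_eq_abs, abs_of_pos hR]
    field_simp
  rw [h3] at h1
  rw [h4] at h2
  set Y := ‖fmul (star (resolventSymbol ((‖k‖ * R)⁻¹ • k))) h‖ ^ 2
  set Q := ‖energyRhs ((‖k‖ * R)⁻¹ • k) h w r₀ r₁‖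
  have hY : 0 ≤ Y := by positivity
  have h5 : R ^ 2 * ‖h‖ ^ 2 ≤ R ^ 2 * Y + ‖w‖ ^ 2 := by
    calc R ^ 2 * ‖h‖ ^ 2 ≤ R ^ 2 * (Y + R⁻¹ ^ 2 * ‖w‖ ^ 2) := by gcongr
      _ = R ^ 2 * Y + ‖w‖ ^ 2 := by field_simp
  have h6 : 0 ≤ z.re * ‖h‖ ^ 2 := by positivity
  have h7 : ν * (R ^ 2 * Y) ≤ 4 * Real.pi * Q - 2 * Real.pi * (ν * ‖w‖ ^ 2) := by
    have hpi := Real.pi_pos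
    have : ν * R ^ 2 / (4 * Real.pi) * Y ≤ Q - ν / 2 * ‖w‖ ^ 2 := by linarith
    have h8 := mul_le_mul_of_nonneg_left this (by positivity : 0 ≤ 4 * Real.pi)
    have h9 : 4 * Real.pi * (ν * R ^ 2 / (4 * Real.pi) * Y) = ν * (R ^ 2 * Y) := by field_simp
    rw [h9] at h8
    linarith
  have hQ : 0 ≤ Q := norm_nonneg _
  have hw0 : 0 ≤ ν * ‖w‖ ^ 2 := by positivity
  -- Bounding R²‖h‖² costs one extra ν‖w‖². Together with ν‖w‖² itself it is absorbed by the term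
  -- -2πν‖w‖² in `h7`, as 2π ≥ 2; finally 4π ≤ 16.
  have h10 : ν * (R ^ 2 * ‖h‖ ^ 2 + ‖w‖ ^ 2) ≤ 16 * Q := by
    have a := mul_le_mul_of_nonneg_left h5 hν.le
    have b := Real.pi_gt_three
    have c := Real.pi_lt_four
    nlinarith
  have h11 : (R * ‖h‖ + ‖w‖) ^ 2 ≤ 2 * (R ^ 2 * ‖h‖ ^ 2 + ‖w‖ ^ 2) := by
    nlinarith [sq_nonneg (R * ‖h‖ - ‖w‖)]
  have h12 : R ^ 2 * ‖h‖ ^ 2 + ‖w‖ ^ 2 ≤ 16 * Q / ν := by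
    rw [le_div_iff₀ hν]; linarith
  calc (R * ‖h‖ + ‖w‖) ^ 2 ≤ 2 * (16 * Q / ν) := h11.trans (by linarith)
    _ = 32 / ν * Q := by ring

/-- The energy is linear in S = R‖h‖ + ‖w‖ while it bounds S², so one factor S cancels; 160 = 32·5.
-/
theorem IsSol.norm_le (hs : IsSol z k ν B h w r₀ r₁) (hz : 0 ≤ z.re) (hν : 0 < ν)
    (hB : ‖B‖ ≤ ν / 10) (hk : k ≠ 0) {R : ℝ} (hR : 0 < R) (hRk : ν * R ^ 3 = ‖k‖) :
    R * ‖h‖ + ‖w‖ ≤ 160 / ν * (R⁻¹ * ‖r₀‖ + ‖r₁‖) := by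
  have h1 := hs.norm_sq_le hz hν hB hk hR hRk
  have h2 := norm_energyRhs_le ((‖k‖ * R)⁻¹ • k) hR (h := h) (w := w) (r₀ := r₀) (r₁ := r₁)
  set S := R * ‖h‖ + ‖w‖
  have hS : 0 ≤ S := by positivity
  have h3 : S ^ 2 ≤ S * (160 / ν * (R⁻¹ * ‖r₀‖ + ‖r₁‖)) :=
    calc S ^ 2 ≤ 32 / ν * (5 * S * (R⁻¹ * ‖r₀‖ + ‖r₁‖)) := h1.trans (by gcongr)
      _ = _ := by ring
  rcases hS.eq_or_lt with h0 | h0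
  · rw [← h0]; positivity
  · rw [sq] at h3
    exact le_of_mul_le_mul_left h3 h0

/-- Transport estimate in a direction `n` for a right-hand side that is regular in that
direction. -/
theorem IsSol.weighted_norm_le (hs : IsSol z k ν B h w r₀ 0) (hz : 0 ≤ z.re) (hν : 0 < ν)
    (hB : ‖B‖ ≤ ν / 10) {n : EuclideanSpace ℝ ι} (hn : 0 < inner ℝ k n) {F : L2E ι}
    (hF : r₀ = fmul (resolventSymbol n) F) :
    ‖fmul (star (resolventSymbol n)) h‖ ≤ 20 * Real.pi / inner ℝ k n * ‖F‖ := by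
  have h1 := hs.energy hz hν.le hB n
  have hpi := Real.pi_pos
  -- The resolvent in the data is moved onto h as its adjoint. The right side then contains the very
  -- quantity controlled on the left, linearly, and the estimate closes without ν.
  have h2 : ‖energyRhs n h w r₀ 0‖ ≤ 5 * ‖fmul (star (resolventSymbol n)) h‖ * ‖F‖ := by
    unfold energyRhs
    rw [inner_zero_right, add_zero, hF, inner_fmul_left, fmul_comm, ← star_star (resolventSymbol n),
      ← inner_fmul_left]
    refine (norm_inner_le_norm _ _).trans ?_
    rw [star_star, star_arctanSymbol]
    calc _ ≤ ‖fmul (star (resolventSymbol n)) h‖ * (5 * ‖F‖) := by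
          gcongr; exact norm_fmul_le (norm_arctanSymbol_le n) F
      _ = _ := by ring
  set Y := ‖fmul (star (resolventSymbol n)) h‖
  have hY : 0 ≤ Y := norm_nonneg _
  have h3 : inner ℝ k n / (4 * Real.pi) * Y ^ 2 ≤ 5 * Y * ‖F‖ := by
    have : 0 ≤ z.re * ‖h‖ ^ 2 + ν / 2 * ‖w‖ ^ 2 := by positivity
    linarith
  rcases hY.eq_or_lt with h0 | h0
  · rw [← h0]; positivity
  · have h4 : inner ℝ k n / (4 * Real.pi) * Y ≤ 5 * ‖F‖ := by
      refine le_of_mul_le_mul_left ?_ h0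
      linarith
    calc Y = 4 * Real.pi / inner ℝ k n * (inner ℝ k n / (4 * Real.pi) * Y) := by field_simp
      _ ≤ 4 * Real.pi / inner ℝ k n * (5 * ‖F‖) := by gcongr
      _ = _ := by ring

/-- Combines both choices of y: the hypoelliptic energy, whose right side is estimated by the
directional norm. The result is of order (ν⟨k, n⟩)^(-1/2)‖F‖, half of the directional gain. -/
theorem IsSol.norm_sq_le_of_resolventSymbol (hs : IsSol z k ν B h w r₀ 0) (hz : 0 ≤ z.re)
    (hν : 0 < ν) (hB : ‖B‖ ≤ ν / 10) {n : EuclideanSpace ℝ ι} (hn : 0 < inner ℝ k n) {F : L2E ι}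
    (hF : r₀ = fmul (resolventSymbol n) F) {R : ℝ} (hR : 0 < R) (hRk : ν * R ^ 3 = ‖k‖) :
    (R * ‖h‖ + ‖w‖) ^ 2 ≤ 3200 * Real.pi / (ν * inner ℝ k n) * ‖F‖ ^ 2 := by
  have hk : k ≠ 0 := by
    rintro rfl
    simp at hn
  have h1 := hs.norm_sq_le hz hν hB hk hR hRk
  have h3 := hs.weighted_norm_le hz hν hB hn hF
  have h2 : ‖energyRhs ((‖k‖ * R)⁻¹ • k) h w r₀ 0‖
      ≤ 5 * ‖fmul (star (resolventSymbol n)) h‖ * ‖F‖ := by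
    unfold energyRhs
    rw [inner_zero_right, add_zero, hF, inner_fmul_left, fmul_comm, ← star_star (resolventSymbol n),
      ← inner_fmul_left]
    refine (norm_inner_le_norm _ _).trans ?_
    rw [star_star, star_arctanSymbol]
    calc _ ≤ ‖fmul (star (resolventSymbol n)) h‖ * (5 * ‖F‖) := by
          gcongr; exact norm_fmul_le (norm_arctanSymbol_le _) F
      _ = _ := by ring
  calc (R * ‖h‖ + ‖w‖) ^ 2 ≤ 32 / ν * (5 * (20 * Real.pi / inner ℝ k n * ‖F‖) * ‖F‖) := by
        refine h1.trans ?_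
        have := h2.trans (mul_le_mul_of_nonneg_right (mul_le_mul_of_nonneg_left h3
          (by norm_num : (0 : ℝ) ≤ 5)) (norm_nonneg F))
        gcongr
    _ = _ := by field_simp; ring

/-- Dual to the preceding estimate: arbitrary data, output measured in direction n, and the same
constant 3200π = 4π·5·160. Composing the two gives ν times (ν⟨k, n⟩)⁻¹, so ν disappears. -/
theorem IsSol.weighted_norm_sq_le (hs : IsSol z k ν B h w r₀ r₁) (hz : 0 ≤ z.re) (hν : 0 < ν)
    (hB : ‖B‖ ≤ ν / 10) {n : EuclideanSpace ℝ ι} (hn : 0 < inner ℝ k n) {R : ℝ} (hR : 0 < R)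
    (hRk : ν * R ^ 3 = ‖k‖) :
    ‖fmul (star (resolventSymbol n)) h‖ ^ 2
      ≤ 3200 * Real.pi / (ν * inner ℝ k n) * (R⁻¹ * ‖r₀‖ + ‖r₁‖) ^ 2 := by
  have hk : k ≠ 0 := by
    rintro rfl
    simp at hn
  have h1 := hs.energy hz hν.le hB n
  have h2 := norm_energyRhs_le n hR (h := h) (w := w) (r₀ := r₀) (r₁ := r₁)
  have h3 := hs.norm_le hz hν hB hk hR hRk
  have hpi := Real.pi_pos
  set Y := ‖fmul (star (resolventSymbol n)) h‖
  set T := R⁻¹ * ‖r₀‖ + ‖r₁‖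
  have hT : 0 ≤ T := by positivity
  have h4 : inner ℝ k n / (4 * Real.pi) * Y ^ 2 ≤ 5 * (160 / ν * T) * T := by
    have : 0 ≤ z.re * ‖h‖ ^ 2 + ν / 2 * ‖w‖ ^ 2 := by positivity
    have h5 : 5 * (R * ‖h‖ + ‖w‖) * T ≤ 5 * (160 / ν * T) * T := by gcongr
    linarith
  calc Y ^ 2 = 4 * Real.pi / inner ℝ k n * (inner ℝ k n / (4 * Real.pi) * Y ^ 2) := by field_simp
    _ ≤ 4 * Real.pi / inner ℝ k n * (5 * (160 / ν * T) * T) := by gcongr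
    _ = _ := by field_simp; ring

end Estimates

/-! ### Abstract solvability and weak measurability. -/

section Lions

/-- Lions' theorem: solvability of `⟨a φ, v⟩ = ⟨J φ, f⟩` for all test vectors `φ`. -/
theorem exists_clm_inner_eq {D H G : Type*} [AddCommGroup D] [Module ℂ D]
    [NormedAddCommGroup H] [InnerProductSpace ℂ H] [CompleteSpace H]
    [NormedAddCommGroup G] [InnerProductSpace ℂ G] (V : Submodule ℂ G) [CompleteSpace V]
    (a : D →ₗ[ℂ] V) (J : D →ₗ[ℂ] H) (ha : DenseRange a) {C : ℝ}
    (hC : ∀ φ, ‖J φ‖ ≤ C * ‖a φ‖) :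
    ∃ R : H →L[ℂ] V, ∀ f v, R f = v ↔ ∀ φ, inner ℂ (a φ) v = inner ℂ (J φ) f := by
  -- The a priori bound makes aφ ↦ Jφ a well defined bounded map on the dense range of a; its
  -- adjoint is the solution operator.
  refine ⟨ContinuousLinearMap.adjoint (J.extendOfNorm a), fun f v => ?_⟩
  have h1 : ∀ φ, inner ℂ (a φ) (ContinuousLinearMap.adjoint (J.extendOfNorm a) f)
      = inner ℂ (J φ) f := fun φ => by
    rw [ContinuousLinearMap.adjoint_inner_right, LinearMap.extendOfNorm_eq ha ⟨C, hC⟩]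
  refine ⟨fun h φ => by rw [← h, h1], fun h => ?_⟩
  refine ha.eq_of_inner_right ℂ ?_
  rintro φ
  rw [h1, h]

theorem denseRange_of_forall_inner_eq_zero {D V : Type*} [AddCommGroup D] [Module ℂ D]
    [NormedAddCommGroup V] [InnerProductSpace ℂ V] [CompleteSpace V] (a : D →ₗ[ℂ] V)
    (h : ∀ v, (∀ φ, inner ℂ (a φ) v = 0) → v = 0) : DenseRange a := by
  have h1 : (LinearMap.range a).topologicalClosure = ⊤ := by
    rw [Submodule.topologicalClosure_eq_top_iff, Submodule.eq_bot_iff]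
    intro v hv
    exact h v fun φ => hv _ (LinearMap.mem_range_self a φ)
  intro v
  have : v ∈ (LinearMap.range a).topologicalClosure := by rw [h1]; trivial
  rwa [← SetLike.mem_coe, Submodule.topologicalClosure_coe, LinearMap.coe_range] at this

variable {Ω V : Type*} [MeasurableSpace Ω] [NormedAddCommGroup V] [InnerProductSpace ℂ V]
  [SecondCountableTopology V]

/-- ‖x‖ ≤ c is equivalent to countably many scalar conditions |⟨g, x⟩| ≤ c‖g‖, with g in a dense
sequence. -/
theorem measurable_norm_of_measurable_inner {x : Ω → V}
    (hx : ∀ g, Measurable fun t => inner ℂ g (x t)) : Measurable fun t => ‖x t‖ := by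
  refine measurable_of_Iic fun c => ?_
  rcases lt_or_ge c 0 with hc | hc
  · convert MeasurableSet.empty
    ext t
    simpa using hc.trans_le (norm_nonneg (x t))
  have : (fun t => ‖x t‖) ⁻¹' Set.Iic c
      = ⋂ n, {t | ‖inner ℂ (TopologicalSpace.denseSeq V n) (x t)‖
          ≤ c * ‖TopologicalSpace.denseSeq V n‖} := by
    ext t
    simp only [Set.mem_preimage, Set.mem_Iic, Set.mem_iInter, Set.mem_ofPred_eq]
    constructor
    · intro h n
      refine (norm_inner_le_norm _ _).trans ?_
      rw [mul_comm]
      gcongr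
    · intro h
      have h1 : ∀ g : V, ‖inner ℂ g (x t)‖ ≤ c * ‖g‖ := by
        intro g
        refine (TopologicalSpace.denseRange_denseSeq V).induction_on
          (p := fun g => ‖inner ℂ g (x t)‖ ≤ c * ‖g‖) g ?_ h
        exact isClosed_le (by fun_prop) (by fun_prop)
      rcases eq_or_ne (x t) 0 with h0 | h0
      · rwa [h0, norm_zero]
      · have := h1 (x t)
        rw [inner_self_eq_norm_sq_to_K] at this
        have h2 : ‖x t‖ * ‖x t‖ ≤ c * ‖x t‖ := by simpa [sq] using this
        exact le_of_mul_le_mul_right h2 (norm_pos_iff.2 h0)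
  rw [this]
  exact MeasurableSet.iInter fun n => measurableSet_le (hx _).norm measurable_const

/-- For each n take the first index j with ‖a t j - g‖ < 1/(n+1). This index depends measurably on
t, and the pairings with v t at these indices converge to ⟨g, v t⟩. -/
theorem measurable_inner_of_dense {a : Ω → ℕ → V} {v : Ω → V}
    (ha : ∀ j g, Measurable fun t => inner ℂ g (a t j)) (hd : ∀ t, DenseRange (a t))
    (hv : ∀ j, Measurable fun t => inner ℂ (a t j) (v t)) (g : V) :
    Measurable fun t => inner ℂ g (v t) := by
  have hdist : ∀ j, Measurable fun t => ‖a t j - g‖ := fun j =>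
    measurable_norm_of_measurable_inner fun g' => by
      simp only [inner_sub_right]
      exact (ha j g').sub measurable_const
  have hex : ∀ (n : ℕ) t, ∃ j, ‖a t j - g‖ < 1 / ((n : ℝ) + 1) := fun n t => by
    obtain ⟨j, hj⟩ := (hd t).exists_dist_lt g (ε := 1 / ((n : ℝ) + 1)) (by positivity)
    exact ⟨j, by rwa [← dist_eq_norm, dist_comm]⟩
  classical
  have hm : ∀ n : ℕ, Measurable fun t => inner ℂ (a t (Nat.find (hex n t))) (v t) := fun n =>
    Measurable.find (f := fun j t => inner ℂ (a t j) (v t)) hv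
      (fun j => measurableSet_lt (hdist j) measurable_const) (hex n)
  refine measurable_of_tendsto_metrizable hm (tendsto_pi_nhds.2 fun t => ?_)
  refine Tendsto.inner ?_ tendsto_const_nhds
  rw [tendsto_iff_norm_sub_tendsto_zero]
  exact squeeze_zero (fun _ => norm_nonneg _) (fun n => (Nat.find_spec (hex n t)).le)
    tendsto_one_div_add_atTop_nhds_zero_nat

end Lions

/-! ### Well-posedness of the resolvent equation and measurability of its solutions. -/

section Existence

variable {ι : Type*} [Fintype ι] [DecidableEq ι]

/-- The gradient of a Schwartz function in `L²`. -/
def gradSchwartz : 𝓢(EuclideanSpace ℝ ι, ℂ) →ₗ[ℂ] Grad ι where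
  toFun φ := WithLp.toLp 2 fun e => (∂_{EuclideanSpace.single e (1 : ℝ)} φ).toLp 2 volume
  map_add' φ ψ := by
    ext1 e
    simp only [LineDeriv.lineDerivOp_add]
    exact (SchwartzMap.toLpCLM ℂ ℂ 2 (volume : Measure (EuclideanSpace ℝ ι))).map_add _ _
  map_smul' c φ := by
    ext1 e
    simp only [LineDeriv.lineDerivOp_smul]
    exact (SchwartzMap.toLpCLM ℂ ℂ 2 (volume : Measure (EuclideanSpace ℝ ι))).map_smul _ _

theorem gradSchwartz_apply (φ : 𝓢(EuclideanSpace ℝ ι, ℂ)) (e : ι) :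
    gradSchwartz φ e = (∂_{EuclideanSpace.single e (1 : ℝ)} φ).toLp 2 volume := rfl

/-- Multiplication of a Schwartz function by the function `v ↦ ⟨v, k⟩`, in `L²`. -/
def transportSchwartz (k : EuclideanSpace ℝ ι) : 𝓢(EuclideanSpace ℝ ι, ℂ) →ₗ[ℂ] L2E ι :=
  (SchwartzMap.toLpCLM ℂ ℂ 2 (volume : Measure (EuclideanSpace ℝ ι)) ∘L
    SchwartzMap.smulLeftCLM ℂ (fun v => ((inner ℝ v k : ℝ) : ℂ))).toLinearMap

theorem transportSchwartz_apply (k : EuclideanSpace ℝ ι) (φ : 𝓢(EuclideanSpace ℝ ι, ℂ)) :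
    transportSchwartz k φ
      = (SchwartzMap.smulLeftCLM ℂ (fun v => ((inner ℝ v k : ℝ) : ℂ)) φ).toLp 2 volume := rfl

theorem transportSchwartz_eq_sum (k : EuclideanSpace ℝ ι) (φ : 𝓢(EuclideanSpace ℝ ι, ℂ)) :
    transportSchwartz k φ
      = ∑ e, ((k e : ℝ) : ℂ) • transportSchwartz (EuclideanSpace.single e (1 : ℝ)) φ := by
  have h : SchwartzMap.smulLeftCLM ℂ (fun v => ((inner ℝ v k : ℝ) : ℂ)) φ
      = ∑ e, ((k e : ℝ) : ℂ) • SchwartzMap.smulLeftCLM ℂ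
        (fun v => ((inner ℝ v (EuclideanSpace.single e (1 : ℝ)) : ℝ) : ℂ)) φ := by
    ext v
    rw [SchwartzMap.smulLeftCLM_apply_apply (by fun_prop), sum_apply]
    simp only [smul_apply]
    simp_rw [fun e => SchwartzMap.smulLeftCLM_apply_apply (F := ℂ)
      (g := fun v : EuclideanSpace ℝ ι => ((inner ℝ v (EuclideanSpace.single e (1 : ℝ)) : ℝ) : ℂ))
      (by fun_prop) φ v]
    simp only [smul_eq_mul, ← mul_assoc, ← Finset.sum_mul]
    congr 1
    rw [PiLp.inner_apply]
    push_cast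
    refine Finset.sum_congr rfl fun e _ => ?_
    simp [EuclideanSpace.inner_single_right]
  change SchwartzMap.toLpCLM ℂ ℂ 2 (volume : Measure (EuclideanSpace ℝ ι))
    (SchwartzMap.smulLeftCLM ℂ (fun v => ((inner ℝ v k : ℝ) : ℂ)) φ) = _
  rw [h, map_sum]
  simp only [map_smul]
  rfl

theorem re_inner_transportSchwartz (k : EuclideanSpace ℝ ι) (φ : 𝓢(EuclideanSpace ℝ ι, ℂ)) :
    (Complex.I * inner ℂ (transportSchwartz k φ) (φ.toLp 2 volume)).re = 0 := by
  have h := re_inner_fmul_transport (ρ := 1) (dρ := 0) (k := k) (by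
      change (fun _ : EuclideanSpace ℝ ι => (1 : ℂ)).HasTemperateGrowth
      fun_prop) (star_one _) (fun x => by
      change HasLineDerivAt ℝ (fun _ => (1 : ℂ)) 0 x k
      exact (hasFDerivAt_const (1 : ℂ) x).hasLineDerivAt k) φ
  have h0 : fmul (0 : EuclideanSpace ℝ ι →ᵇ ℂ) (φ.toLp 2 volume) = 0 := by
    have := fmul_smul (0 : ℂ) (0 : EuclideanSpace ℝ ι →ᵇ ℂ) (φ.toLp 2 volume)
    simpa using this
  rw [fmul_one, h0, inner_zero_right, Complex.zero_re, mul_zero] at h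
  rw [← inner_conj_symm, transportSchwartz_apply]
  simp only [Complex.mul_re, Complex.I_re, Complex.I_im, zero_mul, one_mul, zero_sub,
    Complex.conj_im] at h ⊢
  linarith

/-- The space of pairs `(h, ∇h)` with `h ∈ H¹`. -/
def sobolevPairs (ι : Type*) [Fintype ι] [DecidableEq ι] :
    Submodule ℂ (WithLp 2 (L2E ι × Grad ι)) where
  carrier := {p | HasGrad p.fst p.snd}
  add_mem' {p q} hp hq := HasGrad.add hp hq
  zero_mem' := by
    have := (hasGrad_toLp (0 : 𝓢(EuclideanSpace ℝ ι, ℂ))).smul 0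
    simpa using this
  smul_mem' c p hp := HasGrad.smul hp c

theorem sobolevPairs_ext {p q : sobolevPairs ι} (h1 : p.1.fst = q.1.fst)
    (h2 : p.1.snd = q.1.snd) : p = q := by
  obtain ⟨⟨p₁, p₂⟩, hp⟩ := p
  obtain ⟨⟨q₁, q₂⟩, hq⟩ := q
  obtain rfl : p₁ = q₁ := h1
  obtain rfl : p₂ = q₂ := h2
  rfl

/-- The function underlying a pair `(h, ∇h)`. -/
def sobolevFst : sobolevPairs ι →L[ℂ] L2E ι :=
  LinearMap.mkContinuous
    { toFun := fun p => p.1.fst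
      map_add' := fun _ _ => rfl
      map_smul' := fun _ _ => rfl } 1 fun p => by
    rw [one_mul]
    refine le_of_sq_le_sq ?_ (norm_nonneg _)
    have := WithLp.prod_norm_sq_eq_of_L2 p.1
    change ‖p.1.fst‖ ^ 2 ≤ ‖p.1‖ ^ 2
    rw [this]
    exact le_add_of_nonneg_right (sq_nonneg _)

instance : SecondCountableTopology (L2E ι) :=
  have : Fact ((2 : ENNReal) ≠ ⊤) := ⟨by norm_num⟩
  Lp.SecondCountableTopology

instance : SecondCountableTopology (L2E ι × Grad ι × (ι → L2E ι)) := by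
  have : SecondCountableTopology (ι → L2E ι) := inferInstance
  have : SecondCountableTopology (Grad ι) := inferInstance
  have : SecondCountableTopology (Grad ι × (ι → L2E ι)) := inferInstance
  infer_instance

instance : SecondCountableTopology (sobolevPairs ι) := by
  have : SecondCountableTopology (Grad ι) := inferInstance
  have : SecondCountableTopology (WithLp 2 (L2E ι × Grad ι)) := inferInstance
  exact TopologicalSpace.Subtype.secondCountableTopology _

theorem mem_sobolevPairs {p : WithLp 2 (L2E ι × Grad ι)} :
    p ∈ sobolevPairs ι ↔ HasGrad p.fst p.snd := Iff.rfl

theorem isClosed_sobolevPairs : IsClosed (sobolevPairs ι : Set (WithLp 2 (L2E ι × Grad ι))) := by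
  have : (sobolevPairs ι : Set (WithLp 2 (L2E ι × Grad ι)))
      = ⋂ e : ι, (fun p : WithLp 2 (L2E ι × Grad ι) => (p.fst, p.snd e)) ⁻¹'
        {p | IsWeakDeriv (EuclideanSpace.single e (1 : ℝ)) p.1 p.2} := by
    ext p
    simp [mem_sobolevPairs, HasGrad]
  rw [this]
  refine isClosed_iInter fun e => (isClosed_isWeakDeriv _).preimage ?_
  fun_prop

instance : CompleteSpace (sobolevPairs ι) :=
  isClosed_sobolevPairs.isComplete.completeSpace_coe

/-- The pair `(φ, ∇φ)` together with the components of `v φ`. -/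
def graphSchwartz : 𝓢(EuclideanSpace ℝ ι, ℂ) →ₗ[ℂ] L2E ι × Grad ι × (ι → L2E ι) :=
  (SchwartzMap.toLpCLM ℂ ℂ 2 (volume : Measure (EuclideanSpace ℝ ι))).toLinearMap.prod
    (gradSchwartz.prod (LinearMap.pi fun e =>
      transportSchwartz (EuclideanSpace.single e (1 : ℝ))))

/-- The formal adjoint `conj z - i k · v - ν Δ - div B† ∇`, composed with the projection to
`H¹`. -/
def adjointGraph (z : ℂ) (k : EuclideanSpace ℝ ι) (ν : ℝ) (B : Grad ι →L[ℂ] Grad ι) :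
    (L2E ι × Grad ι × (ι → L2E ι)) →L[ℂ] sobolevPairs ι :=
  (sobolevPairs ι).orthogonalProjectionOnto ∘L
    (WithLp.prodContinuousLinearEquiv 2 ℂ (L2E ι) (Grad ι)).symm.toContinuousLinearMap ∘L
    ContinuousLinearMap.prod (conj z • ContinuousLinearMap.fst ℂ (L2E ι) (Grad ι × (ι → L2E ι)) -
        Complex.I • ∑ e, ((k e : ℝ) : ℂ) • (ContinuousLinearMap.proj (R := ℂ) (φ := fun _ => L2E ι) e
          ∘L ContinuousLinearMap.snd ℂ (Grad ι) (ι → L2E ι) ∘L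
          ContinuousLinearMap.snd ℂ (L2E ι) (Grad ι × (ι → L2E ι))))
      (((ν : ℂ) • ContinuousLinearMap.id ℂ (Grad ι) + ContinuousLinearMap.adjoint B) ∘L
        ContinuousLinearMap.fst ℂ (Grad ι) (ι → L2E ι) ∘L
          ContinuousLinearMap.snd ℂ (L2E ι) (Grad ι × (ι → L2E ι)))

variable {z : ℂ} {k : EuclideanSpace ℝ ι} {ν : ℝ} {B : Grad ι →L[ℂ] Grad ι}

/-- Projecting onto the H¹ pairs does not change the pairing with such a pair. The sesquilinear form
is therefore represented inside the Hilbert space to which Lions' theorem is applied. -/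
theorem inner_adjointGraph (x : L2E ι × Grad ι × (ι → L2E ι)) (p : sobolevPairs ι) :
    inner ℂ (adjointGraph z k ν B x) p
      = z * inner ℂ x.1 p.1.fst + Complex.I * inner ℂ (∑ e, ((k e : ℝ) : ℂ) • x.2.2 e) p.1.fst
        + (ν : ℂ) * inner ℂ x.2.1 p.1.snd + inner ℂ x.2.1 (B p.1.snd) := by
  simp only [adjointGraph, ContinuousLinearMap.comp_apply]
  rw [Submodule.inner_orthogonalProjectionOnto_eq_of_mem_right, WithLp.prod_inner_apply]
  simp [inner_sub_left, inner_add_left, inner_smul_left, ContinuousLinearMap.adjoint_inner_left,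
    -Complex.coe_smul]
  ring

/-- The formal adjoint on Schwartz functions. -/
def adjointSchwartz (z : ℂ) (k : EuclideanSpace ℝ ι) (ν : ℝ) (B : Grad ι →L[ℂ] Grad ι) :
    𝓢(EuclideanSpace ℝ ι, ℂ) →ₗ[ℂ] sobolevPairs ι :=
  (adjointGraph z k ν B).toLinearMap ∘ₗ graphSchwartz

theorem adjointSchwartz_apply (φ : 𝓢(EuclideanSpace ℝ ι, ℂ)) :
    adjointSchwartz z k ν B φ = adjointGraph z k ν B (graphSchwartz φ) := rfl

theorem inner_adjointGraph_schwartz (φ : 𝓢(EuclideanSpace ℝ ι, ℂ)) (p : sobolevPairs ι) :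
    inner ℂ (adjointSchwartz z k ν B φ) p
      = z * inner ℂ (φ.toLp 2 volume) p.1.fst
        + Complex.I * inner ℂ (transportSchwartz k φ) p.1.fst
        + (ν : ℂ) * inner ℂ (gradSchwartz φ) p.1.snd
        + inner ℂ (gradSchwartz φ) (B p.1.snd) := by
  rw [adjointSchwartz_apply, inner_adjointGraph, transportSchwartz_eq_sum]
  rfl

theorem isSol_iff {h : L2E ι} {w : Grad ι} {f : L2E ι} :
    IsSol z k ν B h w f 0 ↔ HasGrad h w ∧ ∀ φ : 𝓢(EuclideanSpace ℝ ι, ℂ),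
      z * inner ℂ (φ.toLp 2 volume) h + Complex.I * inner ℂ (transportSchwartz k φ) h
        + (ν : ℂ) * inner ℂ (gradSchwartz φ) w + inner ℂ (gradSchwartz φ) (B w)
      = inner ℂ (φ.toLp 2 volume) f := by
  have key : ∀ φ : 𝓢(EuclideanSpace ℝ ι, ℂ), Complex.I * inner ℂ
      ((SchwartzMap.smulLeftCLM ℂ (fun v => ((inner ℝ v k : ℝ) : ℂ)) φ).toLp 2 volume) h
      + inner ℂ (φ.toLp 2 volume) (z • h - f)
      + ∑ e, inner ℂ ((∂_{EuclideanSpace.single e (1 : ℝ)} φ).toLp 2 volume)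
        ((ν : ℂ) • w e + (B w) e - (0 : Grad ι) e)
      = (z * inner ℂ (φ.toLp 2 volume) h + Complex.I * inner ℂ (transportSchwartz k φ) h
        + (ν : ℂ) * inner ℂ (gradSchwartz φ) w + inner ℂ (gradSchwartz φ) (B w))
        - inner ℂ (φ.toLp 2 volume) f := by
    intro φ
    simp only [PiLp.inner_apply, gradSchwartz_apply, transportSchwartz_apply, inner_sub_right,
      inner_add_right, inner_smul_right, Finset.sum_add_distrib, Finset.mul_sum, PiLp.zero_apply,
      sub_zero]
    ring
  constructor
  · rintro ⟨h1, h2⟩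
    exact ⟨h1, fun φ => sub_eq_zero.1 ((key φ).symm.trans (h2 φ))⟩
  · rintro ⟨h1, h2⟩
    exact ⟨h1, fun φ => (key φ).trans (sub_eq_zero.2 (h2 φ))⟩

/-- The energy estimate with y = 0, where the symbol is the constant 3: no transport term remains,
and damping and dissipation must vanish separately. -/
theorem IsSol.eq_zero {h : L2E ι} {w : Grad ι} (hs : IsSol z k ν B h w 0 0) (hz : 0 < z.re)
    (hν : 0 < ν) (hB : ‖B‖ ≤ ν / 10) : h = 0 ∧ w = 0 := by
  have h1 := hs.energy hz.le hν.le hB 0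
  simp only [energyRhs, inner_zero_right, add_zero, norm_zero, zero_div, zero_mul] at h1
  have h2 : 0 ≤ z.re * ‖h‖ ^ 2 := by positivity
  have h3 : 0 ≤ ν / 2 * ‖w‖ ^ 2 := by positivity
  have h4 : z.re * ‖h‖ ^ 2 = 0 := by linarith
  have h5 : ν / 2 * ‖w‖ ^ 2 = 0 := by linarith
  exact ⟨by simpa [hz.ne'] using h4, by simpa [hν.ne'] using h5⟩

/-- A pair orthogonal to the range of the formal adjoint is a weak solution of the homogeneous
equation, so density is uniqueness. -/
theorem denseRange_adjointGraph (hz : 0 < z.re) (hν : 0 < ν) (hB : ‖B‖ ≤ ν / 10) :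
    DenseRange (adjointSchwartz z k ν B) := by
  refine denseRange_of_forall_inner_eq_zero (D := 𝓢(EuclideanSpace ℝ ι, ℂ)) (V := sobolevPairs ι) _ fun p hp => ?_
  have h1 : IsSol z k ν B p.1.fst p.1.snd 0 0 := by
    refine isSol_iff.2 ⟨p.2, fun φ => ?_⟩
    rw [inner_zero_right, ← inner_adjointGraph_schwartz]
    exact hp φ
  obtain ⟨h2, h3⟩ := h1.eq_zero hz hν hB
  exact sobolevPairs_ext h2 h3

/-- Coercivity: the adjoint image of φ is paired with (φ, ∇φ). Transport has no real part, and B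
takes at most ν/10 from ν, leaving more than ν/2. -/
theorem norm_le_norm_adjointGraph (hz : 0 < z.re) (hν : 0 < ν) (hB : ‖B‖ ≤ ν / 10)
    (φ : 𝓢(EuclideanSpace ℝ ι, ℂ)) :
    ‖φ.toLp 2 (volume : Measure (EuclideanSpace ℝ ι))‖
      ≤ (min z.re (ν / 2))⁻¹ * ‖adjointSchwartz z k ν B φ‖ := by
  set p : sobolevPairs ι :=
    ⟨WithLp.toLp 2 (φ.toLp 2 volume, gradSchwartz φ), hasGrad_toLp φ⟩ with hp
  have h1 := inner_adjointGraph_schwartz (z := z) (k := k) (ν := ν) (B := B) φ p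
  have e1 : p.1.fst = φ.toLp 2 volume := rfl
  have e2 : p.1.snd = gradSchwartz φ := rfl
  rw [e1, e2] at h1
  set c := min z.re (ν / 2)
  have hc : 0 < c := lt_min hz (by positivity)
  have hpn : ‖p‖ ^ 2 = ‖φ.toLp 2 (volume : Measure (EuclideanSpace ℝ ι))‖ ^ 2
      + ‖gradSchwartz φ‖ ^ 2 := by
    change ‖(p : WithLp 2 (L2E ι × Grad ι))‖ ^ 2 = _
    rw [WithLp.prod_norm_sq_eq_of_L2]
    rfl
  have h2 := congrArg Complex.re h1
  have h3 : (inner ℂ (φ.toLp 2 (volume : Measure (EuclideanSpace ℝ ι))) (φ.toLp 2 volume) : ℂ)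
      = ((‖φ.toLp 2 (volume : Measure (EuclideanSpace ℝ ι))‖ ^ 2 : ℝ) : ℂ) := by
    rw [inner_self_eq_norm_sq_to_K]; norm_cast
  have h4 : (inner ℂ (gradSchwartz φ) (gradSchwartz φ) : ℂ)
      = ((‖gradSchwartz φ‖ ^ 2 : ℝ) : ℂ) := by
    rw [inner_self_eq_norm_sq_to_K]; norm_cast
  rw [h3, h4, Complex.add_re, Complex.add_re, Complex.add_re, re_inner_transportSchwartz,
    Complex.re_mul_ofReal, ← Complex.ofReal_mul, Complex.ofReal_re] at h2
  have h5 : -(ν / 10 * ‖gradSchwartz φ‖ ^ 2)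
      ≤ (inner ℂ (gradSchwartz φ) (B (gradSchwartz φ))).re := by
    have a1 : ‖inner ℂ (gradSchwartz φ) (B (gradSchwartz φ))‖
        ≤ ‖gradSchwartz φ‖ * (ν / 10 * ‖gradSchwartz φ‖) :=
      (norm_inner_le_norm _ _).trans (by gcongr; exact B.le_of_opNorm_le hB _)
    have a2 := (abs_le.1 (Complex.abs_re_le_norm
      (inner ℂ (gradSchwartz φ) (B (gradSchwartz φ))))).1
    nlinarith
  have h6 : c * ‖p‖ ^ 2 ≤ ‖adjointSchwartz z k ν B φ‖ * ‖p‖ := by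
    have b1 := (Complex.re_le_norm _).trans (norm_inner_le_norm (𝕜 := ℂ)
      (adjointSchwartz z k ν B φ) p)
    have b2 : c ≤ z.re := min_le_left _ _
    have b3 : c ≤ ν / 2 := min_le_right _ _
    rw [hpn]
    nlinarith [sq_nonneg ‖φ.toLp 2 (volume : Measure (EuclideanSpace ℝ ι))‖,
      sq_nonneg ‖gradSchwartz φ‖]
  have h7 : ‖φ.toLp 2 (volume : Measure (EuclideanSpace ℝ ι))‖ ≤ ‖p‖ := by
    refine le_of_sq_le_sq ?_ (norm_nonneg _)
    nlinarith [sq_nonneg ‖gradSchwartz φ‖]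
  refine h7.trans ?_
  rw [← div_eq_inv_mul, le_div_iff₀ hc]
  rcases (norm_nonneg p).eq_or_lt with h0 | h0
  · rw [← h0, zero_mul]; positivity
  · refine le_of_mul_le_mul_right ?_ h0
    linarith

/-- Well-posedness of the resolvent equation. -/
theorem exists_resolvent (hz : 0 < z.re) (hν : 0 < ν) (hB : ‖B‖ ≤ ν / 10) :
    ∃ R : L2E ι →L[ℂ] L2E ι, ∀ f h, R f = h ↔ ∃ w, IsSol z k ν B h w f 0 := by
  obtain ⟨R, hR⟩ := exists_clm_inner_eq (D := 𝓢(EuclideanSpace ℝ ι, ℂ)) (H := L2E ι)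
    (sobolevPairs ι) (adjointSchwartz z k ν B)
    (SchwartzMap.toLpCLM ℂ ℂ 2 (volume : Measure (EuclideanSpace ℝ ι))).toLinearMap
    (denseRange_adjointGraph hz hν hB) (norm_le_norm_adjointGraph (k := k) hz hν hB)
  have key : ∀ f (p : sobolevPairs ι), R f = p ↔ IsSol z k ν B p.1.fst p.1.snd f 0 := by
    intro f p
    rw [hR, isSol_iff]
    refine ⟨fun h => ⟨p.2, fun φ => ?_⟩, fun h φ => ?_⟩
    · rw [← inner_adjointGraph_schwartz]
      exact h φ
    · exact (inner_adjointGraph_schwartz φ p).trans (h.2 φ)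
  refine ⟨sobolevFst ∘L R, fun f h => ⟨?_, ?_⟩⟩
  · rintro rfl
    exact ⟨(R f).1.snd, (key f (R f)).1 rfl⟩
  · rintro ⟨w, hw⟩
    have := (key f ⟨WithLp.toLp 2 (h, w), hw.grad⟩).2 hw
    change (R f).1.fst = h
    rw [this]
    rfl

/-- The solution is determined by its pairings with the adjoint images of test functions, and these
pairings equal ⟨φ, f⟩, independent of t. It remains to make countably many images dense for all t
simultaneously. -/
theorem measurable_inner_resolvent {Ω : Type*} [MeasurableSpace Ω] {k : Ω → EuclideanSpace ℝ ι}
    (hk : Measurable k) {B : Ω → Grad ι →L[ℂ] Grad ι}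
    (hBm : ∀ a w, Measurable fun t => inner ℂ a (B t w))
    (hz : 0 < z.re) (hν : 0 < ν) (hB : ∀ t, ‖B t‖ ≤ ν / 10) {f : L2E ι} {h : Ω → L2E ι}
    (hs : ∀ t, ∃ w, IsSol z (k t) ν (B t) (h t) w f 0) (g : L2E ι) :
    Measurable fun t => inner ℂ g (h t) := by
  choose w hw using hs
  -- The sequence is dense for the graph norm of (φ, ∇φ, vφ), in which the formal adjoint is bounded
  -- for every t. One sequence therefore serves all parameters.
  have : SecondCountableTopology (Set.range (graphSchwartz : 𝓢(EuclideanSpace ℝ ι, ℂ) → _)) :=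
    TopologicalSpace.Subtype.secondCountableTopology _
  obtain ⟨u, hu⟩ := TopologicalSpace.exists_dense_seq
    (Set.range (graphSchwartz : 𝓢(EuclideanSpace ℝ ι, ℂ) → _))
  choose φ hφ using fun n => (u n).2
  let p : Ω → sobolevPairs ι := fun t => ⟨WithLp.toLp 2 (h t, w t), (hw t).grad⟩
  have hps : ∀ t ψ, inner ℂ (adjointGraph z (k t) ν (B t) (graphSchwartz ψ)) (p t)
      = inner ℂ (ψ.toLp 2 volume) f := fun t ψ => by
    rw [← adjointSchwartz_apply, inner_adjointGraph_schwartz]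
    exact (isSol_iff.1 (hw t)).2 ψ
  have hmain : ∀ q : sobolevPairs ι, Measurable fun t => inner ℂ q (p t) := by
    refine measurable_inner_of_dense
      (a := fun t j => adjointGraph z (k t) ν (B t) (graphSchwartz (φ j))) (fun j q => ?_)
      (fun t => ?_) (fun j => ?_)
    · have : (fun t => inner ℂ q (adjointGraph z (k t) ν (B t) (graphSchwartz (φ j))))
          = fun t => conj (inner ℂ (adjointGraph z (k t) ν (B t) (graphSchwartz (φ j))) q) := by
        funext t; exact (inner_conj_symm (𝕜 := ℂ) (E := sobolevPairs ι) _ _).symm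
      rw [this]
      refine Complex.continuous_conj.measurable.comp ?_
      simp only [inner_adjointGraph, sum_inner, inner_smul_left, Complex.conj_ofReal]
      have hke : ∀ e, Measurable fun t => ((k t e : ℝ) : ℂ) := fun e =>
        Complex.measurable_ofReal.comp ((EuclideanSpace.proj e).continuous.measurable.comp hk)
      refine ((measurable_const.add ((Finset.measurable_sum _ fun e _ =>
        (hke e).mul measurable_const).const_mul _)).add measurable_const).add (hBm _ _)
    · have h1 := denseRange_adjointGraph (k := k t) hz hν (hB t)
      have h2 : DenseRange (fun x : Set.range (graphSchwartz : 𝓢(EuclideanSpace ℝ ι, ℂ) → _) =>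
          adjointGraph z (k t) ν (B t) x.1) := by
        refine h1.mono ?_
        rintro _ ⟨ψ, rfl⟩
        exact ⟨⟨_, ψ, rfl⟩, rfl⟩
      have h3 := h2.comp hu ((adjointGraph z (k t) ν (B t)).continuous.comp continuous_subtype_val)
      have h4 : (fun j => adjointGraph z (k t) ν (B t) (graphSchwartz (φ j)))
          = (fun x : Set.range (graphSchwartz : 𝓢(EuclideanSpace ℝ ι, ℂ) → _) =>
            adjointGraph z (k t) ν (B t) x.1) ∘ u :=
        funext fun j => congrArg (adjointGraph z (k t) ν (B t)) (hφ j)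
      exact h4 ▸ h3
    · have h1 : (fun t => inner ℂ (adjointGraph z (k t) ν (B t) (graphSchwartz (φ j))) (p t))
          = fun _ => inner ℂ ((φ j).toLp 2 volume) f := funext fun t => hps t (φ j)
      exact h1 ▸ measurable_const
  -- Pairing h with g is pairing (h, ∇h) with the projection of (g, 0).
  have := hmain ((sobolevPairs ι).orthogonalProjectionOnto (WithLp.toLp 2 (g, 0)))
  convert this using 2 with t
  rw [Submodule.inner_orthogonalProjectionOnto_eq_of_mem_right, WithLp.prod_inner_apply]
  simp [p]

end Existence

/-! ### Translations as Fourier multipliers. -/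

section Translation

variable {E : Type*} [NormedAddCommGroup E] [InnerProductSpace ℝ E] [FiniteDimensional ℝ E]
  [MeasurableSpace E] [BorelSpace E]

/-- The symbol `exp(2πi ⟨ξ, x⟩)` of the translation by `x`. -/
def charSymbol (x : E) : E →ᵇ ℂ :=
  BoundedContinuousFunction.ofNormedAddCommGroup
    (fun ξ => Complex.exp (((2 * Real.pi * inner ℝ ξ x : ℝ) : ℂ) * Complex.I)) (by fun_prop) 1
    fun ξ => (Complex.norm_exp_ofReal_mul_I _).le

theorem charSymbol_apply (x ξ : E) :
    charSymbol x ξ = Complex.exp (((2 * Real.pi * inner ℝ ξ x : ℝ) : ℂ) * Complex.I) := rfl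

theorem norm_charSymbol (x ξ : E) : ‖charSymbol x ξ‖ = 1 := Complex.norm_exp_ofReal_mul_I _

theorem charSymbol_zero : charSymbol (0 : E) = 1 := by
  ext ξ
  simp [charSymbol_apply]

theorem charSymbol_add (x y : E) : charSymbol (x + y) = charSymbol x * charSymbol y := by
  ext ξ
  rw [BoundedContinuousFunction.mul_apply, charSymbol_apply, charSymbol_apply, charSymbol_apply,
    ← Complex.exp_add, inner_add_right]
  congr 1
  push_cast
  ring

theorem star_charSymbol (x : E) : star (charSymbol x) = charSymbol (-x) := by
  ext ξ
  change conj (charSymbol x ξ) = _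
  rw [charSymbol_apply, charSymbol_apply, ← Complex.exp_conj, map_mul, Complex.conj_I,
    Complex.conj_ofReal, inner_neg_right]
  congr 1
  push_cast
  ring

/-- The translation `f ↦ f(· + x)` on `L²`. -/
def trans (x : E) : Lp ℂ 2 (volume : Measure E) →L[ℂ] Lp ℂ 2 (volume : Measure E) :=
  fmul (charSymbol x)

theorem trans_zero (f : Lp ℂ 2 (volume : Measure E)) : trans 0 f = f := by
  rw [trans, charSymbol_zero, fmul_one]

theorem trans_trans (x y : E) (f : Lp ℂ 2 (volume : Measure E)) :
    trans x (trans y f) = trans (x + y) f := by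
  rw [trans, trans, fmul_fmul, ← charSymbol_add, trans]

theorem trans_neg_trans (x : E) (f : Lp ℂ 2 (volume : Measure E)) :
    trans (-x) (trans x f) = f := by
  rw [trans_trans, neg_add_cancel, trans_zero]

theorem trans_trans_neg (x : E) (f : Lp ℂ 2 (volume : Measure E)) :
    trans x (trans (-x) f) = f := by
  rw [trans_trans, add_neg_cancel, trans_zero]

theorem inner_trans_left (x : E) (f g : Lp ℂ 2 (volume : Measure E)) :
    inner ℂ (trans x f) g = inner ℂ f (trans (-x) g) := by
  rw [trans, inner_fmul_left, star_charSymbol, trans]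

theorem norm_trans (x : E) (f : Lp ℂ 2 (volume : Measure E)) : ‖trans x f‖ = ‖f‖ := by
  have h1 : ∀ (x : E) (f : Lp ℂ 2 (volume : Measure E)), ‖trans x f‖ ≤ ‖f‖ := fun x f => by
    simpa only [one_mul] using! norm_fmul_le (fun ξ => (norm_charSymbol x ξ).le) f
  refine le_antisymm (h1 x f) ?_
  conv_lhs => rw [← trans_neg_trans x f]
  exact h1 _ _

theorem trans_toLp (x : E) (φ : 𝓢(E, ℂ)) :
    trans x (φ.toLp 2 volume) = (φ.compSubConstCLM ℂ (-x)).toLp 2 volume := by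
  refine fourier_injective_L2 ?_
  rw [trans, fourier_fmul, SchwartzMap.toLp_fourier_eq, SchwartzMap.toLp_fourier_eq]
  refine mulOp_eq_of_ae ?_
  filter_upwards [(𝓕 φ : 𝓢(E, ℂ)).coeFn_toLp 2 volume,
    (𝓕 (φ.compSubConstCLM ℂ (-x)) : 𝓢(E, ℂ)).coeFn_toLp 2 volume] with ξ h1 h2
  rw [h1, h2, SchwartzMap.fourier_coe, SchwartzMap.fourier_coe]
  have h3 : (φ.compSubConstCLM ℂ (-x) : E → ℂ) = (φ : E → ℂ) ∘ fun v => v + x := by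
    ext v
    simp
  have h4 := congrFun (VectorFourier.fourierIntegral_comp_add_right Real.fourierChar
    (volume : Measure E) (innerₗ E) (φ : E → ℂ) x) ξ
  rw [h3]
  refine Eq.trans ?_ h4.symm
  rw [Circle.smul_def, smul_eq_mul, Real.fourierChar_apply, charSymbol_apply, innerₗ_apply_apply,
    real_inner_comm]
  rfl

theorem trans_eq_compMeasurePreserving (x : E) (f : Lp ℂ 2 (volume : Measure E)) :
    trans x f = Lp.compMeasurePreserving (fun v => v + x)
      (measurePreserving_add_right volume x) f := by
  have hd := SchwartzMap.denseRange_toLpCLM (E := E) (F := ℂ) (p := 2)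
    (μ := volume) ENNReal.ofNat_ne_top
  refine hd.induction_on (p := fun f => trans x f = Lp.compMeasurePreserving (fun v => v + x)
      (measurePreserving_add_right volume x) f) f ?_ ?_
  · exact isClosed_eq (trans x).continuous
      (Lp.isometry_compMeasurePreserving _).continuous
  · intro φ
    rw [SchwartzMap.toLpCLM_apply, trans_toLp]
    refine Lp.ext ?_
    have h1 := (measurePreserving_add_right volume x).quasiMeasurePreserving.ae
      (φ.coeFn_toLp 2 volume)
    filter_upwards [(φ.compSubConstCLM ℂ (-x)).coeFn_toLp 2 volume,
      Lp.coeFn_compMeasurePreserving (φ.toLp 2 volume)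
      (measurePreserving_add_right volume x), h1] with v h2 h3 h4
    rw [h2, h3, Function.comp_apply, h4]
    simp

theorem coeFn_trans (x : E) (f : Lp ℂ 2 (volume : Measure E)) :
    trans x f =ᵐ[volume] fun v => f (v + x) := by
  rw [trans_eq_compMeasurePreserving]
  exact Lp.coeFn_compMeasurePreserving f (measurePreserving_add_right volume x)

end Translation

/-! ### Translating the equation. -/

section GradTranslation

variable {ι : Type*} [Fintype ι] [DecidableEq ι]

/-- Translation of vector fields. -/
def gtrans (x : EuclideanSpace ℝ ι) : Grad ι →L[ℂ] Grad ι :=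
  LinearMap.mkContinuous
    { toFun := fun w => WithLp.toLp 2 fun e => trans x (w e)
      map_add' := fun w w' => by ext1 e; exact map_add (trans x) _ _
      map_smul' := fun c w => by ext1 e; exact map_smul (trans x) _ _ } 1 fun w => by
    refine le_of_sq_le_sq ?_ (by positivity)
    rw [one_mul, PiLp.norm_sq_eq_of_L2, PiLp.norm_sq_eq_of_L2]
    refine Finset.sum_le_sum fun e _ => ?_
    change ‖trans x (w e)‖ ^ 2 ≤ _
    rw [norm_trans]

theorem gtrans_apply (x : EuclideanSpace ℝ ι) (w : Grad ι) (e : ι) :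
    gtrans x w e = trans x (w e) := rfl

theorem norm_gtrans (x : EuclideanSpace ℝ ι) (w : Grad ι) : ‖gtrans x w‖ = ‖w‖ := by
  refine (sq_eq_sq₀ (norm_nonneg _) (norm_nonneg _)).1 ?_
  rw [PiLp.norm_sq_eq_of_L2, PiLp.norm_sq_eq_of_L2]
  simp only [gtrans_apply, norm_trans]

theorem gtrans_neg_gtrans (x : EuclideanSpace ℝ ι) (w : Grad ι) : gtrans (-x) (gtrans x w) = w := by
  ext1 e
  exact trans_neg_trans x _

theorem inner_gtrans_left (x : EuclideanSpace ℝ ι) (a w : Grad ι) :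
    inner ℂ (gtrans x a) w = inner ℂ a (gtrans (-x) w) := by
  simp only [PiLp.inner_apply, gtrans_apply, inner_trans_left]

/-- Conjugation of an operator by translations. -/
def conjTrans (x : EuclideanSpace ℝ ι) (B : Grad ι →L[ℂ] Grad ι) : Grad ι →L[ℂ] Grad ι :=
  gtrans x ∘L B ∘L gtrans (-x)

variable {z : ℂ} {k : EuclideanSpace ℝ ι} {ν : ℝ} {B : Grad ι →L[ℂ] Grad ι}
  {h r₀ : L2E ι} {w r₁ : Grad ι}

theorem norm_conjTrans_le (x : EuclideanSpace ℝ ι) : ‖conjTrans x B‖ ≤ ‖B‖ := by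
  refine ContinuousLinearMap.opNorm_le_bound _ (norm_nonneg _) fun w => ?_
  change ‖gtrans x (B (gtrans (-x) w))‖ ≤ _
  rw [norm_gtrans, ← norm_gtrans (-x) w]
  exact B.le_opNorm _

theorem compSubConst_lineDeriv {E : Type*} [NormedAddCommGroup E] [NormedSpace ℝ E]
    (x y : E) (φ : 𝓢(E, ℂ)) :
    (∂_{y} (φ.compSubConstCLM ℂ x) : 𝓢(E, ℂ)) = (∂_{y} φ : 𝓢(E, ℂ)).compSubConstCLM ℂ x := by
  ext v
  rw [SchwartzMap.compSubConstCLM_apply, SchwartzMap.lineDerivOp_apply_eq_fderiv,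
    SchwartzMap.lineDerivOp_apply_eq_fderiv]
  have : (φ.compSubConstCLM ℂ x : E → ℂ) = fun v => φ (v - x) := rfl
  rw [this, fderiv_comp_sub]

/-- Translation changes k·v by the constant k·x. In the equation this is an imaginary shift of z,
invisible to the energy estimates, which use only Re z. -/
theorem TransportEq.trans {p : L2E ι} {s : ι → L2E ι} (ht : TransportEq k h p s)
    (x : EuclideanSpace ℝ ι) :
    TransportEq k (trans x h)
      (RenormalizedHierarchy.trans x p
        + (Complex.I * ((inner ℝ k x : ℝ) : ℂ)) • RenormalizedHierarchy.trans x h)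
      (fun e => RenormalizedHierarchy.trans x (s e)) := by
  intro φ
  have h1 := ht (φ.compSubConstCLM ℂ x)
  have h2 : SchwartzMap.smulLeftCLM ℂ (fun v => ((inner ℝ v k : ℝ) : ℂ)) (φ.compSubConstCLM ℂ x)
      = (SchwartzMap.smulLeftCLM ℂ (fun v => ((inner ℝ v k : ℝ) : ℂ)) φ).compSubConstCLM ℂ x
        + ((inner ℝ k x : ℝ) : ℂ) • φ.compSubConstCLM ℂ x := by
    ext v
    rw [SchwartzMap.smulLeftCLM_apply_apply (by fun_prop), add_apply, smul_apply,
      SchwartzMap.compSubConstCLM_apply, SchwartzMap.compSubConstCLM_apply,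
      SchwartzMap.smulLeftCLM_apply_apply (by fun_prop), inner_sub_left, real_inner_comm x k]
    simp only [smul_eq_mul]
    push_cast
    ring
  have h3 : ∀ ψ : 𝓢(EuclideanSpace ℝ ι, ℂ), (ψ.compSubConstCLM ℂ x).toLp 2 volume
      = RenormalizedHierarchy.trans (-x) (ψ.toLp 2 volume) := fun ψ => by
    rw [trans_toLp, neg_neg]
  have h4 : ((SchwartzMap.smulLeftCLM ℂ (fun v => ((inner ℝ v k : ℝ) : ℂ)) φ).compSubConstCLM ℂ x
        + ((inner ℝ k x : ℝ) : ℂ) • φ.compSubConstCLM ℂ x).toLp 2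
          (volume : Measure (EuclideanSpace ℝ ι))
      = RenormalizedHierarchy.trans (-x)
          ((SchwartzMap.smulLeftCLM ℂ (fun v => ((inner ℝ v k : ℝ) : ℂ)) φ).toLp 2 volume)
        + ((inner ℝ k x : ℝ) : ℂ) • RenormalizedHierarchy.trans (-x) (φ.toLp 2 volume) := by
    rw [← h3, ← h3]
    change SchwartzMap.toLpCLM ℂ ℂ 2 volume _ = _
    rw [map_add, map_smul]
    rfl
  rw [h2, h4] at h1
  simp only [compSubConst_lineDeriv, h3, inner_add_left, inner_smul_left, Complex.conj_ofReal,
    inner_trans_left, neg_neg] at h1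
  rw [inner_add_right, inner_smul_right]
  linear_combination h1

theorem IsSol.trans (hs : IsSol z k ν B h w r₀ r₁) (x : EuclideanSpace ℝ ι) :
    IsSol (z + Complex.I * ((inner ℝ k x : ℝ) : ℂ)) k ν (conjTrans x B)
      (RenormalizedHierarchy.trans x h) (gtrans x w)
      (RenormalizedHierarchy.trans x r₀) (gtrans x r₁) where
  grad := hs.grad.map_fmul _
  eq := by
    have h1 := hs.eq.trans x
    convert h1 using 1
    · rw [map_sub, map_smul, add_smul]
      abel
    · funext e
      rw [map_sub, map_add, map_smul]
      simp only [conjTrans, ContinuousLinearMap.comp_apply, gtrans_neg_gtrans, gtrans_apply]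

end GradTranslation

/-! ### Iterated differences. -/

section Differences

variable {X V : Type*} [AddCommGroup X] [AddCommGroup V]

/-- Iterated forward differences. -/
def fdiff : List X → (X → V) → X → V
  | [], F => F
  | y :: A, F => fun x => fdiff A F (x + y) - fdiff A F x

theorem fdiff_shift (A : List X) (F : X → V) (y x : X) :
    fdiff A (fun x => F (x + y)) x = fdiff A F (x + y) := by
  induction A generalizing x with
  | nil => rfl
  | cons a A ih => simp only [fdiff, ih, add_right_comm x y a]

theorem fdiff_sub (A : List X) (F G : X → V) (x : X) :
    fdiff A (fun x => F x - G x) x = fdiff A F x - fdiff A G x := by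
  induction A generalizing x with
  | nil => rfl
  | cons a A ih => simp only [fdiff, ih]; abel

theorem fdiff_add (A : List X) (F G : X → V) (x : X) :
    fdiff A (fun x => F x + G x) x = fdiff A F x + fdiff A G x := by
  induction A generalizing x with
  | nil => rfl
  | cons a A ih => simp only [fdiff, ih]; abel

/-- The definition takes the first direction as the outermost difference; here it acts first on the
function itself, which is the form needed for inductions on products. -/
theorem fdiff_cons' (y : X) (A : List X) (F : X → V) (x : X) :
    fdiff (y :: A) F x = fdiff A (fun x => F (x + y) - F x) x := by
  rw [fdiff_sub, fdiff_shift, fdiff]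

theorem fdiff_const (v : V) {A : List X} (hA : A ≠ []) (x : X) :
    fdiff A (fun _ => v) x = 0 := by
  cases A with
  | nil => exact absurd rfl hA
  | cons a A =>
    rw [fdiff_cons']
    clear hA
    induction A generalizing x with
    | nil => exact sub_self v
    | cons b A ih => simp only [fdiff, sub_self] at ih ⊢; simp only [ih, sub_self]

theorem map_fdiff {W : Type*} [AddCommGroup W] (T : V →+ W) (A : List X) (F : X → V) (x : X) :
    T (fdiff A F x) = fdiff A (fun x => T (F x)) x := by
  induction A generalizing x with
  | nil => rfl
  | cons a A ih => simp only [fdiff, map_sub, ih]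

theorem fdiff_comp {Y : Type*} [AddCommGroup Y] (i : X →+ Y) (A : List X) (F : Y → V) (x : X) :
    fdiff A (fun x => F (i x)) x = fdiff (A.map i) F (i x) := by
  induction A generalizing x with
  | nil => rfl
  | cons a A ih => simp only [fdiff, List.map_cons, ih, map_add]

theorem fdiff_additive (L : X →+ V) (y : X) (A : List X) (x : X) :
    fdiff (y :: A) (fun x => L x) x = if A = [] then L y else 0 := by
  rw [fdiff_cons']
  simp only [map_add, add_sub_cancel_left]
  split_ifs with h
  · rw [h]; rfl
  · exact fdiff_const _ h x

end Differences

/-! ### Discrete Leibniz rule. -/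

section Leibniz

variable {X : Type*} [AddCommGroup X] {U V : Type*} [NormedAddCommGroup U] [NormedSpace ℂ U]
  [NormedAddCommGroup V] [NormedSpace ℂ V] (wt : X → ℝ)

/-- The product of the weights of a list of directions. -/
def listWeight (A : List X) : ℝ := (A.map wt).prod

theorem listWeight_cons (y : X) (A : List X) :
    listWeight wt (y :: A) = wt y * listWeight wt A := by
  simp [listWeight]

variable {wt}

theorem listWeight_nonneg (hwt : ∀ y, 0 ≤ wt y) (A : List X) : 0 ≤ listWeight wt A :=
  List.prod_nonneg fun a ha => by
    obtain ⟨y, _, rfl⟩ := List.mem_map.1 ha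
    exact hwt y

/-- Each direction falls either on the operator or on the vector, whence 2 to the length of the
list. The undifferenced operator is left unshifted, so bounds on F are used at the base point only,
while u is needed everywhere. -/
theorem norm_fdiff_apply_le (hwt : ∀ y, 0 ≤ wt y) (n : ℕ) {F : X → U →L[ℂ] V} {u : X → U} {x : X}
    {θ η : ℝ} (hθ : 0 ≤ θ)
    (hF : ∀ A : List X, A.length ≤ n → ‖fdiff A F x‖ ≤ θ * listWeight wt A)
    (hu : ∀ A : List X, A.length ≤ n → ∀ x, ‖fdiff A u x‖ ≤ η * listWeight wt A)
    {J : List X} (hJ : J.length ≤ n) :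
    ‖fdiff J (fun x => F x (u x)) x‖ ≤ 2 ^ J.length * θ * η * listWeight wt J := by
  induction J generalizing n F u θ η with
  | nil =>
    have h1 := hF [] (by simp)
    have h2 := hu [] (by simp) x
    simp only [listWeight, List.map_nil, List.prod_nil, mul_one, fdiff] at h1 h2 ⊢
    simpa using (F x).le_of_opNorm_le_of_le h1 h2
  | cons y J ih =>
    obtain ⟨n, rfl⟩ : ∃ m, n = m + 1 := ⟨n - 1, by simp at hJ; omega⟩
    have hJ' : J.length ≤ n := by simpa using hJ
    rw [fdiff_cons']
    have e : (fun x => F (x + y) (u (x + y)) - F x (u x))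
        = fun x => (F (x + y) - F x) (u (x + y)) + F x (u (x + y) - u x) := by
      funext x
      simp only [sub_apply, map_sub]
      abel
    rw [e, fdiff_add]
    have i1 := ih n (F := fun x => F (x + y) - F x) (u := fun x => u (x + y)) (θ := wt y * θ)
      (η := η) (mul_nonneg (hwt y) hθ) (fun A hA => by
        rw [← fdiff_cons']
        refine (hF (y :: A) (by simpa using hA)).trans_eq ?_
        rw [listWeight_cons]; ring) (fun A hA x => by
        rw [fdiff_shift]
        exact hu A (by omega) _) hJ'
    have i2 := ih n (F := F) (u := fun x => u (x + y) - u x) (θ := θ) (η := wt y * η) hθ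
      (fun A hA => hF A (by omega)) (fun A hA x => by
        rw [← fdiff_cons']
        refine (hu (y :: A) (by simpa using hA) x).trans_eq ?_
        rw [listWeight_cons]; ring) hJ'
    refine (norm_add_le _ _).trans ((add_le_add i1 i2).trans_eq ?_)
    rw [listWeight_cons, List.length_cons, pow_succ]
    ring

/-- When all differences fall on u, the operator is evaluated at the base point, where it vanishes.
Hence strictly fewer differences of u are required; this is what allows an induction on their
number. -/
theorem norm_fdiff_apply_le_of_eq_zero (hwt : ∀ y, 0 ≤ wt y) (n : ℕ) {F : X → U →L[ℂ] V}
    {u : X → U} {x : X} {θ η : ℝ} (hθ : 0 ≤ θ) (hη : 0 ≤ η) (h0 : F x = 0)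
    (hF : ∀ A : List X, A.length ≤ n → ‖fdiff A F x‖ ≤ θ * listWeight wt A)
    (hu : ∀ A : List X, A.length < n → ∀ x, ‖fdiff A u x‖ ≤ η * listWeight wt A)
    {J : List X} (hJ : J.length ≤ n) :
    ‖fdiff J (fun x => F x (u x)) x‖ ≤ 2 ^ J.length * θ * η * listWeight wt J := by
  induction J generalizing n u η with
  | nil =>
    simp only [fdiff, h0, zero_apply, norm_zero]
    have := listWeight_nonneg hwt []
    positivity
  | cons y J ih =>
    obtain ⟨n, rfl⟩ : ∃ m, n = m + 1 := ⟨n - 1, by simp at hJ; omega⟩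
    have hJ' : J.length ≤ n := by simpa using hJ
    rw [fdiff_cons']
    have e : (fun x => F (x + y) (u (x + y)) - F x (u x))
        = fun x => (F (x + y) - F x) (u (x + y)) + F x (u (x + y) - u x) := by
      funext x
      simp only [sub_apply, map_sub]
      abel
    rw [e, fdiff_add]
    have i1 := norm_fdiff_apply_le hwt n (F := fun x => F (x + y) - F x) (x := x)
      (u := fun x => u (x + y)) (θ := wt y * θ)
      (η := η) (mul_nonneg (hwt y) hθ) (fun A hA => by
        rw [← fdiff_cons']
        refine (hF (y :: A) (by simpa using hA)).trans_eq ?_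
        rw [listWeight_cons]; ring) (fun A hA x => by
        rw [fdiff_shift]
        exact hu A (by omega) _) hJ'
    have i2 := ih n (u := fun x => u (x + y) - u x) (η := wt y * η) (mul_nonneg (hwt y) hη)
      (fun A hA => hF A (by omega)) (fun A hA x => by
        rw [← fdiff_cons']
        refine (hu (y :: A) (by simpa using hA) x).trans_eq ?_
        rw [listWeight_cons]; ring) hJ'
    refine (norm_add_le _ _).trans ((add_le_add i1 i2).trans_eq ?_)
    rw [listWeight_cons, List.length_cons, pow_succ]
    ring

end Leibniz

/-! ### Estimates for differences of solutions. -/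

section DifferenceEstimate

variable {ι : Type*} [Fintype ι] [DecidableEq ι]

variable {z z' : ℂ} {k : EuclideanSpace ℝ ι} {ν : ℝ} {B B' : Grad ι →L[ℂ] Grad ι}
  {h h' r₀ r₀' : L2E ι} {w w' r₁ r₁' : Grad ι}

theorem TransportEq.sub {p p' : L2E ι} {s s' : ι → L2E ι} (h1 : TransportEq k h p s)
    (h2 : TransportEq k h' p' s') : TransportEq k (h - h') (p - p') (s - s') := by
  intro φ
  have := congrArg₂ (· - ·) (h1 φ) (h2 φ)
  simp only [sub_zero] at this
  simp only [inner_sub_right, Pi.sub_apply, Finset.sum_sub_distrib]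
  rw [← this]
  ring

theorem IsSol.sub (h1 : IsSol z k ν B h w r₀ r₁) (h2 : IsSol z k ν B h' w' r₀' r₁') :
    IsSol z k ν B (h - h') (w - w') (r₀ - r₀') (r₁ - r₁') where
  grad := h1.grad.sub h2.grad
  eq := by
    convert h1.eq.sub h2.eq using 1
    · rw [smul_sub]; abel
    · funext e
      simp only [map_sub, PiLp.sub_apply, Pi.sub_apply, smul_sub]
      abel

/-- Used to freeze the coefficients at a base point: solutions for nearby coefficients become
solutions of one equation, with the discrepancy in the data. -/
theorem IsSol.change_operator (hs : IsSol z k ν B h w r₀ r₁) (z' : ℂ)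
    (B' : Grad ι →L[ℂ] Grad ι) :
    IsSol z' k ν B' h w (r₀ - (z - z') • h) (r₁ - (B - B') w) where
  grad := hs.grad
  eq := by
    convert hs.eq using 1
    · rw [sub_smul]; abel
    · funext e
      simp only [sub_apply, PiLp.sub_apply]
      abel

variable {X : Type*} [AddCommGroup X]

theorem IsSol.fdiff {h r₀ : X → L2E ι} {w r₁ : X → Grad ι}
    (hs : ∀ x, IsSol z k ν B (h x) (w x) (r₀ x) (r₁ x)) (J : List X) (x : X) :
    IsSol z k ν B (fdiff J h x) (fdiff J w x) (fdiff J r₀ x)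
      (fdiff J r₁ x) := by
  induction J generalizing x with
  | nil => exact hs x
  | cons y J ih => exact (ih (x + y)).sub (ih x)

/-- The constants in the estimate of differences of solutions. -/
def diffConst (ϑ : ℝ) : ℕ → ℝ
  | 0 => 1
  | n + 1 => 1 + 160 * 2 ^ (n + 1) * (1 + ϑ) * diffConst ϑ n

theorem one_le_diffConst {ϑ : ℝ} (hϑ : 0 ≤ ϑ) (n : ℕ) : 1 ≤ diffConst ϑ n := by
  induction n with
  | zero => exact le_rfl
  | succ n ih =>
    rw [diffConst]
    have : 0 ≤ 160 * 2 ^ (n + 1) * (1 + ϑ) * diffConst ϑ n := by positivity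
    linarith

variable {wt : X → ℝ} {L : X →+ ℝ} {R ϑ η : ℝ} {Bx : X → Grad ι →L[ℂ] Grad ι}
  {hx rx : X → L2E ι} {wx : X → Grad ι}

/-- After freezing z and B at x, the data contain (L x' - L x) hx and (Bx x' - Bx x) wx. Both
coefficients vanish at x' = x, so only lower differences of the solution enter. The bound νR² on L
meets D/R on h and R⁻¹ on the data, giving νD, the same size as the contribution of B. -/
theorem exists_isSol_fdiff (hwt : ∀ y, 0 ≤ wt y) (hν : 0 < ν) (hR : 0 < R) (hϑ : 0 ≤ ϑ)
    (hs : ∀ x, IsSol (z + Complex.I * ((L x : ℝ) : ℂ)) k ν (Bx x) (hx x) (wx x) (rx x) 0)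
    (hL : ∀ y, |L y| ≤ ν * R ^ 2 * wt y) (n : ℕ)
    (hB : ∀ A : List X, A ≠ [] → A.length ≤ n + 1 → ∀ x,
      ‖fdiff A Bx x‖ ≤ ϑ * ν * listWeight wt A)
    (hr : ∀ A : List X, A ≠ [] → A.length ≤ n + 1 → ∀ x,
      160 / (ν * R) * ‖fdiff A rx x‖ ≤ η * listWeight wt A)
    {D : ℝ} (hD : 0 ≤ D)
    (hind : ∀ A : List X, A.length ≤ n → ∀ x,
      R * ‖fdiff A hx x‖ + ‖fdiff A wx x‖ ≤ D * listWeight wt A)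
    {J : List X} (hJ : J ≠ []) (hJn : J.length ≤ n + 1) (x : X) :
    ∃ r₀ r₁, IsSol (z + Complex.I * ((L x : ℝ) : ℂ)) k ν (Bx x) (fdiff J hx x) (fdiff J wx x)
        r₀ r₁ ∧
      160 / ν * (R⁻¹ * ‖r₀‖ + ‖r₁‖)
        ≤ (η + 160 * 2 ^ J.length * (1 + ϑ) * D) * listWeight wt J := by
  have h1 := IsSol.fdiff (fun x' => (hs x').change_operator (z + Complex.I * ((L x : ℝ) : ℂ))
    (Bx x)) J x
  refine ⟨_, _, h1, ?_⟩
  have hP := listWeight_nonneg hwt J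
  -- the scalar part
  let G : X →+ (L2E ι →L[ℂ] L2E ι) :=
    { toFun := fun x => (Complex.I * ((L x : ℝ) : ℂ)) • ContinuousLinearMap.id ℂ (L2E ι)
      map_zero' := by simp
      map_add' := fun x y => by rw [map_add]; push_cast; rw [mul_add, add_smul] }
  have hG : ∀ y, ‖G y‖ ≤ |L y| := fun y => by
    change ‖(Complex.I * ((L y : ℝ) : ℂ)) • ContinuousLinearMap.id ℂ (L2E ι)‖ ≤ _
    rw [norm_smul, norm_mul, Complex.norm_I, one_mul, Complex.norm_real, Real.norm_eq_abs]
    exact mul_le_of_le_one_right (abs_nonneg _) ContinuousLinearMap.norm_id_le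
  have s1 := norm_fdiff_apply_le_of_eq_zero hwt (n + 1) (F := fun x' => G x' - G x) (u := hx)
    (x := x) (θ := ν * R ^ 2) (η := D / R) (by positivity) (by positivity) (sub_self _)
    (fun A _ => by
      rw [fdiff_sub]
      match A with
      | [] =>
        simp only [fdiff, sub_self, norm_zero]
        have := listWeight_nonneg hwt []
        positivity
      | y :: A =>
        rw [fdiff_const _ (by simp), sub_zero, fdiff_additive]
        split_ifs with hA
        · rw [hA, listWeight_cons]
          simpa [listWeight] using (hG y).trans (hL y)
        · rw [norm_zero]
          have := listWeight_nonneg hwt (y :: A)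
          positivity)
    (fun A hA x => by
      rw [div_mul_eq_mul_div, le_div_iff₀ hR]
      have := hind A (by omega) x
      linarith [norm_nonneg (fdiff A wx x)]) hJn
  have s2 := norm_fdiff_apply_le_of_eq_zero hwt (n + 1) (F := fun x' => Bx x' - Bx x) (u := wx)
    (x := x) (θ := ϑ * ν) (η := D) (by positivity) hD (sub_self _)
    (fun A hA => by
      rw [fdiff_sub]
      rcases eq_or_ne A [] with rfl | h0
      · simp only [fdiff, sub_self, norm_zero]
        have := listWeight_nonneg hwt []
        positivity
      · rw [fdiff_const _ h0, sub_zero]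
        exact hB A h0 hA x)
    (fun A hA x => by
      have := hind A (by omega) x
      have h0 : 0 ≤ R * ‖fdiff A hx x‖ := by positivity
      linarith) hJn
  have e0 : fdiff J (fun x' => rx x' - (z + Complex.I * ((L x' : ℝ) : ℂ)
      - (z + Complex.I * ((L x : ℝ) : ℂ))) • hx x') x
      = fdiff J rx x - fdiff J (fun x' => (G x' - G x) (hx x')) x := by
    rw [← fdiff_sub]
    congr 1
    funext x'
    change _ = rx x' - ((Complex.I * ((L x' : ℝ) : ℂ)) • hx x'
      - (Complex.I * ((L x : ℝ) : ℂ)) • hx x')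
    rw [← sub_smul, add_sub_add_left_eq_sub]
  have e1 : fdiff J (fun x' => (0 : Grad ι) - (Bx x' - Bx x) (wx x')) x
      = - fdiff J (fun x' => (Bx x' - Bx x) (wx x')) x := by
    rw [fdiff_sub, fdiff_const _ hJ, zero_sub]
  rw [e0, e1, norm_neg]
  have s0 := hr J hJ hJn x
  set a := ‖fdiff J rx x‖
  set b := ‖fdiff J (fun x' => (G x' - G x) (hx x')) x‖
  set c := ‖fdiff J (fun x' => (Bx x' - Bx x) (wx x')) x‖
  have s3 := norm_sub_le (fdiff J rx x) (fdiff J (fun x' => (G x' - G x) (hx x')) x)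
  calc 160 / ν * (R⁻¹ * ‖fdiff J rx x - fdiff J (fun x' => (G x' - G x) (hx x')) x‖ + c)
      ≤ 160 / ν * (R⁻¹ * (a + 2 ^ J.length * (ν * R ^ 2) * (D / R) * listWeight wt J)
        + 2 ^ J.length * (ϑ * ν) * D * listWeight wt J) := by
        gcongr
        exact s3.trans (by gcongr)
    _ = 160 / (ν * R) * a + 160 * 2 ^ J.length * (1 + ϑ) * D * listWeight wt J := by
        field_simp
        ring
    _ ≤ η * listWeight wt J + 160 * 2 ^ J.length * (1 + ϑ) * D * listWeight wt J := by gcongr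
    _ = _ := by ring

/-- Keeps the equation together with the bound on its data, and not just the resulting bound on the
solution: the directional estimate is later applied to the same equation. -/
theorem exists_isSol_fdiff_le (hwt : ∀ y, 0 ≤ wt y) (hz : 0 ≤ z.re) (hν : 0 < ν) (hk : k ≠ 0)
    (hR : 0 < R) (hRk : ν * R ^ 3 = ‖k‖) (hϑ : 0 ≤ ϑ) (hη : 0 ≤ η)
    (hs : ∀ x, IsSol (z + Complex.I * ((L x : ℝ) : ℂ)) k ν (Bx x) (hx x) (wx x) (rx x) 0)
    (hL : ∀ y, |L y| ≤ ν * R ^ 2 * wt y) (hBx : ∀ x, ‖Bx x‖ ≤ ν / 10)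
    (h0 : ∀ x, R * ‖hx x‖ + ‖wx x‖ ≤ η) (n : ℕ)
    (hB : ∀ A : List X, A ≠ [] → A.length ≤ n → ∀ x,
      ‖fdiff A Bx x‖ ≤ ϑ * ν * listWeight wt A)
    (hr : ∀ A : List X, A ≠ [] → A.length ≤ n → ∀ x,
      160 / (ν * R) * ‖fdiff A rx x‖ ≤ η * listWeight wt A)
    {J : List X} (hJ : J ≠ []) (hJn : J.length ≤ n) (x : X) :
    ∃ r₀ r₁, IsSol (z + Complex.I * ((L x : ℝ) : ℂ)) k ν (Bx x) (fdiff J hx x) (fdiff J wx x)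
        r₀ r₁ ∧
      160 / ν * (R⁻¹ * ‖r₀‖ + ‖r₁‖) ≤ diffConst ϑ n * η * listWeight wt J := by
  induction n generalizing J x with
  | zero => exact absurd (List.length_eq_zero_iff.1 (Nat.le_zero.1 hJn)) hJ
  | succ n ih =>
    have hD := one_le_diffConst hϑ n
    obtain ⟨r₀, r₁, h1, h2⟩ := exists_isSol_fdiff hwt hν hR hϑ hs hL n hB hr
      (D := diffConst ϑ n * η) (by positivity) (fun A hA x => by
        rcases eq_or_ne A [] with rfl | hA0
        · simp only [fdiff, listWeight, List.map_nil, List.prod_nil, mul_one]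
          exact (h0 x).trans (le_mul_of_one_le_left hη hD)
        · obtain ⟨r₀, r₁, h1, h2⟩ := ih (fun A hA hA' => hB A hA (by omega))
            (fun A hA hA' => hr A hA (by omega)) hA0 hA x
          exact (h1.norm_le (by simpa using hz) hν (hBx x) hk hR hRk).trans h2) hJ hJn x
    refine ⟨r₀, r₁, h1, h2.trans ?_⟩
    have hP := listWeight_nonneg hwt J
    gcongr ?_ * _
    have hp : (2 : ℝ) ^ J.length ≤ 2 ^ (n + 1) := pow_le_pow_right₀ (by norm_num) hJn
    calc η + 160 * 2 ^ J.length * (1 + ϑ) * (diffConst ϑ n * η)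
        ≤ η + 160 * 2 ^ (n + 1) * (1 + ϑ) * (diffConst ϑ n * η) := by gcongr
      _ = _ := by rw [diffConst]; ring

theorem norm_fdiff_sol_le (hwt : ∀ y, 0 ≤ wt y) (hz : 0 ≤ z.re) (hν : 0 < ν) (hk : k ≠ 0)
    (hR : 0 < R) (hRk : ν * R ^ 3 = ‖k‖) (hϑ : 0 ≤ ϑ) (hη : 0 ≤ η)
    (hs : ∀ x, IsSol (z + Complex.I * ((L x : ℝ) : ℂ)) k ν (Bx x) (hx x) (wx x) (rx x) 0)
    (hL : ∀ y, |L y| ≤ ν * R ^ 2 * wt y) (hBx : ∀ x, ‖Bx x‖ ≤ ν / 10)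
    (h0 : ∀ x, R * ‖hx x‖ + ‖wx x‖ ≤ η) (n : ℕ)
    (hB : ∀ A : List X, A ≠ [] → A.length ≤ n → ∀ x,
      ‖fdiff A Bx x‖ ≤ ϑ * ν * listWeight wt A)
    (hr : ∀ A : List X, A ≠ [] → A.length ≤ n → ∀ x,
      160 / (ν * R) * ‖fdiff A rx x‖ ≤ η * listWeight wt A)
    {J : List X} (hJn : J.length ≤ n) (x : X) :
    R * ‖fdiff J hx x‖ + ‖fdiff J wx x‖ ≤ diffConst ϑ n * η * listWeight wt J := by
  rcases eq_or_ne J [] with rfl | hJ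
  · simp only [fdiff, listWeight, List.map_nil, List.prod_nil, mul_one]
    exact (h0 x).trans (le_mul_of_one_le_left hη (one_le_diffConst hϑ n))
  · obtain ⟨r₀, r₁, h1, h2⟩ := exists_isSol_fdiff_le hwt hz hν hk hR hRk hϑ hη hs hL hBx h0 n hB
      hr hJ hJn x
    exact (h1.norm_le (by simpa using hz) hν (hBx x) hk hR hRk).trans h2

end DifferenceEstimate

/-! ### From difference quotients to derivatives. -/

section DifferenceQuotients

variable {E : Type*} [NormedAddCommGroup E] [InnerProductSpace ℝ E] [FiniteDimensional ℝ E]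
  [MeasurableSpace E] [BorelSpace E]

/-- The symbol of an iterated difference. -/
def diffSymbol (A : List E) : E →ᵇ ℂ := (A.map fun y => charSymbol y - 1).prod

theorem diffSymbol_cons (y : E) (A : List E) :
    diffSymbol (y :: A) = (charSymbol y - 1) * diffSymbol A := by
  simp [diffSymbol]

theorem fdiff_trans (A : List E) (f : Lp ℂ 2 (volume : Measure E)) (x : E) :
    fdiff A (fun x => trans x f) x = fmul (diffSymbol A) (trans x f) := by
  induction A generalizing x with
  | nil => simp [fdiff, diffSymbol, fmul_one]
  | cons y A ih =>
    have e : charSymbol y * diffSymbol A = diffSymbol (y :: A) + diffSymbol A := by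
      rw [diffSymbol_cons]; ring
    simp only [fdiff, ih]
    rw [add_comm x y, ← trans_trans, trans, trans, fmul_comm (diffSymbol A),
      fmul_fmul (charSymbol y), e, fmul_add, add_sub_cancel_right]

theorem norm_charSymbol_sub_one_le (y ξ : E) :
    ‖charSymbol y ξ - 1‖ ≤ 2 * Real.pi * |inner ℝ ξ y| := by
  rw [charSymbol_apply, mul_comm]
  refine (Real.norm_exp_I_mul_ofReal_sub_one_le).trans_eq ?_
  rw [Real.norm_eq_abs, abs_mul, abs_of_pos (by positivity)]

theorem norm_diffSymbol_le (A : List E) (ξ : E) :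
    ‖diffSymbol A ξ‖ ≤ (2 * Real.pi * ‖ξ‖) ^ A.length * listWeight (‖·‖) A := by
  induction A with
  | nil => simp [diffSymbol, listWeight]
  | cons y A ih =>
    rw [diffSymbol_cons, listWeight_cons, BoundedContinuousFunction.mul_apply, norm_mul,
      List.length_cons, pow_succ]
    have h1 : ‖(charSymbol y - 1) ξ‖ ≤ 2 * Real.pi * ‖ξ‖ * ‖y‖ := by
      exact (norm_charSymbol_sub_one_le y ξ).trans ((mul_le_mul_of_nonneg_left
        (abs_real_inner_le_norm ξ y) (by positivity : 0 ≤ 2 * Real.pi)).trans_eq (by ring))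
    calc _ ≤ (2 * Real.pi * ‖ξ‖ * ‖y‖) *
          ((2 * Real.pi * ‖ξ‖) ^ A.length * listWeight (‖·‖) A) := by gcongr
      _ = _ := by ring

theorem tendsto_charSymbol_quotient (y ξ : E) :
    Tendsto (fun t : ℝ => (t : ℂ)⁻¹ * (charSymbol (t • y) ξ - 1)) (𝓝[>] 0)
      (𝓝 (2 * Real.pi * Complex.I * (inner ℝ ξ y : ℝ))) := by
  have h1 : HasDerivAt (fun t : ℝ => charSymbol (t • y) ξ)
      (2 * Real.pi * Complex.I * (inner ℝ ξ y : ℝ)) 0 := by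
    have h2 : HasDerivAt (fun t : ℝ => Complex.exp ((t : ℂ) * (2 * Real.pi * Complex.I *
        (inner ℝ ξ y : ℝ)))) (Complex.exp (((0 : ℝ) : ℂ) * (2 * Real.pi * Complex.I *
        (inner ℝ ξ y : ℝ))) * (1 * (2 * Real.pi * Complex.I * (inner ℝ ξ y : ℝ)))) 0 :=
      ((Complex.ofRealCLM.hasDerivAt (x := (0 : ℝ))).mul_const _).cexp
    simp only [Complex.ofReal_zero, zero_mul, Complex.exp_zero, one_mul] at h2
    refine h2.congr_of_eventuallyEq (Eventually.of_forall fun t => ?_)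
    change charSymbol (t • y) ξ = _
    rw [charSymbol_apply, real_inner_smul_right]
    congr 1
    push_cast
    ring
  have h3 := h1.tendsto_slope_zero_right
  simpa [charSymbol_apply, Complex.real_smul] using! h3

theorem tendsto_diffSymbol_quotient (A : List E) (ξ : E) :
    Tendsto (fun t : ℝ => ((t : ℂ) ^ A.length)⁻¹ * diffSymbol (A.map (t • ·)) ξ) (𝓝[>] 0)
      (𝓝 (A.map fun y => 2 * Real.pi * Complex.I * ((inner ℝ ξ y : ℝ) : ℂ)).prod) := by
  induction A with
  | nil => simp [diffSymbol]
  | cons y A ih =>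
    rw [List.map_cons, List.prod_cons]
    refine ((tendsto_charSymbol_quotient y ξ).mul ih).congr fun t => ?_
    rw [List.map_cons, diffSymbol_cons, List.length_cons, pow_succ, mul_inv,
      BoundedContinuousFunction.mul_apply, BoundedContinuousFunction.sub_apply]
    simp only [BoundedContinuousFunction.coe_one, Pi.one_apply]
    ring

/-- Bounds of iterated difference quotients give iterated derivatives, in Fourier variables. -/
theorem exists_fourier_eq_of_difference_quotients (A : List E) (f : Lp ℂ 2 (volume : Measure E))
    {D : ℝ} (hD : 0 ≤ D)
    (hf : ∀ t : ℝ, 0 < t → ‖fmul (diffSymbol (A.map (t • ·))) f‖ ≤ t ^ A.length * D) :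
    ∃ u : Lp ℂ 2 (volume : Measure E), ‖u‖ ≤ D ∧
      (𝓕 u : Lp ℂ 2 (volume : Measure E)) =ᵐ[volume] fun ξ =>
        (A.map fun y => 2 * Real.pi * Complex.I * ((inner ℝ ξ y : ℝ) : ℂ)).prod *
          (𝓕 f : Lp ℂ 2 (volume : Measure E)) ξ := by
  set F : Lp ℂ 2 (volume : Measure E) := 𝓕 f with hF
  set σ : E → ℂ := fun ξ =>
    (A.map fun y => 2 * Real.pi * Complex.I * ((inner ℝ ξ y : ℝ) : ℂ)).prod with hσ
  have hσc : Continuous σ := by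
    rw [hσ]
    clear hf hσ σ
    induction A with
    | nil => simpa using continuous_const
    | cons y A ih =>
      simp only [List.map_cons, List.prod_cons]
      exact (by fun_prop : Continuous fun ξ : E =>
        2 * Real.pi * Complex.I * ((inner ℝ ξ y : ℝ) : ℂ)).mul ih
  have hm : AEStronglyMeasurable (fun ξ => σ ξ * F ξ) volume :=
    hσc.aestronglyMeasurable.mul (Lp.memLp F).1
  let t : ℕ → ℝ := fun n => 1 / ((n : ℝ) + 1)
  have ht0 : ∀ n, 0 < t n := fun n => by positivity
  have ht : Tendsto t atTop (𝓝[>] 0) :=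
    tendsto_nhdsWithin_iff.2 ⟨tendsto_one_div_add_atTop_nhds_zero_nat,
      Eventually.of_forall fun n => ht0 n⟩
  let g : ℕ → E → ℂ := fun n ξ => (((t n : ℂ) ^ A.length)⁻¹ * diffSymbol (A.map (t n • ·)) ξ) * F ξ
  -- Fatou's lemma on the Fourier side along t = 1/(n+1): the symbols of the quotients converge
  -- pointwise, and their L² norms stay below D.
  have hlim : eLpNorm (fun ξ => σ ξ * F ξ) 2 volume ≤ ENNReal.ofReal D := by
    refine (Lp.eLpNorm_lim_le_liminf_eLpNorm (f := g) (fun n => ?_) _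
      (Eventually.of_forall fun ξ => ?_)).trans ?_
    · exact ((continuous_const.mul (diffSymbol _).continuous).aestronglyMeasurable).mul
        (Lp.memLp F).1
    · exact ((tendsto_diffSymbol_quotient A ξ).comp ht).mul_const _
    · refine Filter.liminf_le_of_le (by isBoundedDefault) fun b hb => ?_
      obtain ⟨n, hn⟩ := hb.exists
      refine hn.trans ?_
      have e1 : g n =ᵐ[volume] ((((t n : ℂ) ^ A.length)⁻¹ •
          mulOp (diffSymbol (A.map (t n • ·))) F : Lp ℂ 2 (volume : Measure E)) : E → ℂ) := by
        filter_upwards [coeFn_mulOp (diffSymbol (A.map (t n • ·))) F,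
          Lp.coeFn_smul (((t n : ℂ) ^ A.length)⁻¹) (mulOp (diffSymbol (A.map (t n • ·))) F)]
          with ξ h1 h2
        rw [h2, Pi.smul_apply, h1, smul_eq_mul, ← mul_assoc]
      rw [eLpNorm_congr_ae e1, ← Lp.enorm_def, ← ofReal_norm]
      refine ENNReal.ofReal_le_ofReal ?_
      have h3 := hf (t n) (ht0 n)
      rw [← Lp.norm_fourier_eq, fourier_fmul, ← hF] at h3
      rw [norm_smul, norm_inv, norm_pow, Complex.norm_real, Real.norm_eq_abs, abs_of_pos (ht0 n)]
      rw [inv_mul_le_iff₀ (pow_pos (ht0 n) _)]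
      exact h3
  have hmem : MemLp (fun ξ => σ ξ * F ξ) 2 volume := ⟨hm, hlim.trans_lt ENNReal.ofReal_lt_top⟩
  refine ⟨𝓕⁻ (hmem.toLp _), ?_, ?_⟩
  · rw [← Lp.norm_fourier_eq, FourierTransform.fourier_fourierInv_eq, Lp.norm_toLp]
    exact ENNReal.toReal_le_of_le_ofReal hD hlim
  · rw [FourierTransform.fourier_fourierInv_eq]
    exact hmem.coeFn_toLp

theorem norm_fmul_toLp_le {ρ : E →ᵇ ℂ} {σ : E → ℂ} (hσ : σ.HasTemperateGrowth) {c : ℝ}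
    (hc : ∀ ξ, ‖ρ ξ‖ ≤ c * ‖σ ξ‖) (φ : 𝓢(E, ℂ)) :
    ‖fmul ρ (φ.toLp 2 volume)‖
      ≤ c * ‖(SchwartzMap.fourierMultiplierCLM ℂ σ φ).toLp 2 (volume : Measure E)‖ := by
  rw [← Lp.norm_fourier_eq, fourier_fmul, ← Lp.norm_fourier_eq
    ((SchwartzMap.fourierMultiplierCLM ℂ σ φ).toLp 2 (volume : Measure E)),
    SchwartzMap.toLp_fourier_eq, SchwartzMap.toLp_fourier_eq]
  refine Lp.norm_le_mul_norm_of_ae_le_mul ?_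
  filter_upwards [coeFn_mulOp ρ ((𝓕 φ : 𝓢(E, ℂ)).toLp 2 volume),
    (𝓕 φ : 𝓢(E, ℂ)).coeFn_toLp 2 volume,
    (𝓕 (SchwartzMap.fourierMultiplierCLM ℂ σ φ) : 𝓢(E, ℂ)).coeFn_toLp 2 volume] with ξ h1 h2 h3
  have h4 : (𝓕 (SchwartzMap.fourierMultiplierCLM ℂ σ φ) : 𝓢(E, ℂ))
      = SchwartzMap.smulLeftCLM ℂ σ (𝓕 φ : 𝓢(E, ℂ)) := by
    rw [SchwartzMap.fourierMultiplierCLM_apply, FourierTransform.fourier_fourierInv_eq]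
  rw [h1, h2, h3, h4, SchwartzMap.smulLeftCLM_apply_apply hσ, norm_mul, smul_eq_mul, norm_mul,
    ← mul_assoc]
  gcongr
  exact hc ξ

end DifferenceQuotients

/-! ### Splitting off the last particle. -/

section Blocks

variable {d m : ℕ}

/-- The vector `(x, 0)`. -/
def extendVel (x : Config d m) : Config d (m + 1) :=
  WithLp.toLp 2 fun p => Fin.lastCases (motive := fun _ => ℝ) 0 (fun l => x (l, p.2)) p.1

/-- The vector `(0, u)`. -/
def liftLast (u : EuclideanSpace ℝ (Fin d)) : Config d (m + 1) :=
  WithLp.toLp 2 fun p => Fin.lastCases (motive := fun _ => ℝ) (u p.2) (fun _ => 0) p.1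

@[simp]
theorem initVel_add (v w : Config d (m + 1)) : initVel (v + w) = initVel v + initVel w := rfl

@[simp]
theorem lastVel_add (v w : Config d (m + 1)) : lastVel (v + w) = lastVel v + lastVel w := rfl

@[simp]
theorem initVel_smul (c : ℝ) (v : Config d (m + 1)) : initVel (c • v) = c • initVel v := rfl

@[simp]
theorem lastVel_smul (c : ℝ) (v : Config d (m + 1)) : lastVel (c • v) = c • lastVel v := rfl

@[simp]
theorem initVel_extendVel (x : Config d m) : initVel (extendVel x) = x := by
  ext p
  simp [initVel, extendVel]

@[simp]
theorem lastVel_extendVel (x : Config d m) : lastVel (extendVel x) = 0 := by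
  ext i
  simp [lastVel, extendVel]

@[simp]
theorem initVel_liftLast (u : EuclideanSpace ℝ (Fin d)) :
    initVel (liftLast (m := m) u) = 0 := by
  ext p
  simp [initVel, liftLast]

@[simp]
theorem lastVel_liftLast (u : EuclideanSpace ℝ (Fin d)) :
    lastVel (liftLast (m := m) u) = u := by
  ext i
  simp [lastVel, liftLast]

theorem config_ext {v w : Config d (m + 1)} (h1 : initVel v = initVel w)
    (h2 : lastVel v = lastVel w) : v = w := by
  ext ⟨j, i⟩
  induction j using Fin.lastCases with
  | last => exact congrArg (fun u : EuclideanSpace ℝ (Fin d) => u i) h2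
  | cast l => exact congrArg (fun u : Config d m => u (l, i)) h1

theorem inner_config (v w : Config d (m + 1)) :
    inner ℝ v w = inner ℝ (initVel v) (initVel w) + inner ℝ (lastVel v) (lastVel w) := by
  simp only [PiLp.inner_apply, initVel, lastVel, Fintype.sum_prod_type]
  rw [Fin.sum_univ_castSucc]

theorem norm_sq_config (v : Config d (m + 1)) : ‖v‖ ^ 2 = ‖initVel v‖ ^ 2 + ‖lastVel v‖ ^ 2 := by
  rw [← real_inner_self_eq_norm_sq, inner_config, real_inner_self_eq_norm_sq,
    real_inner_self_eq_norm_sq]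

theorem norm_extendVel (x : Config d m) : ‖extendVel x‖ = ‖x‖ := by
  refine (sq_eq_sq₀ (norm_nonneg _) (norm_nonneg _)).1 ?_
  rw [norm_sq_config]
  simp

/-- `extendVel` as an additive map. -/
def extendVelHom : Config d m →+ Config d (m + 1) where
  toFun := extendVel
  map_zero' := config_ext (by rw [initVel_extendVel]; rfl) (by rw [lastVel_extendVel]; rfl)
  map_add' x y := config_ext (by simp) (by simp)

theorem extendVelHom_apply (x : Config d m) : extendVelHom x = extendVel x := rfl

/-- The vector with block `j` equal to `q` and the other blocks zero. -/
def blockVel (j : Fin (m + 1)) (q : EuclideanSpace ℝ (Fin d)) : Config d m :=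
  WithLp.toLp 2 fun p => if p.1 = j then q p.2 else 0

theorem norm_blockVel (j : Fin (m + 1)) (q : EuclideanSpace ℝ (Fin d)) :
    ‖blockVel j q‖ = ‖q‖ := by
  refine (sq_eq_sq₀ (norm_nonneg _) (norm_nonneg _)).1 ?_
  rw [EuclideanSpace.norm_sq_eq, EuclideanSpace.norm_sq_eq, Fintype.sum_prod_type,
    Finset.sum_eq_single j]
  · simp [blockVel]
  · intro b _ hb
    simp [blockVel, hb]
  · simp

@[simp]
theorem initVel_transferMomentum (k : Config d m) (j : Fin (m + 1))
    (q : EuclideanSpace ℝ (Fin d)) : initVel (transferMomentum k j q) = k - blockVel j q := by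
  ext p
  simp [initVel, transferMomentum, blockVel]

@[simp]
theorem lastVel_transferMomentum (k : Config d m) (j : Fin (m + 1))
    (q : EuclideanSpace ℝ (Fin d)) : lastVel (transferMomentum k j q) = q := by
  ext i
  simp [lastVel, transferMomentum]

theorem bracket_pos (k : Config d m) : 0 < bracket k := Real.sqrt_pos.2 (by positivity)

theorem bracket_sq (k : Config d m) : bracket k ^ 2 = 1 + ‖k‖ ^ 2 := Real.sq_sqrt (by positivity)

theorem one_le_bracket (k : Config d m) : 1 ≤ bracket k := by
  refine Real.one_le_sqrt.2 ?_
  nlinarith [sq_nonneg ‖k‖]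

theorem norm_le_bracket (k : Config d m) : ‖k‖ ≤ bracket k :=
  Real.le_sqrt_of_sq_le (by linarith)

/-- A collision enlarges ⟨k⟩ by a factor depending on q only. Powers of this factor are paid for by
the moments of |V̂|². -/
theorem bracket_transferMomentum_le (k : Config d m) (j : Fin (m + 1))
    (q : EuclideanSpace ℝ (Fin d)) :
    bracket (transferMomentum k j q) ≤ bracket k * (2 * (1 + ‖q‖)) := by
  refine le_of_sq_le_sq ?_ (mul_nonneg (bracket_pos k).le (by positivity))
  rw [mul_pow, bracket_sq, bracket_sq, norm_sq_config, initVel_transferMomentum,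
    lastVel_transferMomentum]
  have h1 : ‖k - blockVel j q‖ ≤ ‖k‖ + ‖q‖ :=
    (norm_sub_le _ _).trans_eq (by rw [norm_blockVel])
  have h2 : ‖k - blockVel j q‖ ^ 2 ≤ (‖k‖ + ‖q‖) ^ 2 := by gcongr
  nlinarith [norm_nonneg k, norm_nonneg q, mul_nonneg (norm_nonneg k) (norm_nonneg q),
    mul_nonneg (sq_nonneg ‖k‖) (norm_nonneg q), sq_nonneg (‖k‖ - ‖q‖),
    mul_nonneg (sq_nonneg ‖k‖) (sq_nonneg ‖q‖)]

theorem measurable_transferMomentum (j : Fin (m + 1)) :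
    Measurable fun p : Config d m × EuclideanSpace ℝ (Fin d) =>
      transferMomentum p.1 j p.2 := by
  refine (PiLp.continuous_toLp 2 _).measurable.comp (measurable_pi_lambda _ fun p => ?_)
  obtain ⟨l, i⟩ := p
  induction l using Fin.lastCases with
  | last =>
    simp only [Fin.lastCases_last]
    fun_prop
  | cast l =>
    simp only [Fin.lastCases_castSucc]
    split_ifs <;> fun_prop

theorem quasiMeasurePreserving_initVel :
    Measure.QuasiMeasurePreserving (initVel : Config d (m + 1) → Config d m) volume volume :=
  Measure.quasiMeasurePreserving_fst.comp (measurePreserving_split d m).quasiMeasurePreserving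

end Blocks

/-! ### Tensor products with a function of the last velocity. -/

section Tensor

variable {d m : ℕ} {g g' : EuclideanSpace ℝ (Fin d) → ℂ}

theorem norm_tensor_sq (hg : MemLp g 2 volume) (f : L2 d m) :
    ‖(memLp_tensor_of_memLp (Lp.memLp f) hg).toLp _‖ ^ 2 = ‖hg.toLp g‖ ^ 2 * ‖f‖ ^ 2 := by
  have e1 : ∀ {α : Type} [MeasureSpace α] {h : α → ℂ} (hh : MemLp h 2 volume),
      ‖hh.toLp h‖ ^ 2 = ∫ x, ‖h x‖ ^ 2 := by
    intro α _ h hh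
    rw [← @inner_self_eq_norm_sq ℂ, L2.inner_def, ← integral_re (L2.integrable_inner _ _)]
    refine integral_congr_ae ?_
    filter_upwards [hh.coeFn_toLp] with x hx
    rw [hx, inner_self_eq_norm_sq]
  have e2 : ‖f‖ ^ 2 = ∫ x, ‖f x‖ ^ 2 := by
    conv_lhs => rw [← Lp.toLp_coeFn f (Lp.memLp f)]
    exact e1 _
  rw [e1, e1, e2, mul_comm, ← integral_prod_mul (fun x => ‖f x‖ ^ 2) (fun y => ‖g y‖ ^ 2)]
  have h1 : AEStronglyMeasurable
      (fun z : Config d m × EuclideanSpace ℝ (Fin d) => ‖f z.1‖ ^ 2 * ‖g z.2‖ ^ 2)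
      (volume.prod volume) :=
    ((Lp.memLp f).1.comp_fst.norm.pow 2).mul (hg.1.comp_snd.norm.pow 2)
  rw [← (measurePreserving_split d m).map_eq] at h1 ⊢
  rw [integral_map (measurePreserving_split d m).measurable.aemeasurable h1]
  refine integral_congr_ae (Eventually.of_forall fun v => ?_)
  simp only [norm_mul, mul_pow]
  ring

/-- The tensor product `f ↦ g(v_{m+1}) f(v_0, …, v_m)` with a fixed function `g ∈ L²`. -/
def tensorCLM (hg : MemLp g 2 volume) : L2 d m →L[ℂ] L2 d (m + 1) :=
  LinearMap.mkContinuous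
    { toFun := fun f => (memLp_tensor_of_memLp (Lp.memLp f) hg).toLp _
      map_add' := fun f f' => by
        rw [← MemLp.toLp_add, MemLp.toLp_eq_toLp_iff]
        filter_upwards [quasiMeasurePreserving_initVel.ae (Lp.coeFn_add f f')] with v hv
        simp only [hv, Pi.add_apply, mul_add]
      map_smul' := fun c f => by
        rw [← MemLp.toLp_const_smul, MemLp.toLp_eq_toLp_iff]
        filter_upwards [quasiMeasurePreserving_initVel.ae (Lp.coeFn_smul c f)] with v hv
        simp only [hv, Pi.smul_apply, smul_eq_mul, RingHom.id_apply]
        ring }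
    ‖hg.toLp g‖ fun f => by
      refine le_of_sq_le_sq ?_ (by positivity)
      rw [mul_pow]
      exact (norm_tensor_sq hg f).le

theorem norm_tensorCLM (hg : MemLp g 2 volume) (f : L2 d m) :
    ‖tensorCLM hg f‖ = ‖hg.toLp g‖ * ‖f‖ := by
  refine (sq_eq_sq₀ (norm_nonneg _) (by positivity)).1 ?_
  rw [mul_pow]
  exact norm_tensor_sq hg f

theorem coeFn_tensorCLM (hg : MemLp g 2 volume) (f : L2 d m) :
    tensorCLM hg f =ᵐ[volume] fun v => g (lastVel v) * f (initVel v) :=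
  (memLp_tensor_of_memLp (Lp.memLp f) hg).coeFn_toLp

/-- Only the first m + 1 velocities are translated, so the factor in the last velocity is untouched.
Regularity in the old variables thus passes through the collision operators. -/
theorem trans_tensorCLM (hg : MemLp g 2 volume) (f : L2 d m) (x : Config d m) :
    trans (extendVel x) (tensorCLM hg f) = tensorCLM hg (trans x f) := by
  refine Lp.ext ?_
  have h1 := (measurePreserving_add_right volume (extendVel x)).quasiMeasurePreserving.ae
    (coeFn_tensorCLM hg f)
  filter_upwards [coeFn_trans (extendVel x) (tensorCLM hg f), h1,
    coeFn_tensorCLM hg (trans x f), quasiMeasurePreserving_initVel.ae (coeFn_trans x f)]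
    with v a1 a2 a3 a4
  rw [a1, a2, a3, a4]
  simp

theorem isWeakDeriv_of_integral {E : Type*} [NormedAddCommGroup E] [InnerProductSpace ℝ E]
    [FiniteDimensional ℝ E] [MeasurableSpace E] [BorelSpace E] {y : E}
    {h w : Lp ℂ 2 (volume : Measure E)}
    (H : ∀ φ : 𝓢(E, ℂ), ∫ v, (∂_{y} φ : 𝓢(E, ℂ)) v * h v = -∫ v, φ v * w v) :
    IsWeakDeriv y h w := by
  ext φ
  change (h : 𝓢'(E, ℂ)) (-∂_{y} φ) = (w : 𝓢'(E, ℂ)) φ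
  rw [map_neg, Lp.toTemperedDistribution_apply, Lp.toTemperedDistribution_apply]
  simp only [smul_eq_mul]
  rw [H, neg_neg]

theorem integrable_schwartz_mul {E : Type*} [NormedAddCommGroup E] [InnerProductSpace ℝ E]
    [FiniteDimensional ℝ E] [MeasurableSpace E] [BorelSpace E] (φ : 𝓢(E, ℂ))
    (h : Lp ℂ 2 (volume : Measure E)) : Integrable (fun v => φ v * h v) :=
  (φ.memLp 2 volume).integrable_mul (Lp.memLp h)

/-- Along `liftLast u` the first velocities are fixed, so f acts as a constant and needs no
derivative; integration by parts only involves g. -/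
theorem isWeakDeriv_tensorCLM (hg : MemLp g 2 volume) (hg' : MemLp g' 2 volume)
    {u : EuclideanSpace ℝ (Fin d)} (hd : ∀ v, HasLineDerivAt ℝ g (g' v) v u) (f : L2 d m) :
    IsWeakDeriv (liftLast u) (tensorCLM hg f) (tensorCLM hg' f) := by
  refine isWeakDeriv_of_integral fun φ => ?_
  have e1 : ∫ v, (∂_{liftLast (m := m) u} φ : 𝓢(Config d (m + 1), ℂ)) v * tensorCLM hg f v
      = ∫ v, (∂_{liftLast (m := m) u} φ : 𝓢(Config d (m + 1), ℂ)) v *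
        (g (lastVel v) * f (initVel v)) := by
    refine integral_congr_ae ?_
    filter_upwards [coeFn_tensorCLM hg f] with v hv
    rw [hv]
  have e2 : ∫ v, φ v * tensorCLM hg' f v = ∫ v, φ v * (g' (lastVel v) * f (initVel v)) := by
    refine integral_congr_ae ?_
    filter_upwards [coeFn_tensorCLM hg' f] with v hv
    rw [hv]
  have i : ∀ (ψ : 𝓢(Config d (m + 1), ℂ)) {g : EuclideanSpace ℝ (Fin d) → ℂ}
      (hg : MemLp g 2 volume), Integrable fun v => ψ v * (g (lastVel v) * f (initVel v)) := by
    intro ψ g hg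
    refine (integrable_schwartz_mul ψ (tensorCLM hg f)).congr ?_
    filter_upwards [coeFn_tensorCLM hg f] with v hv
    rw [hv]
  rw [e1, e2]
  have key := integral_bilinear_hasLineDerivAt_right_eq_neg_left_of_integrable
    (μ := (volume : Measure (Config d (m + 1)))) (B := ContinuousLinearMap.mul ℝ ℂ)
    (f := (φ : Config d (m + 1) → ℂ))
    (f' := ((∂_{liftLast (m := m) u} φ : 𝓢(Config d (m + 1), ℂ)) : Config d (m + 1) → ℂ))
    (g := fun v => g (lastVel v) * f (initVel v)) (g' := fun v => g' (lastVel v) * f (initVel v))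
    (v := liftLast (m := m) u) (i _ hg) (i _ hg') (i _ hg)
    (fun v _ => by
      rw [SchwartzMap.lineDerivOp_apply_eq_fderiv]
      exact (φ.differentiableAt).hasFDerivAt.hasLineDerivAt _)
    (fun v _ => by
      have h1 : HasDerivAt (fun t : ℝ => g (lastVel v + t • u)) (g' (lastVel v)) 0 :=
        hd (lastVel v)
      have h2 := h1.mul_const (f (initVel v))
      unfold HasLineDerivAt
      simpa using h2)
  simp only [ContinuousLinearMap.mul_apply'] at key
  rw [key, neg_neg]

/-- A function with an `L²` derivative in direction `n` is in the range of the resolvent in that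
direction. -/
theorem IsWeakDeriv.eq_fmul_resolventSymbol {E : Type*} [NormedAddCommGroup E]
    [InnerProductSpace ℝ E] [FiniteDimensional ℝ E] [MeasurableSpace E] [BorelSpace E] {n : E}
    {f f' : Lp ℂ 2 (volume : Measure E)} (hf : IsWeakDeriv n f f') :
    f = RenormalizedHierarchy.fmul (resolventSymbol n)
      (f + ((1 / (2 * Real.pi) : ℝ) : ℂ) • f') := by
  refine fourier_injective_L2 ?_
  rw [fourier_fmul, FourierTransform.fourier_add, FourierTransform.fourier_smul]
  refine (mulOp_eq_of_ae ?_).symm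
  filter_upwards [(isWeakDeriv_iff_fourier _ _ _).1 hf,
    Lp.coeFn_add (𝓕 f : Lp ℂ 2 (volume : Measure E))
      (((1 / (2 * Real.pi) : ℝ) : ℂ) • (𝓕 f' : Lp ℂ 2 (volume : Measure E))),
    Lp.coeFn_smul (((1 / (2 * Real.pi) : ℝ) : ℂ)) (𝓕 f' : Lp ℂ 2 (volume : Measure E))]
    with ξ h1 h2 h3
  have h4 : (1 + Complex.I * ((inner ℝ ξ n : ℝ) : ℂ)) ≠ 0 := fun h0 => by
    have := one_le_norm_one_add_I_mul (inner ℝ ξ n)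
    rw [h0, norm_zero] at this
    norm_num at this
  have h5 : (Real.pi : ℂ) ≠ 0 := by exact_mod_cast Real.pi_ne_zero
  rw [h2, Pi.add_apply, h3, Pi.smul_apply, h1, resolventSymbol_apply, smul_eq_mul]
  push_cast
  field_simp

end Tensor

/-! ### Regularity of √M in the last velocity. -/

section Maxwellian

variable {d m : ℕ} {β : ℝ}

/-- `√M` as a complex function. -/
def sqrtMaxwellian (β : ℝ) (v : EuclideanSpace ℝ (Fin d)) : ℂ :=
  ((Real.sqrt (maxwellian β v) : ℝ) : ℂ)

/-- The derivative of `√M` in direction `u`. -/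
def sqrtMaxwellianDeriv (β : ℝ) (u v : EuclideanSpace ℝ (Fin d)) : ℂ :=
  ((-(β / 2) * inner ℝ v u : ℝ) : ℂ) * sqrtMaxwellian β v

theorem sqrt_maxwellian_eq (hβ : 0 < β) (v : EuclideanSpace ℝ (Fin d)) :
    Real.sqrt (maxwellian β v)
      = Real.sqrt ((β / (2 * Real.pi)) ^ ((d : ℝ) / 2)) * Real.exp (-(β / 4) * ‖v‖ ^ 2) := by
  have h : Real.exp (-(β / 2) * ‖v‖ ^ 2) = Real.exp (-(β / 4) * ‖v‖ ^ 2) ^ 2 := by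
    rw [← Real.exp_nat_mul]
    congr 1
    push_cast
    ring
  rw [maxwellian, h, Real.sqrt_mul (by positivity), Real.sqrt_sq (Real.exp_nonneg _)]

theorem hasLineDerivAt_sqrtMaxwellian (hβ : 0 < β) (u v : EuclideanSpace ℝ (Fin d)) :
    HasLineDerivAt ℝ (sqrtMaxwellian β) (sqrtMaxwellianDeriv β u v) v u := by
  have h1 : HasFDerivAt (fun v : EuclideanSpace ℝ (Fin d) => ‖v‖ ^ 2) (2 • innerSL ℝ v) v :=
    (hasStrictFDerivAt_norm_sq v).hasFDerivAt
  have h2 := ((h1.const_mul (-(β / 4))).exp.const_mul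
    (Real.sqrt ((β / (2 * Real.pi)) ^ ((d : ℝ) / 2)))).hasLineDerivAt u
  have h4 : HasDerivAt (fun t : ℝ => Real.sqrt (maxwellian β (v + t • u)))
      (-(β / 2) * inner ℝ v u * Real.sqrt (maxwellian β v)) 0 := by
    simp only [sqrt_maxwellian_eq hβ]
    refine HasDerivAt.congr_deriv h2 ?_
    simp
    ring
  refine HasDerivAt.congr_deriv h4.ofReal_comp ?_
  simp [sqrtMaxwellianDeriv, sqrtMaxwellian]

/-- Comparison with the Maxwellian of parameter β/2: the factor |v| is absorbed by exp(β|v|²/8). -/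
theorem memLp_norm_mul_sqrtMaxwellian (hβ : 0 < β) :
    MemLp (fun v : EuclideanSpace ℝ (Fin d) => ((‖v‖ : ℝ) : ℂ) * sqrtMaxwellian β v) 2 volume := by
  have h1 := memLp_sqrt_maxwellian (d := d) (half_pos hβ)
  have hc : Continuous (fun v : EuclideanSpace ℝ (Fin d) => sqrtMaxwellian β v) := by
    unfold sqrtMaxwellian maxwellian
    exact Complex.continuous_ofReal.comp (Real.continuous_sqrt.comp (by fun_prop))
  set a := Real.sqrt ((β / (2 * Real.pi)) ^ ((d : ℝ) / 2))
  set b := Real.sqrt ((β / 2 / (2 * Real.pi)) ^ ((d : ℝ) / 2))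
  have hb0 : 0 < b := Real.sqrt_pos.2 (by positivity)
  refine h1.of_le_mul (c := a / b * (1 + 8 / β))
    ((Complex.continuous_ofReal.comp continuous_norm).mul hc).aestronglyMeasurable
    (Eventually.of_forall fun v => ?_)
  rw [norm_mul, Complex.norm_real, Complex.norm_real, norm_norm, sqrtMaxwellian,
    Complex.norm_real, Real.norm_eq_abs, Real.norm_eq_abs, abs_of_nonneg (Real.sqrt_nonneg _),
    abs_of_nonneg (Real.sqrt_nonneg _), sqrt_maxwellian_eq hβ, sqrt_maxwellian_eq (half_pos hβ)]
  have h2 : ‖v‖ ≤ (1 + 8 / β) * Real.exp (β / 8 * ‖v‖ ^ 2) := by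
    have h3 := Real.add_one_le_exp (β / 8 * ‖v‖ ^ 2)
    have h4 : ‖v‖ ≤ 1 + ‖v‖ ^ 2 := by nlinarith [sq_nonneg (‖v‖ - 1)]
    have h5 : 1 + ‖v‖ ^ 2 ≤ (1 + 8 / β) * (β / 8 * ‖v‖ ^ 2 + 1) := by
      have : (1 + 8 / β) * (β / 8 * ‖v‖ ^ 2 + 1)
          = 1 + ‖v‖ ^ 2 + (β / 8 * ‖v‖ ^ 2 + 8 / β) := by field_simp; ring
      rw [this]
      have : 0 ≤ β / 8 * ‖v‖ ^ 2 + 8 / β := by positivity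
      linarith
    exact h4.trans (h5.trans (by gcongr))
  have h6 : Real.exp (-(β / 4) * ‖v‖ ^ 2)
      = Real.exp (-(β / 2 / 4) * ‖v‖ ^ 2) * (Real.exp (β / 8 * ‖v‖ ^ 2))⁻¹ := by
    rw [← Real.exp_neg, ← Real.exp_add]
    congr 1
    ring
  rw [h6]
  have ha0 : 0 ≤ a := Real.sqrt_nonneg _
  change ‖v‖ * (a * _) ≤ a / b * (1 + 8 / β) * (b * _)
  clear_value a b
  have h7 : ‖v‖ * (Real.exp (β / 8 * ‖v‖ ^ 2))⁻¹ ≤ 1 + 8 / β := by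
    rw [← div_eq_mul_inv, div_le_iff₀ (Real.exp_pos _)]
    exact h2
  calc _ = a * Real.exp (-(β / 2 / 4) * ‖v‖ ^ 2) *
        (‖v‖ * (Real.exp (β / 8 * ‖v‖ ^ 2))⁻¹) := by ring
    _ ≤ a * Real.exp (-(β / 2 / 4) * ‖v‖ ^ 2) * (1 + 8 / β) := by gcongr
    _ = _ := by field_simp

theorem norm_sqrtMaxwellianDeriv_le (hβ : 0 < β) (u v : EuclideanSpace ℝ (Fin d)) :
    ‖sqrtMaxwellianDeriv β u v‖ ≤ β / 2 * ‖u‖ * ‖((‖v‖ : ℝ) : ℂ) * sqrtMaxwellian β v‖ := by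
  rw [sqrtMaxwellianDeriv, norm_mul, norm_mul, Complex.norm_real, Complex.norm_real, norm_norm,
    Real.norm_eq_abs, abs_mul, abs_neg, abs_of_pos (half_pos hβ)]
  calc β / 2 * |inner ℝ v u| * ‖sqrtMaxwellian β v‖
      ≤ β / 2 * (‖v‖ * ‖u‖) * ‖sqrtMaxwellian β v‖ := by
        gcongr; exact abs_real_inner_le_norm v u
    _ = _ := by ring

theorem memLp_sqrtMaxwellianDeriv (hβ : 0 < β) (u : EuclideanSpace ℝ (Fin d)) :
    MemLp (sqrtMaxwellianDeriv β u) 2 volume := by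
  refine (memLp_norm_mul_sqrtMaxwellian hβ).of_le_mul ?_
    (Eventually.of_forall (norm_sqrtMaxwellianDeriv_le hβ u))
  have hc : Continuous (fun v : EuclideanSpace ℝ (Fin d) => sqrtMaxwellian β v) := by
    unfold sqrtMaxwellian maxwellian
    exact Complex.continuous_ofReal.comp (Real.continuous_sqrt.comp (by fun_prop))
  exact (Continuous.mul (by fun_prop) hc).aestronglyMeasurable

/-- The constant in the regularity of `√M(v_{m+1}) f` in direction `v_{m+1}`. -/
def maxwellianConst (d : ℕ) {β : ℝ} (hβ : 0 < β) : ℝ :=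
  1 + ‖(memLp_sqrt_maxwellian (d := d) hβ).toLp _‖
    + β / 2 * ‖(memLp_norm_mul_sqrtMaxwellian (d := d) hβ).toLp _‖

theorem maxwellianConst_pos (d : ℕ) (hβ : 0 < β) : 0 < maxwellianConst d hβ := by
  unfold maxwellianConst; positivity

/-- `tensorSqrtMaxwellian` as a bounded linear map. -/
def maxwellianCLM (hβ : 0 < β) : L2 d m →L[ℂ] L2 d (m + 1) :=
  tensorCLM (memLp_sqrt_maxwellian hβ)

theorem trans_maxwellianCLM (hβ : 0 < β) (f : L2 d m) (x : Config d m) :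
    trans (extendVel x) (maxwellianCLM hβ f) = maxwellianCLM hβ (trans x f) :=
  trans_tensorCLM _ f x

/-- Supplies the hypothesis of the directional estimates. The bound on F is uniform over unit
vectors u and does not involve derivatives of f. -/
theorem exists_maxwellianCLM_eq (hβ : 0 < β) {u : EuclideanSpace ℝ (Fin d)} (hu : ‖u‖ = 1)
    (f : L2 d m) :
    ∃ F, maxwellianCLM hβ f = fmul (resolventSymbol (liftLast u)) F ∧
      ‖F‖ ≤ maxwellianConst d hβ * ‖f‖ := by
  refine ⟨_, (isWeakDeriv_tensorCLM (memLp_sqrt_maxwellian hβ) (memLp_sqrtMaxwellianDeriv hβ u)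
    (hasLineDerivAt_sqrtMaxwellian hβ u) f).eq_fmul_resolventSymbol, ?_⟩
  refine (norm_add_le _ _).trans ?_
  rw [norm_smul, norm_tensorCLM, norm_tensorCLM, Complex.norm_real, Real.norm_eq_abs,
    abs_of_pos (by positivity)]
  have h1 : ‖(memLp_sqrtMaxwellianDeriv hβ u).toLp _‖
      ≤ β / 2 * ‖(memLp_norm_mul_sqrtMaxwellian (d := d) hβ).toLp _‖ := by
    refine Lp.norm_le_mul_norm_of_ae_le_mul ?_
    filter_upwards [(memLp_sqrtMaxwellianDeriv hβ u).coeFn_toLp,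
      (memLp_norm_mul_sqrtMaxwellian (d := d) hβ).coeFn_toLp] with v a b
    rw [a, b]
    simpa [hu] using norm_sqrtMaxwellianDeriv_le hβ u v
  have h2 : 1 / (2 * Real.pi) ≤ 1 := by
    rw [div_le_one (by positivity)]
    linarith [Real.pi_gt_three]
  have h3 := mul_le_mul h2 (mul_le_mul_of_nonneg_right h1 (norm_nonneg f)) (by positivity)
    (by norm_num)
  unfold maxwellianConst
  linarith [norm_nonneg f]

end Maxwellian

/-! ### Decay of the Fourier transform of the potential. -/

section Potential

variable {d : ℕ} {V : EuclideanSpace ℝ (Fin d) → ℝ}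

theorem exists_schwartz_potentialHat (hV : ContDiff ℝ ∞ V) (hc : HasCompactSupport V) :
    ∃ ψ : 𝓢(EuclideanSpace ℝ (Fin d), ℂ),
      ∀ q, potentialHat V q = ψ ((2 * Real.pi)⁻¹ • q) := by
  have hg₁ : HasCompactSupport (Complex.ofRealCLM ∘ V) := hc.comp_left rfl
  have hg₂ : ContDiff ℝ ∞ (Complex.ofRealCLM ∘ V) := by fun_prop
  refine ⟨𝓕 (hg₁.toSchwartzMap hg₂), fun q => ?_⟩
  rw [SchwartzMap.fourier_coe, Real.fourier_eq]
  unfold potentialHat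
  refine integral_congr_ae (Eventually.of_forall fun x => ?_)
  have h1 : (Real.fourierChar (-inner ℝ x ((2 * Real.pi)⁻¹ • q)) : ℂ)
      = Complex.exp (-(Complex.I * ((inner ℝ q x : ℝ) : ℂ))) := by
    rw [Real.fourierChar_apply, real_inner_smul_right, real_inner_comm]
    congr 1
    push_cast
    have : (Real.pi : ℂ) ≠ 0 := by exact_mod_cast Real.pi_ne_zero
    field_simp
  change _ = Real.fourierChar (-inner ℝ x ((2 * Real.pi)⁻¹ • q)) •
    (hg₁.toSchwartzMap hg₂) x
  rw [Circle.smul_def, h1]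
  rfl

theorem continuous_potentialHat (hV : ContDiff ℝ ∞ V) (hc : HasCompactSupport V) :
    Continuous (potentialHat V) := by
  obtain ⟨ψ, hψ⟩ := exists_schwartz_potentialHat hV hc
  rw [funext hψ]
  exact ψ.continuous.comp (continuous_const_smul _)

/-- The weighted moments of `|V̂|²`. -/
def potentialMoment (V : EuclideanSpace ℝ (Fin d) → ℝ) (n : ℕ) : ℝ :=
  ∫ q, ‖q‖ * ‖potentialHat V q‖ ^ 2 * (2 * (1 + ‖q‖)) ^ n

theorem potentialMoment_zero : potentialMoment V 0 = potentialConst V := by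
  simp [potentialMoment, potentialConst]

theorem potentialMoment_nonneg (n : ℕ) : 0 ≤ potentialMoment V n :=
  integral_nonneg fun q => by positivity

theorem integrable_potentialMoment (hV : ContDiff ℝ ∞ V) (hc : HasCompactSupport V) (n : ℕ) :
    Integrable fun q => ‖q‖ * ‖potentialHat V q‖ ^ 2 * (2 * (1 + ‖q‖)) ^ n := by
  obtain ⟨ψ, hψ⟩ := exists_schwartz_potentialHat hV hc
  obtain ⟨C, hC⟩ : ∃ C, ∀ q, ‖potentialHat V q‖ ≤ C := by
    obtain ⟨C, hC⟩ := ψ.decay 0 0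
    refine ⟨C, fun q => ?_⟩
    rw [hψ]
    simpa using hC.2 ((2 * Real.pi)⁻¹ • q)
  have h2 : (2 * Real.pi)⁻¹ ≠ 0 := by positivity
  have hi : ∀ j : ℕ, Integrable fun q : EuclideanSpace ℝ (Fin d) =>
      ‖q‖ ^ j * ‖potentialHat V q‖ := fun j => by
    have h1 := ((ψ.integrable_pow_mul volume j).comp_smul h2).const_mul ((2 * Real.pi) ^ j)
    refine h1.congr (Eventually.of_forall fun q => ?_)
    have h3 : ‖q‖ = 2 * Real.pi * ‖(2 * Real.pi)⁻¹ • q‖ := by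
      rw [norm_smul, Real.norm_of_nonneg (by positivity), mul_inv_cancel_left₀ (by positivity)]
    simp only [hψ]
    conv_rhs => rw [h3, mul_pow, mul_assoc]
  have hdom := (((hi 1).add (hi (n + 1))).const_mul (C * 4 ^ n))
  refine hdom.mono' ?_ (Eventually.of_forall fun q => ?_)
  · have := continuous_potentialHat hV hc
    exact Continuous.aestronglyMeasurable (by fun_prop)
  · rw [Real.norm_eq_abs, abs_of_nonneg (by positivity)]
    have h3 : (1 + ‖q‖) ^ n ≤ 2 ^ n * (1 + ‖q‖ ^ n) := by
      rcases le_total ‖q‖ 1 with h | h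
      · calc (1 + ‖q‖) ^ n ≤ (2 : ℝ) ^ n := by gcongr; linarith
          _ ≤ 2 ^ n * (1 + ‖q‖ ^ n) := le_mul_of_one_le_right (by positivity)
            (le_add_of_nonneg_right (by positivity))
      · calc (1 + ‖q‖) ^ n ≤ (2 * ‖q‖) ^ n := by gcongr; linarith
          _ = 2 ^ n * ‖q‖ ^ n := mul_pow _ _ _
          _ ≤ 2 ^ n * (1 + ‖q‖ ^ n) := by gcongr; linarith
    have h4 : ‖potentialHat V q‖ ^ 2 ≤ C * ‖potentialHat V q‖ := by
      rw [sq]; gcongr; exact hC q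
    calc ‖q‖ * ‖potentialHat V q‖ ^ 2 * (2 * (1 + ‖q‖)) ^ n
        ≤ ‖q‖ * (C * ‖potentialHat V q‖) * (2 ^ n * (2 ^ n * (1 + ‖q‖ ^ n))) := by
          rw [mul_pow]
          have : 0 ≤ C * ‖potentialHat V q‖ := (by positivity : (0 : ℝ) ≤ _).trans h4
          gcongr
      _ = C * 4 ^ n * (‖q‖ ^ 1 * ‖potentialHat V q‖ + ‖q‖ ^ (n + 1) * ‖potentialHat V q‖) := by
          rw [show (4 : ℝ) = 2 * 2 by norm_num, mul_pow]
          ring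

end Potential

/-! ### The collision form and its representing operator. -/

section HatForm

variable {d m : ℕ} {β : ℝ}

/-- The contraction `q · w_j`. -/
def contract (j : Fin (m + 1)) (q : EuclideanSpace ℝ (Fin d))
    (w : Fin (m + 1) × Fin d → L2 d m) : L2 d m :=
  ∑ i, ((q i : ℝ) : ℂ) • w (j, i)

theorem contract_add (j : Fin (m + 1)) (q : EuclideanSpace ℝ (Fin d))
    (w w' : Fin (m + 1) × Fin d → L2 d m) :
    contract j q (w + w') = contract j q w + contract j q w' := by
  simp [contract, smul_add, Finset.sum_add_distrib]

theorem contract_smul (j : Fin (m + 1)) (q : EuclideanSpace ℝ (Fin d)) (c : ℂ)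
    (w : Fin (m + 1) × Fin d → L2 d m) : contract j q (c • w) = c • contract j q w := by
  simp only [contract, Pi.smul_apply, Finset.smul_sum, smul_comm c]

theorem contract_zero_left (j : Fin (m + 1)) (w : Fin (m + 1) × Fin d → L2 d m) :
    contract j 0 w = 0 := by
  simp [contract]

theorem trans_contract (x : Config d m) (j : Fin (m + 1)) (q : EuclideanSpace ℝ (Fin d))
    (w : Fin (m + 1) × Fin d → L2 d m) :
    trans x (contract j q w) = contract j q fun e => trans x (w e) := by
  simp only [contract, map_sum, map_smul]

/-- The norm of the block `j` of a vector field. -/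
def blockNorm (j : Fin (m + 1)) (w : Fin (m + 1) × Fin d → L2 d m) : ℝ :=
  Real.sqrt (∑ i, ‖w (j, i)‖ ^ 2)

theorem norm_contract_le (j : Fin (m + 1)) (q : EuclideanSpace ℝ (Fin d))
    (w : Fin (m + 1) × Fin d → L2 d m) : ‖contract j q w‖ ≤ ‖q‖ * blockNorm j w := by
  refine (norm_sum_le _ _).trans ?_
  simp only [norm_smul, Complex.norm_real]
  rw [EuclideanSpace.norm_eq, blockNorm]
  exact Real.sum_mul_le_sqrt_mul_sqrt _ _ _

/-- Cauchy–Schwarz over the particles; it avoids a factor m + 1, so the smallness condition is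
independent of the level. -/
theorem sum_blockNorm_le (a w : Grad (Fin (m + 1) × Fin d)) :
    ∑ j, blockNorm j a.ofLp * blockNorm j w.ofLp ≤ ‖a‖ * ‖w‖ := by
  refine (Real.sum_mul_le_sqrt_mul_sqrt _ _ _).trans_eq ?_
  have h : ∀ a : Grad (Fin (m + 1) × Fin d), Real.sqrt (∑ j, blockNorm j a.ofLp ^ 2) = ‖a‖ := by
    intro a
    rw [← Real.sqrt_sq (norm_nonneg a), PiLp.norm_sq_eq_of_L2, Fintype.sum_prod_type]
    congr 1
    exact Finset.sum_congr rfl fun j _ => Real.sq_sqrt (by positivity)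
  rw [h, h]

/-- The collision integrand for a family `G` of operators on `L²((ℝ^d)^{m+2})`. -/
def formIntegrand (hβ : 0 < β) (V : EuclideanSpace ℝ (Fin d) → ℝ)
    (G : Fin (m + 1) → EuclideanSpace ℝ (Fin d) → (L2 d (m + 1) →L[ℂ] L2 d (m + 1)))
    (a w : Fin (m + 1) × Fin d → L2 d m) (j : Fin (m + 1)) (q : EuclideanSpace ℝ (Fin d)) : ℂ :=
  ((‖potentialHat V q‖ ^ 2 : ℝ) : ℂ) *
    inner ℂ (maxwellianCLM hβ (contract j q a)) (G j q (maxwellianCLM hβ (contract j q w)))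

/-- The collision form for a family `G` of operators on `L²((ℝ^d)^{m+2})`. -/
def collisionForm (hβ : 0 < β) (V : EuclideanSpace ℝ (Fin d) → ℝ)
    (G : Fin (m + 1) → EuclideanSpace ℝ (Fin d) → (L2 d (m + 1) →L[ℂ] L2 d (m + 1)))
    (a w : Fin (m + 1) × Fin d → L2 d m) : ℂ :=
  ∑ j, ∫ q, formIntegrand hβ V G a w j q

/-- The combinatorial factor m + 1 cancels the two factors (m+1)^(-1/2), and V̂ times its conjugate
is |V̂|². -/
theorem hatForm_eq (P : Params d)
    (W : Config d (m + 1) → (L2 d (m + 1) →L[ℂ] L2 d (m + 1))) (k : Config d m)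
    (a w : Fin (m + 1) × Fin d → L2 d m) :
    hatForm P W k a w = ((((2 * Real.pi) ^ d)⁻¹ : ℝ) : ℂ) *
      collisionForm P.β_pos P.V (fun j q => W (transferMomentum k j q)) a w := by
  rw [hatForm, collisionForm, Finset.mul_sum]
  refine Finset.sum_congr rfl fun j _ => ?_
  rw [mul_comm ((m : ℂ) + 1), mul_assoc, ← integral_const_mul]
  congr 1
  refine integral_congr_ae (Eventually.of_forall fun q => ?_)
  have hm : ((m : ℂ) + 1) ≠ 0 := by exact_mod_cast Nat.succ_ne_zero m
  have hs : ((Real.sqrt (m + 1) : ℝ) : ℂ) * ((Real.sqrt (m + 1) : ℝ) : ℂ) = (m : ℂ) + 1 := by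
    rw [← Complex.ofReal_mul, Real.mul_self_sqrt (by positivity)]
    push_cast
    rfl
  have hs0 : ((Real.sqrt (m + 1) : ℝ) : ℂ) ≠ 0 := fun h0 => hm (by rw [← hs, h0, mul_zero])
  have hV : conj (potentialHat P.V q) * potentialHat P.V q
      = ((‖potentialHat P.V q‖ ^ 2 : ℝ) : ℂ) := by
    rw [mul_comm, Complex.mul_conj, Complex.normSq_eq_norm_sq]
  simp only [collisionMinus, formIntegrand, map_smul, inner_smul_left, inner_smul_right, map_mul,
    map_neg, Complex.conj_conj, Complex.conj_ofReal]
  rw [← hV]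
  change _ = conj (potentialHat P.V q) * potentialHat P.V q *
    inner ℂ (tensorSqrtMaxwellian P.β_pos (contract j q a)) _
  push_cast
  rw [← hs]
  field_simp
  rfl

variable {hβ : 0 < β} {V : EuclideanSpace ℝ (Fin d) → ℝ}
  {G : Fin (m + 1) → EuclideanSpace ℝ (Fin d) → (L2 d (m + 1) →L[ℂ] L2 d (m + 1))}
  {a w a' w' : Fin (m + 1) × Fin d → L2 d m}

theorem measurable_inner_contract {Ω : Type*} [MeasurableSpace Ω] (hβ : 0 < β)
    {q : Ω → EuclideanSpace ℝ (Fin d)} (hq : Measurable q)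
    {G : Ω → (L2 d (m + 1) →L[ℂ] L2 d (m + 1))}
    (hG : ∀ f g, Measurable fun t => inner ℂ f (G t g)) (a w : Fin (m + 1) × Fin d → L2 d m)
    (j : Fin (m + 1)) :
    Measurable fun t => inner ℂ (maxwellianCLM hβ (contract j (q t) a))
      (G t (maxwellianCLM hβ (contract j (q t) w))) := by
  simp only [contract, map_sum, map_smul, sum_inner, inner_sum, inner_smul_left, inner_smul_right,
    Complex.conj_ofReal]
  have hqe : ∀ e, Measurable fun t => ((q t e : ℝ) : ℂ) := fun e =>
    Complex.measurable_ofReal.comp ((EuclideanSpace.proj e).continuous.measurable.comp hq)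
  exact Finset.measurable_sum _ fun i _ => (hqe i).mul
    (Finset.measurable_sum _ fun i' _ => (hqe i').mul (hG _ _))

/-- Weak measurability and bounds for a family of operators in the collision form. -/
structure Admissible (hβ : 0 < β)
    (G : Fin (m + 1) → EuclideanSpace ℝ (Fin d) → (L2 d (m + 1) →L[ℂ] L2 d (m + 1)))
    (c : ℝ) (n : ℕ) : Prop where
  meas : ∀ j f g, Measurable fun q => inner ℂ f (G j q g)
  bound : ∀ j q, q ≠ 0 → ∀ φ f : L2 d m,
    ‖inner ℂ (maxwellianCLM hβ φ) (G j q (maxwellianCLM hβ f))‖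
      ≤ c * (2 * (1 + ‖q‖)) ^ n / ‖q‖ * ‖φ‖ * ‖f‖

/-- Each contraction yields |q| and the operator costs 1/|q|, leaving the weight |q||V̂|² of C_0^V.
At q = 0, where the operator bound is not assumed, the integrand vanishes. -/
theorem Admissible.norm_formIntegrand_le {c : ℝ} {n : ℕ} (hc : 0 ≤ c)
    (hG : Admissible hβ G c n) (j : Fin (m + 1)) (q : EuclideanSpace ℝ (Fin d)) :
    ‖formIntegrand hβ V G a w j q‖
      ≤ c * (blockNorm j a * blockNorm j w) *
        (‖q‖ * ‖potentialHat V q‖ ^ 2 * (2 * (1 + ‖q‖)) ^ n) := by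
  have ha : 0 ≤ blockNorm j a := Real.sqrt_nonneg _
  have hw : 0 ≤ blockNorm j w := Real.sqrt_nonneg _
  rcases eq_or_ne q 0 with rfl | hq
  · simp [formIntegrand, contract_zero_left]
  · have hq0 : 0 < ‖q‖ := norm_pos_iff.2 hq
    rw [formIntegrand, norm_mul, Complex.norm_real, Real.norm_eq_abs, abs_of_nonneg (by positivity)]
    calc _ ≤ ‖potentialHat V q‖ ^ 2 * (c * (2 * (1 + ‖q‖)) ^ n / ‖q‖ *
          (‖q‖ * blockNorm j a) * (‖q‖ * blockNorm j w)) := by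
          gcongr
          refine (hG.bound j q hq _ _).trans ?_
          gcongr
          · exact norm_contract_le j q a
          · exact norm_contract_le j q w
      _ = _ := by field_simp

theorem measurable_formIntegrand (hV : ContDiff ℝ ∞ V) (hVc : HasCompactSupport V)
    (hG : ∀ j f g, Measurable fun q => inner ℂ f (G j q g))
    (j : Fin (m + 1)) : Measurable (formIntegrand hβ V G a w j) := by
  have h1 := (continuous_potentialHat hV hVc).measurable
  exact (Complex.measurable_ofReal.comp (h1.norm.pow_const 2)).mul
    (measurable_inner_contract hβ measurable_id (hG j) a w j)

theorem Admissible.integrable (hV : ContDiff ℝ ∞ V) (hVc : HasCompactSupport V)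
    {c : ℝ} {n : ℕ} (hc : 0 ≤ c) (hG : Admissible hβ G c n)
    (j : Fin (m + 1)) : Integrable (formIntegrand hβ V G a w j) :=
  ((integrable_potentialMoment hV hVc n).const_mul _).mono'
    (measurable_formIntegrand hV hVc hG.meas j).aestronglyMeasurable
    (Eventually.of_forall fun q => hG.norm_formIntegrand_le hc j q)

theorem Admissible.norm_collisionForm_le (hV : ContDiff ℝ ∞ V) (hVc : HasCompactSupport V)
    {c : ℝ} {n : ℕ} (hc : 0 ≤ c)
    (hG : Admissible hβ G c n) (a w : Grad (Fin (m + 1) × Fin d)) :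
    ‖collisionForm hβ V G a.ofLp w.ofLp‖ ≤ c * potentialMoment V n * ‖a‖ * ‖w‖ := by
  have h1 : ∀ j, ‖∫ q, formIntegrand hβ V G a.ofLp w.ofLp j q‖
      ≤ c * potentialMoment V n * (blockNorm j a.ofLp * blockNorm j w.ofLp) := fun j => by
    refine (norm_integral_le_of_norm_le ((integrable_potentialMoment hV hVc n).const_mul _)
      (Eventually.of_forall fun q => hG.norm_formIntegrand_le hc j q)).trans_eq ?_
    rw [integral_const_mul, potentialMoment]
    ring
  refine (norm_sum_le _ _).trans ((Finset.sum_le_sum fun j _ => h1 j).trans ?_)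
  rw [← Finset.mul_sum, mul_assoc _ ‖a‖]
  exact mul_le_mul_of_nonneg_left (sum_blockNorm_le a w)
    (mul_nonneg hc (potentialMoment_nonneg n))

theorem Admissible.exists_operator (hV : ContDiff ℝ ∞ V) (hVc : HasCompactSupport V)
    {c : ℝ} {n : ℕ} (hc : 0 ≤ c) (hG : Admissible hβ G c n) :
    ∃ B : Grad (Fin (m + 1) × Fin d) →L[ℂ] Grad (Fin (m + 1) × Fin d),
      ∀ a w, inner ℂ a (B w) = collisionForm hβ V G a.ofLp w.ofLp := by
  let S : Grad (Fin (m + 1) × Fin d) →ₗ⋆[ℂ] Grad (Fin (m + 1) × Fin d) →ₗ[ℂ] ℂ :=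
    LinearMap.mk₂'ₛₗ (starRingEnd ℂ) (RingHom.id ℂ)
      (fun a w => collisionForm hβ V G a.ofLp w.ofLp)
      (fun a a' w => by
        simp only [collisionForm]
        rw [← Finset.sum_add_distrib]
        refine Finset.sum_congr rfl fun j _ => ?_
        rw [← integral_add (Admissible.integrable hV hVc hc hG j) (Admissible.integrable hV hVc hc hG j)]
        refine integral_congr_ae (Eventually.of_forall fun q => ?_)
        simp only [formIntegrand, WithLp.ofLp_add, contract_add, map_add, inner_add_left, mul_add])
      (fun c a w => by
        simp only [collisionForm]
        rw [smul_eq_mul, Finset.mul_sum]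
        refine Finset.sum_congr rfl fun j _ => ?_
        rw [← integral_const_mul]
        refine integral_congr_ae (Eventually.of_forall fun q => ?_)
        simp only [formIntegrand, WithLp.ofLp_smul, contract_smul, map_smul, inner_smul_left]
        ring)
      (fun a w w' => by
        simp only [collisionForm]
        rw [← Finset.sum_add_distrib]
        refine Finset.sum_congr rfl fun j _ => ?_
        rw [← integral_add (Admissible.integrable hV hVc hc hG j) (Admissible.integrable hV hVc hc hG j)]
        refine integral_congr_ae (Eventually.of_forall fun q => ?_)
        simp only [formIntegrand, WithLp.ofLp_add, contract_add, map_add, inner_add_right, mul_add])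
      (fun c a w => by
        simp only [collisionForm]
        rw [smul_eq_mul, Finset.mul_sum]
        refine Finset.sum_congr rfl fun j _ => ?_
        rw [← integral_const_mul]
        refine integral_congr_ae (Eventually.of_forall fun q => ?_)
        simp only [formIntegrand, WithLp.ofLp_smul, contract_smul, map_smul, inner_smul_right,
          RingHom.id_apply]
        ring)
  let S' := S.mkContinuous₂ (c * potentialMoment V n)
    fun a w => Admissible.norm_collisionForm_le hV hVc hc hG a w
  -- The Riesz representation puts the operator in the first slot of the inner product; the adjoint
  -- moves it to the second.
  refine ⟨ContinuousLinearMap.adjoint (InnerProductSpace.continuousLinearMapOfBilin S'),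
    fun a w => ?_⟩
  rw [ContinuousLinearMap.adjoint_inner_right, InnerProductSpace.continuousLinearMapOfBilin_apply]
  rfl

theorem Admissible.opNorm_le (hV : ContDiff ℝ ∞ V) (hVc : HasCompactSupport V)
    {c r : ℝ} {n : ℕ} (hc : 0 ≤ c) (hr : 0 ≤ r) (hG : Admissible hβ G c n)
    {B : Grad (Fin (m + 1) × Fin d) →L[ℂ] Grad (Fin (m + 1) × Fin d)}
    (hB : ∀ a w, inner ℂ a (B w) = (r : ℂ) * collisionForm hβ V G a.ofLp w.ofLp) :
    ‖B‖ ≤ r * (c * potentialMoment V n) := by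
  have h0 := potentialMoment_nonneg (V := V) n
  refine ContinuousLinearMap.opNorm_le_of_re_inner_le (𝕜 := ℂ) (by positivity) fun x y hx hy => ?_
  refine (Complex.re_le_norm _).trans ?_
  rw [norm_inner_symm, hB, norm_mul, Complex.norm_real, Real.norm_of_nonneg hr]
  have h1 := Admissible.norm_collisionForm_le hV hVc hc hG y x
  rw [hx, hy, mul_one, mul_one] at h1
  gcongr

/-- Differences pass under the integral over q. Integrability is proved in the same induction
because subtracting integrals requires it. -/
theorem fdiff_collisionForm {X : Type*} [AddCommGroup X]
    {G : X → Fin (m + 1) → EuclideanSpace ℝ (Fin d) → (L2 d (m + 1) →L[ℂ] L2 d (m + 1))}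
    (hG : ∀ x j, Integrable (formIntegrand hβ V (G x) a w j)) (A : List X) (x : X) :
    (∀ j, Integrable (formIntegrand hβ V
      (fun j q => fdiff A (fun x => G x j q) x) a w j)) ∧
    fdiff A (fun x => collisionForm hβ V (G x) a w) x
      = collisionForm hβ V (fun j q => fdiff A (fun x => G x j q) x) a w := by
  induction A generalizing x with
  | nil => exact ⟨hG x, rfl⟩
  | cons y A ih =>
    obtain ⟨i1, e1⟩ := ih (x + y)
    obtain ⟨i2, e2⟩ := ih x
    have e : ∀ j q, formIntegrand hβ V (fun j q => fdiff (y :: A) (fun x => G x j q) x) a w j q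
        = formIntegrand hβ V (fun j q => fdiff A (fun x => G x j q) (x + y)) a w j q
          - formIntegrand hβ V (fun j q => fdiff A (fun x => G x j q) x) a w j q := fun j q => by
      simp only [formIntegrand, fdiff, sub_apply, inner_sub_right, mul_sub]
    refine ⟨fun j => ((i1 j).sub (i2 j)).congr (Eventually.of_forall fun q => (e j q).symm), ?_⟩
    simp only [fdiff] at e ⊢
    rw [e1, e2]
    simp only [collisionForm]
    rw [← Finset.sum_sub_distrib]
    refine Finset.sum_congr rfl fun j _ => ?_
    rw [← integral_sub (i1 j) (i2 j)]
    exact integral_congr_ae (Eventually.of_forall fun q => (e j q).symm)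

end HatForm

/-! ### Identification with the abstract equation. -/

section Resolvent

variable {d m : ℕ}

/-- The scalar `(1 + iα)/t_N`. -/
def resolventShift (P : Params d) : ℂ := (1 + Complex.I * ((P.α : ℝ) : ℂ)) / ((P.tN : ℝ) : ℂ)

theorem re_resolventShift_pos {P : Params d} (h : 0 < P.tN) : 0 < (resolventShift P).re := by
  rw [resolventShift, Complex.div_ofReal_re]
  simpa using h

theorem integral_conj_mul_inner_mul (k : Config d m) (φ : 𝓢(Config d m, ℂ)) (h : L2 d m) :
    ∫ v, conj (φ v) * ((inner ℝ k v : ℝ) : ℂ) * h v = inner ℂ (transportSchwartz k φ) h := by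
  rw [transportSchwartz_apply, L2.inner_def]
  refine integral_congr_ae ?_
  filter_upwards [(SchwartzMap.smulLeftCLM ℂ (fun v : Config d m => ((inner ℝ v k : ℝ) : ℂ))
    φ).coeFn_toLp 2 volume] with v hv
  rw [hv, SchwartzMap.smulLeftCLM_apply_apply (by fun_prop), RCLike.inner_apply, smul_eq_mul,
    map_mul, Complex.conj_ofReal, real_inner_comm]
  ring

theorem isResolventSolution_iff {P : Params d}
    {W : Config d (m + 1) → (L2 d (m + 1) →L[ℂ] L2 d (m + 1))} {k : Config d m}
    {B : Grad (Fin (m + 1) × Fin d) →L[ℂ] Grad (Fin (m + 1) × Fin d)}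
    (hB : ∀ a w, inner ℂ a (B w) = ((1 / P.N : ℝ) : ℂ) * hatForm P W k a.ofLp w.ofLp)
    {f h : L2 d m} :
    IsResolventSolution P W k f h
      ↔ ∃ w, IsSol (resolventShift P) k (P.κ / P.N) B h w f 0 := by
  have key : ∀ (w : Grad (Fin (m + 1) × Fin d)) (φ : 𝓢(Config d m, ℂ)),
      (∑ e, inner ℂ (schwartzGradient φ e) (w.ofLp e)) = inner ℂ (gradSchwartz φ) w := by
    intro w φ
    rw [PiLp.inner_apply]
    rfl
  constructor
  · rintro ⟨w, hw, he⟩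
    refine ⟨WithLp.toLp 2 w, isSol_iff.2 ⟨hw, fun φ => ?_⟩⟩
    rw [← he φ, hB, ← key, integral_conj_mul_inner_mul]
    rfl
  · rintro ⟨w, hs⟩
    obtain ⟨hw, he⟩ := isSol_iff.1 hs
    refine ⟨w.ofLp, hw, fun φ => ?_⟩
    rw [← he φ, hB, ← key, integral_conj_mul_inner_mul]
    rfl

theorem boundedInverse_apply_eq_iff {S : L2 d m → L2 d m → Prop}
    (hS : ∃ R : L2 d m →L[ℂ] L2 d m, ∀ f h, R f = h ↔ S f h) (f h : L2 d m) :
    boundedInverse S f = h ↔ S f h := by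
  rw [boundedInverse, dif_pos hS]
  exact hS.choose_spec f h

theorem propagatorAux_succ_apply_eq_iff {P : Params d} {n : ℕ} {k : Config d m}
    {B : Grad (Fin (m + 1) × Fin d) →L[ℂ] Grad (Fin (m + 1) × Fin d)}
    (hB : ∀ a w, inner ℂ a (B w)
      = ((1 / P.N : ℝ) : ℂ) * hatForm P (propagatorAux P n (m + 1)) k a.ofLp w.ofLp)
    (hν : 0 < P.κ / P.N) (ht : 0 < P.tN) (hBn : ‖B‖ ≤ P.κ / P.N / 10) (f h : L2 d m) :
    propagatorAux P (n + 1) m k f = h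
      ↔ IsResolventSolution P (propagatorAux P n (m + 1)) k f h := by
  obtain ⟨R, hR⟩ := exists_resolvent (k := k) (re_resolventShift_pos ht) hν hBn
  exact boundedInverse_apply_eq_iff
    ⟨R, fun f h => (hR f h).trans (isResolventSolution_iff hB).symm⟩ f h

end Resolvent

/-! ### Families of propagators with bounded differences. -/

section Family

variable {d m : ℕ} {β : ℝ}

/-- Conjugation by the translation by `x`. -/
def conjTransL2 (x : Config d m) (W : L2 d m →L[ℂ] L2 d m) : L2 d m →L[ℂ] L2 d m :=
  trans x ∘L W ∘L trans (-x)

/-- The weight of a translation at momenta `k`. -/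
def transWeight (ν : ℝ) (k : Config d m) {E : Type*} [Norm E] (y : E) : ℝ :=
  bracket k / ν ^ (1 / 3 : ℝ) * ‖y‖

theorem transWeight_nonneg {ν : ℝ} (hν : 0 < ν) (k : Config d m) {E : Type*}
    [NormedAddCommGroup E] (y : E) : 0 ≤ transWeight ν k y := by
  have := bracket_pos k
  unfold transWeight
  positivity

theorem listWeight_mono_mul {X : Type*} [AddCommGroup X] {wt wt' : X → ℝ} {a : ℝ} (ha : 0 ≤ a)
    (hwt : ∀ y, 0 ≤ wt y) (hwt' : ∀ y, 0 ≤ wt' y) (h : ∀ y, wt y ≤ a * wt' y) (A : List X) :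
    listWeight wt A ≤ a ^ A.length * listWeight wt' A := by
  induction A with
  | nil => simp [listWeight]
  | cons y A ih =>
    rw [listWeight_cons, listWeight_cons, List.length_cons, pow_succ]
    have := listWeight_nonneg hwt A
    have := hwt' y
    calc _ ≤ (a * wt' y) * (a ^ A.length * listWeight wt' A) := by gcongr; exact h y
      _ = _ := by ring

theorem listWeight_map {X Y : Type*} {wt : X → ℝ} {wt' : Y → ℝ} {i : X → Y}
    (h : ∀ y, wt' (i y) = wt y) (A : List X) : listWeight wt' (A.map i) = listWeight wt A := by
  simp only [listWeight, List.map_map]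
  congr 2
  funext y
  exact h y

/-- Weak measurability and bounds of iterated differences for a family of operators depending
on the momenta. -/
structure IsRegularFamily (hβ : 0 < β) (ν : ℝ) (c : ℕ → ℝ)
    (W : Config d (m + 1) → (L2 d (m + 1) →L[ℂ] L2 d (m + 1))) : Prop where
  meas : ∀ f g, Measurable fun k => inner ℂ f (W k g)
  bound : ∀ k, lastVel k ≠ 0 → ∀ (A : List (Config d m)) (x : Config d m) (φ f : L2 d m),
    ‖inner ℂ (maxwellianCLM hβ φ)
        (fdiff A (fun x => conjTransL2 (extendVel x) (W k)) x (maxwellianCLM hβ f))‖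
      ≤ c A.length / ‖lastVel k‖ * listWeight (transWeight ν k) A * ‖φ‖ * ‖f‖

variable {hβ : 0 < β} {ν : ℝ} {c : ℕ → ℝ}
  {W : Config d (m + 1) → (L2 d (m + 1) →L[ℂ] L2 d (m + 1))}

theorem measurable_inner_fdiff_conjTransL2 {Ω : Type*} [MeasurableSpace Ω] {X : Type*}
    [AddCommGroup X] {i : X → Config d m} {G : Ω → (L2 d m →L[ℂ] L2 d m)}
    (hG : ∀ f g, Measurable fun t => inner ℂ f (G t g)) (A : List X) (x : X) (f g : L2 d m) :
    Measurable fun t => inner ℂ f (fdiff A (fun x => conjTransL2 (i x) (G t)) x g) := by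
  induction A generalizing x with
  | nil =>
    simp only [fdiff, conjTransL2, ContinuousLinearMap.comp_apply]
    have h : ∀ t, inner ℂ f (trans (i x) (G t (trans (-i x) g)))
        = inner ℂ (trans (-i x) f) (G t (trans (-i x) g)) := fun t => by
      rw [inner_trans_left, neg_neg]
    simp only [h]
    exact hG _ _
  | cons y A ih =>
    simp only [fdiff, sub_apply, inner_sub_right]
    exact (ih _).sub (ih _)

/-- The weights belong to the momenta after the collision; returning to the weights at k costs 2(1 +
|q|) for each difference. -/
theorem IsRegularFamily.admissible (hν : 0 < ν) (hc : ∀ n, 0 ≤ c n)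
    (hW : IsRegularFamily hβ ν c W) (k : Config d m) (A : List (Config d m)) (x : Config d m) :
    Admissible hβ (fun j q => fdiff A
      (fun x => conjTransL2 (extendVel x) (W (transferMomentum k j q))) x)
      (c A.length * listWeight (transWeight ν k) A) A.length where
  meas j f g := measurable_inner_fdiff_conjTransL2 (fun f g => (hW.meas f g).comp
    ((measurable_transferMomentum j).comp measurable_prodMk_left)) A x f g
  bound j q hq φ f := by
    have h1 := hW.bound (transferMomentum k j q) (by rwa [lastVel_transferMomentum]) A x φ f
    rw [lastVel_transferMomentum] at h1
    refine h1.trans ?_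
    have h2 : listWeight (transWeight ν (transferMomentum k j q)) A
        ≤ (2 * (1 + ‖q‖)) ^ A.length * listWeight (transWeight ν k) A := by
      refine listWeight_mono_mul (by positivity) (transWeight_nonneg hν _)
        (transWeight_nonneg hν _) (fun y => ?_) A
      have := bracket_transferMomentum_le k j q
      calc transWeight ν (transferMomentum k j q) y
          ≤ bracket k * (2 * (1 + ‖q‖)) / ν ^ (1 / 3 : ℝ) * ‖y‖ := by
            unfold transWeight; gcongr
        _ = _ := by unfold transWeight; ring
    have := hc A.length
    calc _ ≤ c A.length / ‖q‖ * ((2 * (1 + ‖q‖)) ^ A.length * listWeight (transWeight ν k) A)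
          * ‖φ‖ * ‖f‖ := by gcongr
      _ = _ := by ring

/-- Translations of the first velocities commute with contraction and with √M, so they reach the
propagator. Conjugating B is therefore conjugating the propagator one level up. -/
theorem collisionForm_gtrans {V : EuclideanSpace ℝ (Fin d) → ℝ} (x : Config d m)
    (G : Fin (m + 1) → EuclideanSpace ℝ (Fin d) → (L2 d (m + 1) →L[ℂ] L2 d (m + 1)))
    (a w : Grad (Fin (m + 1) × Fin d)) :
    collisionForm hβ V G (gtrans (-x) a).ofLp (gtrans (-x) w).ofLp
      = collisionForm hβ V (fun j q => conjTransL2 (extendVel x) (G j q)) a.ofLp w.ofLp := by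
  have e : ∀ (a : Grad (Fin (m + 1) × Fin d)) j q,
      maxwellianCLM hβ (contract j q (gtrans (-x) a).ofLp)
        = trans (-extendVel x) (maxwellianCLM hβ (contract j q a.ofLp)) := by
    intro a j q
    have h1 : -extendVel x = extendVel (-x) := (map_neg extendVelHom x).symm
    rw [h1, trans_maxwellianCLM, trans_contract]
    rfl
  unfold collisionForm formIntegrand
  simp only [e, conjTransL2, ContinuousLinearMap.comp_apply]
  refine Finset.sum_congr rfl fun j _ => ?_
  congr 1
  funext q
  rw [inner_trans_left, neg_neg]

theorem inner_conjTrans (x : Config d m) (B : Grad (Fin (m + 1) × Fin d) →L[ℂ] _)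
    (a w : Grad (Fin (m + 1) × Fin d)) :
    inner ℂ a (conjTrans x B w) = inner ℂ (gtrans (-x) a) (B (gtrans (-x) w)) := by
  rw [inner_gtrans_left, neg_neg]
  rfl

theorem IsRegularFamily.exists_operator {P : Params d} (hV : ContDiff ℝ ∞ P.V)
    (hVc : HasCompactSupport P.V) (hc : ∀ n, 0 ≤ c n) (hν : 0 < P.κ / P.N)
    (hW : IsRegularFamily P.β_pos (P.κ / P.N) c W) (k : Config d m) :
    ∃ B : Grad (Fin (m + 1) × Fin d) →L[ℂ] Grad (Fin (m + 1) × Fin d),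
      (∀ a w, inner ℂ a (B w) = ((1 / P.N : ℝ) : ℂ) * hatForm P W k a.ofLp w.ofLp) ∧
      ∀ A x, ‖fdiff A (fun x => conjTrans x B) x‖
        ≤ 1 / P.N * ((2 * Real.pi) ^ d)⁻¹ *
          (c A.length * listWeight (transWeight (P.κ / P.N) k) A * potentialMoment P.V A.length) := by
  have hadm := hW.admissible hν hc k
  have hnn : ∀ A : List (Config d m), 0 ≤ c A.length * listWeight (transWeight (P.κ / P.N) k) A :=
    fun A => mul_nonneg (hc _) (listWeight_nonneg (transWeight_nonneg hν k) A)
  have e0 : ∀ G : L2 d (m + 1) →L[ℂ] L2 d (m + 1),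
      conjTransL2 (extendVel (0 : Config d m)) G = G := fun G => by
    have h1 : extendVel (0 : Config d m) = 0 := map_zero extendVelHom
    ext1 f
    simp only [conjTransL2, ContinuousLinearMap.comp_apply, h1, neg_zero, trans_zero]
  obtain ⟨B₀, hB₀⟩ := (hadm [] 0).exists_operator hV hVc (hnn [])
  simp only [fdiff, e0] at hB₀
  set r : ℝ := 1 / P.N * ((2 * Real.pi) ^ d)⁻¹ with hr
  have hr0 : 0 ≤ r := by positivity
  have hB : ∀ a w, inner ℂ a (((r : ℂ) • B₀) w)
      = (r : ℂ) * collisionForm P.β_pos P.V (fun j q => W (transferMomentum k j q))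
        a.ofLp w.ofLp := fun a w => by
    rw [smul_apply, inner_smul_right, hB₀]
  refine ⟨(r : ℂ) • B₀, fun a w => ?_, fun A x => ?_⟩
  · rw [hB, hatForm_eq, hr]
    push_cast
    ring
  · refine (hadm A x).opNorm_le hV hVc (hnn A) hr0 fun a w => ?_
    have h1 := fdiff_collisionForm (V := P.V) (hβ := P.β_pos) (a := a.ofLp) (w := w.ofLp)
      (G := fun x j q => conjTransL2 (extendVel x) (W (transferMomentum k j q)))
      (fun x j => (hadm [] x).integrable hV hVc (hnn []) j) A x
    rw [← h1.2]
    let ev : (Grad (Fin (m + 1) × Fin d) →L[ℂ] Grad (Fin (m + 1) × Fin d)) →+ ℂ :=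
      { toFun := fun T => inner ℂ a (T w)
        map_zero' := by simp
        map_add' := fun T S => by rw [add_apply, inner_add_right] }
    let mu : ℂ →+ ℂ := AddMonoidHom.mulLeft (r : ℂ)
    change ev _ = mu _
    rw [map_fdiff ev, map_fdiff mu]
    congr 1
    funext x
    change inner ℂ a (conjTrans x ((r : ℂ) • B₀) w) = (r : ℂ) * _
    rw [inner_conjTrans, hB, collisionForm_gtrans]

end Family

/-! ### The propagator between Maxwellians. -/

section DifferenceBound

variable {d m : ℕ} {β : ℝ} {z : ℂ} {ν : ℝ}

/-- The length scale `(|k|/ν)^{1/3}` of hypoelliptic regularization. -/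
def hypoScale (ν : ℝ) (k : Config d m) : ℝ := (‖k‖ / ν) ^ (1 / 3 : ℝ)

theorem hypoScale_pos (hν : 0 < ν) {k : Config d m} (hk : k ≠ 0) : 0 < hypoScale ν k := by
  have := norm_pos_iff.2 hk
  unfold hypoScale
  positivity

theorem rpow_third_pow_three {x : ℝ} (hx : 0 ≤ x) : (x ^ (1 / 3 : ℝ)) ^ 3 = x := by
  rw [← Real.rpow_natCast, ← Real.rpow_mul hx]
  norm_num

theorem rpow_third_le_bracket (k : Config d m) : ‖k‖ ^ (1 / 3 : ℝ) ≤ bracket k :=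
  calc ‖k‖ ^ (1 / 3 : ℝ) ≤ bracket k ^ (1 / 3 : ℝ) := by
        gcongr; exact norm_le_bracket k
    _ ≤ bracket k ^ (1 : ℝ) := Real.rpow_le_rpow_of_exponent_le (one_le_bracket k) (by norm_num)
    _ = bracket k := Real.rpow_one _

theorem mul_hypoScale_pow (hν : 0 < ν) (k : Config d m) : ν * hypoScale ν k ^ 3 = ‖k‖ := by
  rw [hypoScale, rpow_third_pow_three (by positivity)]
  field_simp

theorem hypoScale_le (hν : 0 < ν) (k : Config d m) :
    hypoScale ν k ≤ bracket k / ν ^ (1 / 3 : ℝ) := by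
  rw [hypoScale, Real.div_rpow (norm_nonneg _) hν.le]
  gcongr
  exact rpow_third_le_bracket k

/-- From |k| = νR³, the shift k·y is νR² times R|y|. The weight contains ⟨k⟩ν^(-1/3) in place of R,
since ⟨k⟩, unlike |k|, is comparable before and after a collision. -/
theorem abs_inner_le_transWeight (hν : 0 < ν) (k y : Config d m) :
    |inner ℝ k y| ≤ ν * hypoScale ν k ^ 2 * transWeight ν k y := by
  have h0 : 0 ≤ hypoScale ν k := by unfold hypoScale; positivity
  calc |inner ℝ k y| ≤ ‖k‖ * ‖y‖ := abs_real_inner_le_norm k y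
    _ = ν * hypoScale ν k ^ 2 * (hypoScale ν k * ‖y‖) := by
        rw [← mul_hypoScale_pow hν k]; ring
    _ ≤ _ := by
        unfold transWeight
        gcongr
        exact hypoScale_le hν k

theorem isSol_conjTransL2 {k : Config d m} {B : Grad (Fin (m + 1) × Fin d) →L[ℂ] _}
    {W : L2 d m →L[ℂ] L2 d m} (hW : ∀ f, ∃ w, IsSol z k ν B (W f) w f 0) (x : Config d m)
    (f : L2 d m) :
    ∃ w, IsSol (z + Complex.I * ((inner ℝ k x : ℝ) : ℂ)) k ν (conjTrans x B)
      (conjTransL2 x W f) w f 0 := by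
  obtain ⟨w, hw⟩ := hW (trans (-x) f)
  have h := hw.trans x
  rw [trans_trans_neg, map_zero] at h
  exact ⟨_, h⟩

/-- The constant in the base estimate of the propagator between Maxwellians. -/
def baseConst (d : ℕ) {β : ℝ} (hβ : 0 < β) : ℝ := 20 * Real.pi * maxwellianConst d hβ ^ 2

theorem baseConst_pos (d : ℕ) (hβ : 0 < β) : 0 < baseConst d hβ := by
  have := maxwellianConst_pos d hβ
  have := Real.pi_pos
  unfold baseConst
  positivity

/-- Data regular in direction u give solutions of size S‖F‖; the difference estimate turns these
into data of size νS‖F‖ for the differenced equation; measuring its solution in direction u gives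
νS²‖F‖, of order ‖F‖/|q| with no ν left. -/
theorem norm_fmul_star_resolventSymbol_fdiff_le {k : Config d (m + 1)} (hk : lastVel k ≠ 0)
    (hz : 0 ≤ z.re) (hν : 0 < ν) {B : Grad (Fin (m + 2) × Fin d) →L[ℂ] Grad (Fin (m + 2) × Fin d)}
    (hB : ‖B‖ ≤ ν / 10) {W : L2 d (m + 1) →L[ℂ] L2 d (m + 1)}
    (hW : ∀ f, ∃ w, IsSol z k ν B (W f) w f 0) {ϑ : ℝ} (hϑ : 0 ≤ ϑ) {n : ℕ}
    (hdiff : ∀ A : List (Config d (m + 1)), A ≠ [] → A.length ≤ n → ∀ x,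
      ‖fdiff A (fun x => conjTrans x B) x‖ ≤ ϑ * ν * listWeight (transWeight ν k) A)
    {f F : L2 d (m + 1)} {u : EuclideanSpace ℝ (Fin d)} (hu : u = ‖lastVel k‖⁻¹ • lastVel k)
    (hF : f = fmul (resolventSymbol (liftLast u)) F)
    {A : List (Config d m)} (hA : A.length ≤ n) (x : Config d m) :
    ‖fmul (star (resolventSymbol (liftLast u)))
        (fdiff A (fun x => conjTransL2 (extendVel x) W) x f)‖
      ≤ 20 * Real.pi / ‖lastVel k‖ * ‖F‖ * diffConst ϑ n * listWeight (transWeight ν k) A := by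
  have hq := norm_pos_iff.2 hk
  have hpi := Real.pi_pos
  have hk0 : k ≠ 0 := by
    rintro rfl
    exact hk rfl
  -- The direction is chosen along the last momentum, so that transport along it has speed exactly
  -- |q|.
  have hn : inner ℝ k (liftLast u) = ‖lastVel k‖ := by
    rw [inner_config, initVel_liftLast, inner_zero_right, zero_add, lastVel_liftLast, hu,
      real_inner_smul_right, real_inner_self_eq_norm_sq]
    field_simp
  have hn0 : 0 < inner ℝ k (liftLast u) := hn ▸ hq
  have hR := hypoScale_pos hν hk0
  have hRk := mul_hypoScale_pow hν k
  set R := hypoScale ν k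
  have hwt := transWeight_nonneg hν k (E := Config d m)
  let L : Config d m →+ ℝ :=
    { toFun := fun x => inner ℝ k (extendVel x)
      map_zero' := by
        rw [show extendVel (0 : Config d m) = 0 from map_zero extendVelHom, inner_zero_right]
      map_add' := fun x y => by
        rw [show extendVel (x + y) = extendVel x + extendVel y from map_add extendVelHom x y,
          inner_add_right] }
  have hz' : ∀ x : Config d m, 0 ≤ (z + Complex.I * ((L x : ℝ) : ℂ)).re := fun x => by simpa using hz
  let hx : Config d m → L2 d (m + 1) := fun x => conjTransL2 (extendVel x) W f
  choose wx hs using fun x : Config d m => isSol_conjTransL2 hW (extendVel x) f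
  have hBx : ∀ x : Config d m, ‖conjTrans (extendVel x) B‖ ≤ ν / 10 := fun x =>
    (norm_conjTrans_le _).trans hB
  have ev : fdiff A (fun x => conjTransL2 (extendVel x) W) x f = fdiff A hx x := by
    let ev : (L2 d (m + 1) →L[ℂ] L2 d (m + 1)) →+ L2 d (m + 1) :=
      { toFun := fun T => T f
        map_zero' := rfl
        map_add' := fun _ _ => rfl }
    exact map_fdiff ev A _ x
  rw [ev]
  rcases eq_or_ne A [] with rfl | hA0
  -- Without differences the directional estimate applies directly and involves no information on
  -- differences of B; this gives the level-independent base constant.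
  · have h1 := (hs x).weighted_norm_le (hz' x) hν (hBx x) hn0 hF
    rw [hn] at h1
    simp only [listWeight, List.map_nil, List.prod_nil, mul_one]
    exact h1.trans (le_mul_of_one_le_right (by positivity) (one_le_diffConst hϑ n))
  · set S := Real.sqrt (3200 * Real.pi / (ν * ‖lastVel k‖)) with hS
    have hSS : S ^ 2 = 3200 * Real.pi / (ν * ‖lastVel k‖) := Real.sq_sqrt (by positivity)
    have hS0 : 0 ≤ S := Real.sqrt_nonneg _
    obtain ⟨r₀, r₁, h1, h2⟩ := exists_isSol_fdiff_le (wt := transWeight ν k) (L := L)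
      (η := S * ‖F‖) (rx := fun _ => f) (hx := hx) (wx := wx)
      (Bx := fun x => conjTrans (extendVel x) B) (z := z) (k := k) hwt hz hν hk0 hR
      hRk hϑ (by positivity) hs (fun y => by
        have h := abs_inner_le_transWeight hν k (extendVel y)
        rw [transWeight, norm_extendVel] at h
        exact h) hBx
      (fun x => by
        have h := (hs x).norm_sq_le_of_resolventSymbol (hz' x) hν (hBx x) hn0 hF hR hRk
        rw [hn, ← hSS, ← mul_pow] at h
        exact le_of_sq_le_sq h (by positivity)) n
      (fun A hA0 hA x => by
        have h := hdiff (A.map extendVelHom) (by simpa using hA0) (by simpa using hA) (extendVel x)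
        rw [listWeight_map (wt := transWeight ν k) fun y => by
          rw [transWeight, transWeight, extendVelHom_apply, norm_extendVel]] at h
        have h' := fdiff_comp extendVelHom A (fun x => conjTrans x B) x
        simp only [extendVelHom_apply] at h'
        rw [h']
        exact h)
      (fun A hA0 hA x => by
        rw [fdiff_const _ hA0, norm_zero, mul_zero]
        have := listWeight_nonneg hwt A
        positivity) hA0 hA x
    have h3 := h1.weighted_norm_sq_le (hz' x) hν (hBx x) hn0 hR hRk
    rw [hn, ← hSS, ← mul_pow] at h3
    have hW0 := listWeight_nonneg hwt A
    have hD0 := one_le_diffConst hϑ n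
    have h5 : R⁻¹ * ‖r₀‖ + ‖r₁‖
        ≤ ν / 160 * (diffConst ϑ n * (S * ‖F‖) * listWeight (transWeight ν k) A) := by
      calc R⁻¹ * ‖r₀‖ + ‖r₁‖ = ν / 160 * (160 / ν * (R⁻¹ * ‖r₀‖ + ‖r₁‖)) := by field_simp
        _ ≤ _ := by gcongr
    have h4 := le_of_sq_le_sq h3 (by positivity)
    calc _ ≤ S * (R⁻¹ * ‖r₀‖ + ‖r₁‖) := h4
      _ ≤ S * (ν / 160 * (diffConst ϑ n * (S * ‖F‖) * listWeight (transWeight ν k) A)) := by gcongr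
      -- S²·ν/160 = 20π/|q|, the same constant as in the case of no differences.
      _ = S ^ 2 * (ν / 160 * (diffConst ϑ n * ‖F‖ * listWeight (transWeight ν k) A)) := by ring
      _ = _ := by
        rw [hSS]
        field_simp
        ring

/-- Both Maxwellian factors are used: the right one as regular data, the left one to transfer a
resolvent onto the solution. -/
theorem norm_inner_maxwellianCLM_fdiff_le (hβ : 0 < β) {k : Config d (m + 1)}
    (hk : lastVel k ≠ 0) (hz : 0 ≤ z.re) (hν : 0 < ν)
    {B : Grad (Fin (m + 2) × Fin d) →L[ℂ] Grad (Fin (m + 2) × Fin d)}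
    (hB : ‖B‖ ≤ ν / 10) {W : L2 d (m + 1) →L[ℂ] L2 d (m + 1)}
    (hW : ∀ f, ∃ w, IsSol z k ν B (W f) w f 0) {ϑ : ℝ} (hϑ : 0 ≤ ϑ) {n : ℕ}
    (hdiff : ∀ A : List (Config d (m + 1)), A ≠ [] → A.length ≤ n → ∀ x,
      ‖fdiff A (fun x => conjTrans x B) x‖ ≤ ϑ * ν * listWeight (transWeight ν k) A)
    {A : List (Config d m)} (hA : A.length ≤ n) (x : Config d m) (φ f : L2 d m) :
    ‖inner ℂ (maxwellianCLM hβ φ)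
        (fdiff A (fun x => conjTransL2 (extendVel x) W) x (maxwellianCLM hβ f))‖
      ≤ baseConst d hβ * diffConst ϑ n / ‖lastVel k‖ * listWeight (transWeight ν k) A
        * ‖φ‖ * ‖f‖ := by
  have hq := norm_pos_iff.2 hk
  have hpi := Real.pi_pos
  obtain ⟨u, hu⟩ : ∃ u, u = ‖lastVel k‖⁻¹ • lastVel k := ⟨_, rfl⟩
  have hu1 : ‖u‖ = 1 := by
    rw [hu, norm_smul, norm_inv, norm_norm, inv_mul_cancel₀ hq.ne']
  obtain ⟨Φ, hΦ, hΦn⟩ := exists_maxwellianCLM_eq (m := m) hβ hu1 φ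
  obtain ⟨F, hF, hFn⟩ := exists_maxwellianCLM_eq (m := m) hβ hu1 f
  have h1 := norm_fmul_star_resolventSymbol_fdiff_le hk hz hν hB hW hϑ hdiff hu hF hA x
  rw [hΦ, inner_fmul_left]
  have h0 := listWeight_nonneg (transWeight_nonneg hν k (E := Config d m)) A
  have hD := one_le_diffConst hϑ n
  have hc := maxwellianConst_pos d hβ
  calc _ ≤ ‖Φ‖ * _ := norm_inner_le_norm _ _
    _ ≤ (maxwellianConst d hβ * ‖φ‖) * (20 * Real.pi / ‖lastVel k‖ *
        (maxwellianConst d hβ * ‖f‖) * diffConst ϑ n * listWeight (transWeight ν k) A) := by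
        gcongr
        exact h1.trans (by gcongr)
    _ = _ := by unfold baseConst; ring

end DifferenceBound

/-! ### Downward induction over the levels. -/

section Hierarchy

variable {d m : ℕ} {P : Params d} {c : ℕ → ℝ} {κ₀ : ℝ}
  {W : Config d (m + 1) → (L2 d (m + 1) →L[ℂ] L2 d (m + 1))}

/-- The relative size of the differences of the collision operator. -/
def perturbConst (V : EuclideanSpace ℝ (Fin d) → ℝ) (κ₀ : ℝ) (c : ℕ → ℝ) (n : ℕ) : ℝ :=
  ∑ i ∈ Finset.range (n + 1), ((2 * Real.pi) ^ d)⁻¹ * c i * potentialMoment V i / κ₀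

theorem perturbConst_nonneg (V : EuclideanSpace ℝ (Fin d) → ℝ) (hκ₀ : 0 < κ₀)
    (hc : ∀ n, 0 ≤ c n) (n : ℕ) : 0 ≤ perturbConst V κ₀ c n :=
  Finset.sum_nonneg fun i _ => by
    have := hc i
    have := potentialMoment_nonneg (V := V) i
    have := Real.pi_pos
    positivity

/-- Only c 0 and the zeroth moment C_0^V enter the smallness of B. Its differences need merely be
bounded relative to ν, and the higher moments go into `perturbConst`. Comparing κ₀/N with κ/N makes
these constants uniform in κ and N. -/
theorem IsRegularFamily.exists_perturbation (hV : ContDiff ℝ ∞ P.V)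
    (hVc : HasCompactSupport P.V) (hc : ∀ n, 0 ≤ c n) (hκ₀ : 0 < κ₀) (hκ : κ₀ ≤ P.κ)
    (hN : 1 ≤ P.N) (hsmall : 10 * ((2 * Real.pi) ^ d)⁻¹ * c 0 * potentialConst P.V ≤ κ₀)
    (hW : IsRegularFamily P.β_pos (P.κ / P.N) c W) (k : Config d m) :
    ∃ B : Grad (Fin (m + 1) × Fin d) →L[ℂ] Grad (Fin (m + 1) × Fin d),
      (∀ a w, inner ℂ a (B w) = ((1 / P.N : ℝ) : ℂ) * hatForm P W k a.ofLp w.ofLp) ∧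
      ‖B‖ ≤ P.κ / P.N / 10 ∧
      ∀ n (A : List (Config d m)), A.length ≤ n → ∀ x, ‖fdiff A (fun x => conjTrans x B) x‖
        ≤ perturbConst P.V κ₀ c n * (P.κ / P.N) *
          listWeight (transWeight (P.κ / P.N) k) A := by
  have hN0 : (0 : ℝ) < P.N := by exact_mod_cast hN
  have hκ0 := hκ₀.trans_le hκ
  have hν : 0 < P.κ / P.N := by positivity
  have hpi := Real.pi_pos
  obtain ⟨B, hB, hBd⟩ := hW.exists_operator hV hVc hc hν k
  refine ⟨B, hB, ?_, fun n A hA x => (hBd A x).trans ?_⟩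
  · have h1 := hBd [] 0
    have e : conjTrans 0 B = B := by
      ext1 w
      change gtrans 0 (B (gtrans (-0) w)) = _
      have hg : ∀ w : Grad (Fin (m + 1) × Fin d), gtrans 0 w = w := fun w => by
        ext1 e
        exact trans_zero _
      rw [neg_zero, hg, hg]
    simp only [fdiff, e, listWeight, List.map_nil, List.prod_nil, mul_one, List.length_nil,
      potentialMoment_zero] at h1
    refine h1.trans ?_
    calc 1 / P.N * ((2 * Real.pi) ^ d)⁻¹ * (c 0 * potentialConst P.V)
        = 10 * ((2 * Real.pi) ^ d)⁻¹ * c 0 * potentialConst P.V / P.N / 10 := by ring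
      _ ≤ P.κ / P.N / 10 := by gcongr; exact hsmall.trans hκ
  · have h0 := listWeight_nonneg (transWeight_nonneg hν k (E := Config d m)) A
    have h2 : ((2 * Real.pi) ^ d)⁻¹ * c A.length * potentialMoment P.V A.length / κ₀
        ≤ perturbConst P.V κ₀ c n := by
      refine Finset.single_le_sum (f := fun i =>
        ((2 * Real.pi) ^ d)⁻¹ * c i * potentialMoment P.V i / κ₀) (fun i _ => ?_)
        (Finset.mem_range.2 (by omega))
      have := hc i
      have := potentialMoment_nonneg (V := P.V) i
      positivity
    have hp := potentialMoment_nonneg (V := P.V) A.length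
    have hcA := hc A.length
    calc _ = ((2 * Real.pi) ^ d)⁻¹ * c A.length * potentialMoment P.V A.length / κ₀ *
          (κ₀ / P.N) * listWeight (transWeight (P.κ / P.N) k) A := by field_simp
      _ ≤ _ := by
          have := perturbConst_nonneg P.V hκ₀ hc n
          gcongr

theorem measurable_hatForm (hV : ContDiff ℝ ∞ P.V) (hVc : HasCompactSupport P.V)
    (hW : ∀ f g, Measurable fun k => inner ℂ f (W k g)) (a w : Fin (m + 1) × Fin d → L2 d m) :
    Measurable fun k => hatForm P W k a w := by
  simp only [hatForm_eq, collisionForm]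
  refine measurable_const.mul (Finset.measurable_sum _ fun j _ => ?_)
  have h1 : Measurable fun p : Config d m × EuclideanSpace ℝ (Fin d) =>
      formIntegrand P.β_pos P.V (fun j q => W (transferMomentum p.1 j q)) a w j p.2 := by
    have h2 : Measurable fun p : Config d m × EuclideanSpace ℝ (Fin d) => potentialHat P.V p.2 :=
      (continuous_potentialHat hV hVc).measurable.comp measurable_snd
    exact (Complex.measurable_ofReal.comp (h2.norm.pow_const 2)).mul
      (measurable_inner_contract P.β_pos measurable_snd
        (fun f g => (hW f g).comp (measurable_transferMomentum j)) a w j)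
  exact (h1.stronglyMeasurable.integral_prod_right (ν := volume)).measurable

/-- The assertion that `W` is the family of resolvents built from the family `W'`. -/
def IsResolventFamily (P : Params d)
    (W' : Config d (m + 1) → (L2 d (m + 1) →L[ℂ] L2 d (m + 1)))
    (W : Config d m → (L2 d m →L[ℂ] L2 d m)) : Prop :=
  ∀ k f h, W k f = h ↔ IsResolventSolution P W' k f h

theorem IsRegularFamily.isResolventFamily {n : ℕ} (hV : ContDiff ℝ ∞ P.V)
    (hVc : HasCompactSupport P.V) (hc : ∀ n, 0 ≤ c n) (hκ₀ : 0 < κ₀) (hκ : κ₀ ≤ P.κ)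
    (hN : 1 ≤ P.N) (ht : 0 < P.tN)
    (hsmall : 10 * ((2 * Real.pi) ^ d)⁻¹ * c 0 * potentialConst P.V ≤ κ₀)
    (hW : IsRegularFamily P.β_pos (P.κ / P.N) c (propagatorAux P n (m + 1))) :
    IsResolventFamily P (propagatorAux P n (m + 1)) (propagatorAux P (n + 1) m) := by
  intro k f h
  obtain ⟨B, hB, hBn, -⟩ := hW.exists_perturbation hV hVc hc hκ₀ hκ hN hsmall k
  have hN0 : (0 : ℝ) < P.N := by exact_mod_cast hN
  exact propagatorAux_succ_apply_eq_iff hB (div_pos (hκ₀.trans_le hκ) hN0) ht hBn f h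

/-- The induction step: regularity of the family above makes B small with bounded differences, and
the directional estimates return regularity of the family below. Measurability in k passes from W'
to the form B and then to the resolvent. -/
theorem IsRegularFamily.next {W' : Config d (m + 2) → (L2 d (m + 2) →L[ℂ] L2 d (m + 2))}
    (hV : ContDiff ℝ ∞ P.V) (hVc : HasCompactSupport P.V) (hc : ∀ n, 0 ≤ c n) (hκ₀ : 0 < κ₀)
    (hκ : κ₀ ≤ P.κ) (hN : 1 ≤ P.N) (ht : 0 < P.tN)
    (hsmall : 10 * ((2 * Real.pi) ^ d)⁻¹ * c 0 * potentialConst P.V ≤ κ₀)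
    (hW' : IsRegularFamily P.β_pos (P.κ / P.N) c W') (hW : IsResolventFamily P W' W) :
    IsRegularFamily P.β_pos (P.κ / P.N)
      (fun n => baseConst d P.β_pos * diffConst (perturbConst P.V κ₀ c n) n) W := by
  have hN0 : (0 : ℝ) < P.N := by exact_mod_cast hN
  have hν : 0 < P.κ / P.N := div_pos (hκ₀.trans_le hκ) hN0
  have hz := re_resolventShift_pos ht
  choose B hB hBn hBd using fun k => hW'.exists_perturbation hV hVc hc hκ₀ hκ hN hsmall k
  have hs : ∀ k f, ∃ w, IsSol (resolventShift P) k (P.κ / P.N) (B k) (W k f) w f 0 := fun k f =>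
    (isResolventSolution_iff (hB k)).1 ((hW k f _).1 rfl)
  refine ⟨fun g f => ?_, fun k hk A x φ f => ?_⟩
  · refine measurable_inner_resolvent measurable_id (B := B) (fun a w => ?_) hz hν hBn
      (fun k => hs k f) g
    simp only [hB]
    exact measurable_const.mul (measurable_hatForm hV hVc hW'.meas _ _)
  · exact norm_inner_maxwellianCLM_fdiff_le P.β_pos hk hz.le hν (hBn k) (hs k)
      (perturbConst_nonneg P.V hκ₀ hc A.length) (fun A' _ hA' x => hBd k A.length A' hA' x) le_rfl
      x φ f

theorem isRegularFamily_zero {β ν : ℝ} {hβ : 0 < β} (hν : 0 < ν) (hc : ∀ n, 0 ≤ c n) :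
    IsRegularFamily hβ ν c (fun _ : Config d (m + 1) => (0 : L2 d (m + 1) →L[ℂ] L2 d (m + 1))) where
  meas f g := by simp
  bound k _ A x φ f := by
    have e : ∀ A : List (Config d m), ∀ x, fdiff A (fun x : Config d m =>
        conjTransL2 (extendVel x) (0 : L2 d (m + 1) →L[ℂ] L2 d (m + 1))) x = 0 := by
      intro A
      induction A with
      | nil =>
        intro x
        ext1 f
        simp [fdiff, conjTransL2]
      | cons y A ih => intro x; simp [fdiff, ih]
    rw [e, zero_apply, inner_zero_right, norm_zero]
    have := hc A.length
    have := listWeight_nonneg (transWeight_nonneg hν k (E := Config d m)) A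
    positivity

/-- The constants in the estimates of the propagators, by the number of levels above the
truncation. -/
def levelConst {β : ℝ} (hβ : 0 < β) (V : EuclideanSpace ℝ (Fin d) → ℝ) (κ₀ : ℝ) : ℕ → ℕ → ℝ
  | 0, _ => baseConst d hβ
  | L + 1, n => baseConst d hβ * diffConst (perturbConst V κ₀ (levelConst hβ V κ₀ L) n) n

theorem levelConst_nonneg {β : ℝ} (hβ : 0 < β) (V : EuclideanSpace ℝ (Fin d) → ℝ)
    (hκ₀ : 0 < κ₀) (L n : ℕ) : 0 ≤ levelConst hβ V κ₀ L n := by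
  have hb := baseConst_pos d hβ
  induction L generalizing n with
  | zero => exact hb.le
  | succ L ih =>
    have := one_le_diffConst (perturbConst_nonneg V hκ₀ ih n) n
    rw [levelConst]
    positivity

/-- The reason why one smallness condition serves all levels: the bound without differences never
deteriorates. Level 0 is assigned `baseConst`, although the propagator vanishes there, to keep this
uniform. -/
theorem levelConst_apply_zero {β : ℝ} (hβ : 0 < β) (V : EuclideanSpace ℝ (Fin d) → ℝ) (κ₀ : ℝ)
    (L : ℕ) : levelConst hβ V κ₀ L 0 = baseConst d hβ := by
  cases L with
  | zero => rfl
  | succ L => rw [levelConst, diffConst, mul_one]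

theorem isRegularFamily_propagatorAux (hV : ContDiff ℝ ∞ P.V) (hVc : HasCompactSupport P.V)
    (hκ₀ : 0 < κ₀) (hκ : κ₀ ≤ P.κ) (hN : 1 ≤ P.N) (ht : 0 < P.tN)
    (hsmall : 10 * ((2 * Real.pi) ^ d)⁻¹ * baseConst d P.β_pos * potentialConst P.V ≤ κ₀)
    (L m : ℕ) :
    IsRegularFamily P.β_pos (P.κ / P.N) (levelConst P.β_pos P.V κ₀ L)
      (propagatorAux P L (m + 1)) := by
  have hN0 : (0 : ℝ) < P.N := by exact_mod_cast hN
  have hν : 0 < P.κ / P.N := div_pos (hκ₀.trans_le hκ) hN0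
  have hc := levelConst_nonneg P.β_pos P.V hκ₀
  induction L generalizing m with
  | zero => exact isRegularFamily_zero hν (hc 0)
  | succ L ih =>
    have hs : 10 * ((2 * Real.pi) ^ d)⁻¹ * levelConst P.β_pos P.V κ₀ L 0
        * potentialConst P.V ≤ κ₀ := by rwa [levelConst_apply_zero]
    exact (ih (m + 1)).next hV hVc (hc L) hκ₀ hκ hN ht hs
      ((ih (m + 1)).isResolventFamily hV hVc (hc L) hκ₀ hκ hN ht hs)

end Hierarchy

/-! ### Iterated weak derivatives. -/

section IteratedDerivatives

variable {E : Type*} [NormedAddCommGroup E] [InnerProductSpace ℝ E] [FiniteDimensional ℝ E]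
  [MeasurableSpace E] [BorelSpace E]

/-- The symbol of an iterated derivative. -/
def derivSymbol (A : List E) (ξ : E) : ℂ :=
  (A.map fun y => 2 * Real.pi * Complex.I * ((inner ℝ ξ y : ℝ) : ℂ)).prod

/-- If all products of at most `N` derivatives, in Fourier variables, are square integrable, they
are the iterated weak derivatives. -/
theorem iteratedLineDerivOp_eq_of_fourier {ι : Type*} (e : ι → E)
    {h : Lp ℂ 2 (volume : Measure E)} {N : ℕ} {b : ℕ → ℝ}
    (H : ∀ n ≤ N, ∀ I : Fin n → ι, ∃ u : Lp ℂ 2 (volume : Measure E), ‖u‖ ≤ b n ∧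
      (𝓕 u : Lp ℂ 2 (volume : Measure E)) =ᵐ[volume] fun ξ =>
        derivSymbol (List.ofFn fun r => e (I r)) ξ * (𝓕 h : Lp ℂ 2 (volume : Measure E)) ξ)
    (n : ℕ) (hn : n ≤ N) (I : Fin n → ι) :
    ∃ u : Lp ℂ 2 (volume : Measure E), ∂^{fun r => e (I r)} (h : 𝓢'(E, ℂ)) = (u : 𝓢'(E, ℂ)) ∧
      ‖u‖ ≤ b n ∧ (𝓕 u : Lp ℂ 2 (volume : Measure E)) =ᵐ[volume] fun ξ =>
        derivSymbol (List.ofFn fun r => e (I r)) ξ * (𝓕 h : Lp ℂ 2 (volume : Measure E)) ξ := by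
  induction n with
  | zero =>
    obtain ⟨u, hu, hF⟩ := H 0 hn I
    have : u = h := fourier_injective_L2 (Lp.ext (by simpa [derivSymbol] using hF))
    exact ⟨u, by rw [this]; rfl, hu, hF⟩
  | succ n ih =>
    obtain ⟨u', h1, -, h3⟩ := ih (by omega) (Fin.tail I)
    obtain ⟨u, hu, hF⟩ := H (n + 1) hn I
    refine ⟨u, ?_, hu, hF⟩
    rw [LineDeriv.iteratedLineDerivOp_succ_left]
    have h4 : Fin.tail (fun r => e (I r)) = fun r => e (Fin.tail I r) := rfl
    rw [h4, h1]
    refine (isWeakDeriv_iff_fourier (e (I 0)) u' u).2 ?_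
    filter_upwards [h3, hF] with ξ a1 a2
    rw [a2, a1, ← mul_assoc]
    congr 1
    rw [List.ofFn_succ]
    simp only [derivSymbol, List.map_cons, List.prod_cons]
    rfl

end IteratedDerivatives

/-! ### Regularity of solutions. -/

section Regularity

variable {d m : ℕ}

theorem besselSymbol_growth (s : ℕ) : (fun ξ : Config d m =>
    (((1 + (2 * Real.pi * ‖ξ‖) ^ 2) ^ ((s : ℝ) / 2) : ℝ) : ℂ)).HasTemperateGrowth := by
  have h1 : (fun ξ : Config d m => (2 * Real.pi) • ξ).HasTemperateGrowth := by fun_prop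
  have h2 := (Function.hasTemperateGrowth_one_add_norm_sq_rpow (Config d m) ((s : ℝ) / 2)).comp h1
  have h3 : (fun ξ : Config d m => (1 + (2 * Real.pi * ‖ξ‖) ^ 2) ^ ((s : ℝ) / 2))
      = (fun x : Config d m => (1 + ‖x‖ ^ 2) ^ ((s : ℝ) / 2)) ∘ fun ξ => (2 * Real.pi) • ξ := by
    funext ξ
    simp only [Function.comp_apply, norm_smul, Real.norm_eq_abs,
      abs_of_pos (by positivity : 0 < 2 * Real.pi)]
  rw [← h3] at h2
  fun_prop

theorem norm_fmul_diffSymbol_toLp_le (A : List (Config d m)) (g : 𝓢(Config d m, ℂ)) :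
    ‖fmul (diffSymbol A) (g.toLp 2 volume)‖ ≤ listWeight (‖·‖) A * besselNorm A.length g := by
  refine norm_fmul_toLp_le (besselSymbol_growth A.length) (fun ξ => ?_) g
  refine (norm_diffSymbol_le A ξ).trans ?_
  rw [mul_comm]
  have h0 : 0 ≤ listWeight (‖·‖) A := listWeight_nonneg (fun y => norm_nonneg y) A
  gcongr
  rw [Complex.norm_real, Real.norm_of_nonneg (by positivity)]
  calc (2 * Real.pi * ‖ξ‖) ^ A.length
      = ((2 * Real.pi * ‖ξ‖) ^ 2) ^ ((A.length : ℝ) / 2) := by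
        rw [← Real.rpow_natCast (2 * Real.pi * ‖ξ‖) 2, ← Real.rpow_mul (by positivity),
          ← Real.rpow_natCast]
        congr 1
        push_cast
        ring
    _ ≤ _ := by gcongr; linarith

theorem besselNorm_nonneg (s : ℕ) (g : 𝓢(Config d m, ℂ)) : 0 ≤ besselNorm s g := norm_nonneg _

variable {z : ℂ} {k : Config d m} {ν ϑ : ℝ}
  {B : Grad (Fin (m + 1) × Fin d) →L[ℂ] Grad (Fin (m + 1) × Fin d)}
  {h : L2 d m} {w : Grad (Fin (m + 1) × Fin d)} {g : 𝓢(Config d m, ℂ)}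

/-- The size of the data in the regularity estimate. -/
def dataSize (ν : ℝ) (k : Config d m) (n : ℕ) (g : 𝓢(Config d m, ℂ)) : ℝ :=
  160 / (ν * hypoScale ν k) * ∑ s ∈ Finset.range (n + 1),
    ((bracket k / ν ^ (1 / 3 : ℝ)) ^ s)⁻¹ * besselNorm s g

/-- The powers of ⟨k⟩ν^(-1/3) in the weights are divided out again: each derivative that falls on g
instead of on the equation saves one such factor. -/
theorem le_dataSize (hν : 0 < ν) (hk : k ≠ 0) {n : ℕ} {A : List (Config d m)}
    (hA : A.length ≤ n) :
    160 / (ν * hypoScale ν k) * ‖fmul (diffSymbol A) (g.toLp 2 volume)‖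
      ≤ dataSize ν k n g * listWeight (transWeight ν k) A := by
  have hR := hypoScale_pos hν hk
  have hb := bracket_pos k
  set ω₀ := bracket k / ν ^ (1 / 3 : ℝ) with hω
  have hω0 : 0 < ω₀ := by positivity
  have h1 : listWeight (transWeight ν k) A = ω₀ ^ A.length * listWeight (‖·‖) A := by
    clear hA
    induction A with
    | nil => simp [listWeight]
    | cons y A ih =>
      rw [listWeight_cons, listWeight_cons, ih, List.length_cons, pow_succ, transWeight]
      ring
  have h2 : (ω₀ ^ A.length)⁻¹ * besselNorm A.length g
      ≤ ∑ s ∈ Finset.range (n + 1), (ω₀ ^ s)⁻¹ * besselNorm s g :=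
    Finset.single_le_sum (f := fun s => (ω₀ ^ s)⁻¹ * besselNorm s g)
      (fun s _ => mul_nonneg (by positivity) (besselNorm_nonneg s g))
      (Finset.mem_range.2 (by omega))
  have h0 : 0 ≤ listWeight (‖·‖) A := listWeight_nonneg (fun y => norm_nonneg y) A
  rw [h1, dataSize]
  calc _ ≤ 160 / (ν * hypoScale ν k) * (listWeight (‖·‖) A * besselNorm A.length g) := by
        gcongr
        exact norm_fmul_diffSymbol_toLp_le A g
    _ = 160 / (ν * hypoScale ν k) * ((ω₀ ^ A.length)⁻¹ * besselNorm A.length g) *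
        (ω₀ ^ A.length * listWeight (‖·‖) A) := by field_simp
    _ ≤ _ := by gcongr

theorem IsSol.norm_add_norm_fdiff_le (hs : IsSol z k ν B h w (g.toLp 2 volume) 0)
    (hz : 0 ≤ z.re) (hν : 0 < ν) (hk : k ≠ 0) (hB : ‖B‖ ≤ ν / 10) (hϑ : 0 ≤ ϑ) {n : ℕ}
    (hdiff : ∀ A : List (Config d m), A.length ≤ n → ∀ x,
      ‖RenormalizedHierarchy.fdiff A (fun x => conjTrans x B) x‖ ≤ ϑ * ν * listWeight (transWeight ν k) A)
    {A : List (Config d m)} (hA : A.length ≤ n) :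
    hypoScale ν k * ‖RenormalizedHierarchy.fdiff A (fun x => RenormalizedHierarchy.trans x h) 0‖
        + ‖RenormalizedHierarchy.fdiff A (fun x => gtrans x w) 0‖
      ≤ diffConst ϑ n * dataSize ν k n g * listWeight (transWeight ν k) A := by
  have hR := hypoScale_pos hν hk
  have hRk := mul_hypoScale_pow hν k
  have hwt := transWeight_nonneg hν k (E := Config d m)
  let L : Config d m →+ ℝ :=
    { toFun := fun x => inner ℝ k x
      map_zero' := inner_zero_right _
      map_add' := fun x y => inner_add_right _ _ _ }
  have hr : ∀ A : List (Config d m), A.length ≤ n → ∀ x : Config d m,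
      160 / (ν * hypoScale ν k) * ‖RenormalizedHierarchy.fdiff A (fun x =>
        RenormalizedHierarchy.trans x (g.toLp 2 volume)) x‖
      ≤ dataSize ν k n g * listWeight (transWeight ν k) A := fun A hA x => by
    rw [fdiff_trans, RenormalizedHierarchy.trans, fmul_comm]
    change _ * ‖RenormalizedHierarchy.trans x _‖ ≤ _
    rw [norm_trans]
    exact le_dataSize hν hk hA
  have hη : 0 ≤ dataSize ν k n g := by
    have h1 := hr [] (by simp) 0
    simp only [listWeight, List.map_nil, List.prod_nil, mul_one] at h1
    exact (by positivity : (0 : ℝ) ≤ _).trans h1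
  have hsx : ∀ x : Config d m, IsSol (z + Complex.I * ((L x : ℝ) : ℂ)) k ν (conjTrans x B)
      (RenormalizedHierarchy.trans x h) (gtrans x w)
      (RenormalizedHierarchy.trans x (g.toLp 2 volume)) 0 := fun x => by
    have h1 := hs.trans x
    rw [map_zero] at h1
    exact h1
  refine norm_fdiff_sol_le (L := L) (Bx := fun x => conjTrans x B)
    (hx := fun x => RenormalizedHierarchy.trans x h) (wx := fun x => gtrans x w)
    (rx := fun x => RenormalizedHierarchy.trans x (g.toLp 2 volume)) hwt hz hν hk hR hRk hϑ hη hsx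
    (fun y => abs_inner_le_transWeight hν k y) (fun x => (norm_conjTrans_le x).trans hB)
    (fun x => ?_) n (fun A _ hA x => hdiff A hA x) (fun A _ hA x => hr A hA x) hA 0
  have h1 := (hsx x).norm_le (by simpa using hz) hν ((norm_conjTrans_le x).trans hB) hk hR hRk
  refine h1.trans ?_
  have h2 := hr [] (by simp) x
  simp only [RenormalizedHierarchy.fdiff, listWeight, List.map_nil, List.prod_nil, mul_one] at h2
  rw [norm_zero, add_zero]
  refine le_trans (le_of_eq ?_) h2
  field_simp

theorem fdiff_gtrans_apply (A : List (Config d m)) (w : Grad (Fin (m + 1) × Fin d))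
    (e : Fin (m + 1) × Fin d) :
    fdiff A (fun x => gtrans x w) 0 e = fmul (diffSymbol A) (w e) := by
  let ev : Grad (Fin (m + 1) × Fin d) →+ L2 d m :=
    { toFun := fun w => w e
      map_zero' := rfl
      map_add' := fun _ _ => rfl }
  have h1 := map_fdiff ev A (fun x => gtrans x w) 0
  have h2 := fdiff_trans A (w e) 0
  rw [trans_zero] at h2
  exact h1.trans h2

/-- The bound for the derivatives of order `n` of solutions. -/
def derivBound (ν ϑ : ℝ) (k : Config d m) (N : ℕ) (g : 𝓢(Config d m, ℂ)) : ℕ → ℝ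
  | 0 => diffConst ϑ N * dataSize ν k N g * (hypoScale ν k)⁻¹
  | n + 1 => diffConst ϑ N * dataSize ν k N g * (bracket k / ν ^ (1 / 3 : ℝ)) ^ n

theorem IsSol.exists_fourier_deriv (hs : IsSol z k ν B h w (g.toLp 2 volume) 0)
    (hz : 0 ≤ z.re) (hν : 0 < ν) (hk : k ≠ 0) (hB : ‖B‖ ≤ ν / 10) (hϑ : 0 ≤ ϑ) {N : ℕ}
    (hdiff : ∀ A : List (Config d m), A.length ≤ N → ∀ x,
      ‖RenormalizedHierarchy.fdiff A (fun x => conjTrans x B) x‖ ≤ ϑ * ν * listWeight (transWeight ν k) A)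
    (n : ℕ) (hn : n ≤ N + 1) (I : Fin n → Fin (m + 1) × Fin d) :
    ∃ u : L2 d m, ‖u‖ ≤ derivBound ν ϑ k N g n ∧ (𝓕 u : L2 d m) =ᵐ[volume] fun ξ =>
      derivSymbol (List.ofFn fun r => unitVec (I r)) ξ * (𝓕 h : L2 d m) ξ := by
  have hR := hypoScale_pos hν hk
  have hb := bracket_pos k
  cases n with
  | zero =>
    refine ⟨h, ?_, by simp [derivSymbol]⟩
    have h1 := hs.norm_add_norm_fdiff_le hz hν hk hB hϑ hdiff (A := []) (by simp)
    simp only [RenormalizedHierarchy.fdiff, listWeight, List.map_nil, List.prod_nil, mul_one,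
      trans_zero] at h1
    rw [derivBound, ← div_eq_mul_inv, le_div_iff₀ hR]
    linarith [norm_nonneg (gtrans 0 w)]
  | succ n =>
    -- The first of the n + 1 derivatives is already a component of the weak gradient and only the
    -- other n are difference quotients. Hence N differences of the data suffice for N + 1
    -- derivatives.
    set A : List (Config d m) := List.ofFn fun r : Fin n => unitVec (I r.succ) with hA
    have hAl : A.length = n := List.length_ofFn
    have hD : ∀ t : ℝ, 0 < t → ‖fmul (diffSymbol (A.map (t • ·))) (w (I 0))‖
        ≤ t ^ A.length * derivBound ν ϑ k N g (n + 1) := by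
      intro t ht
      have h1 := hs.norm_add_norm_fdiff_le hz hν hk hB hϑ hdiff (A := A.map (t • ·))
        (by rw [List.length_map, hAl]; omega)
      have h2 : ‖fmul (diffSymbol (A.map (t • ·))) (w (I 0))‖
          ≤ ‖RenormalizedHierarchy.fdiff (A.map (t • ·)) (fun x => gtrans x w) 0‖ := by
        rw [← fdiff_gtrans_apply]
        exact PiLp.norm_apply_le _ _
      have h3 : listWeight (transWeight ν k) (A.map (t • ·))
          = t ^ A.length * (bracket k / ν ^ (1 / 3 : ℝ)) ^ n := by
        have h4 : A.map (t • ·) = List.ofFn fun r : Fin n => t • unitVec (I r.succ) := by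
          rw [hA, List.map_ofFn]
          rfl
        have h5 : ∀ e : Fin (m + 1) × Fin d, transWeight ν k (t • (unitVec e : Config d m))
            = bracket k / ν ^ (1 / 3 : ℝ) * t := fun e => by
          rw [transWeight, norm_smul, Real.norm_of_nonneg ht.le, unitVec,
            PiLp.norm_single, norm_one, mul_one]
        rw [h4, listWeight, List.map_ofFn, List.prod_ofFn]
        simp only [Function.comp_apply, h5]
        rw [Finset.prod_const, Finset.card_univ, Fintype.card_fin, mul_pow, hAl, mul_comm]
      rw [h3] at h1
      have h6 : 0 ≤ hypoScale ν k *
          ‖RenormalizedHierarchy.fdiff (A.map (t • ·)) (fun x => RenormalizedHierarchy.trans x h) 0‖ := by positivity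
      rw [derivBound]
      linarith
    have hD0 : 0 ≤ derivBound ν ϑ k N g (n + 1) := by
      have := hD 1 one_pos
      rw [one_pow, one_mul] at this
      exact (norm_nonneg _).trans this
    obtain ⟨u, hu, hF⟩ := exists_fourier_eq_of_difference_quotients A (w (I 0)) hD0 hD
    refine ⟨u, hu, ?_⟩
    filter_upwards [hF, (isWeakDeriv_iff_fourier _ _ _).1 (hs.grad (I 0))] with ξ a1 a2
    rw [a1, a2, List.ofFn_succ, derivSymbol, List.map_cons, List.prod_cons, hA, unitVec]
    ring

theorem IsSol.exists_iteratedGradient (hs : IsSol z k ν B h w (g.toLp 2 volume) 0)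
    (hz : 0 ≤ z.re) (hν : 0 < ν) (hk : k ≠ 0) (hB : ‖B‖ ≤ ν / 10) (hϑ : 0 ≤ ϑ) {N : ℕ}
    (hdiff : ∀ A : List (Config d m), A.length ≤ N → ∀ x,
      ‖RenormalizedHierarchy.fdiff A (fun x => conjTrans x B) x‖ ≤ ϑ * ν * listWeight (transWeight ν k) A)
    (l : ℕ) (hl : l ≤ N + 1) :
    ∃ u : (Fin l → Fin (m + 1) × Fin d) → L2 d m, IsWeakIteratedGradient l h u ∧
      tensorNorm u ≤ (((m + 1) * d) ^ l : ℕ) * derivBound ν ϑ k N g l := by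
  have h1 := iteratedLineDerivOp_eq_of_fourier (E := Config d m) unitVec
    (hs.exists_fourier_deriv hz hν hk hB hϑ hdiff) l hl
  choose u hu hb _ using h1
  refine ⟨u, hu, ?_⟩
  have hcard : Fintype.card (Fin l → Fin (m + 1) × Fin d) = ((m + 1) * d) ^ l := by simp
  rw [← hcard]
  rcases isEmpty_or_nonempty (Fin l → Fin (m + 1) × Fin d) with he | ⟨⟨I⟩⟩
  · simp [tensorNorm]
  have hb0 := (norm_nonneg _).trans (hb I)
  -- The sum over components is bounded crudely, using √card ≤ card.
  have hc1 : (1 : ℝ) ≤ Fintype.card (Fin l → Fin (m + 1) × Fin d) := by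
    exact_mod_cast Fintype.card_pos_iff.2 ⟨I⟩
  refine Real.sqrt_le_iff.2 ⟨by positivity, ?_⟩
  calc ∑ I, ‖u I‖ ^ 2 ≤ ∑ _I : Fin l → Fin (m + 1) × Fin d, derivBound ν ϑ k N g l ^ 2 :=
        Finset.sum_le_sum fun I _ => pow_le_pow_left₀ (norm_nonneg _) (hb I) 2
    _ = Fintype.card (Fin l → Fin (m + 1) × Fin d) * derivBound ν ϑ k N g l ^ 2 := by
        rw [Finset.sum_const, Finset.card_univ, nsmul_eq_mul]
    _ ≤ _ := by
        rw [mul_pow]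
        gcongr
        nlinarith

end Regularity

/-! ### Powers of |k|, ⟨k⟩ and N. -/

section Powers

variable {d m : ℕ} {ν : ℝ} {k : Config d m}

/-- With a = |k|^(1/3) and c = ν^(1/3), 1/(νR) = 1/(ac²) = a⁻⁶a⁵c⁻². The factor a⁻⁶ is |k|⁻², and a⁵
is absorbed in ⟨k⟩⁵. -/
theorem inv_mul_hypoScale_mul_le (hν : 0 < ν) (hk : k ≠ 0) (s j : ℕ) :
    1 / (ν * hypoScale ν k) * (((bracket k / ν ^ (1 / 3 : ℝ)) ^ s)⁻¹ *
        (bracket k / ν ^ (1 / 3 : ℝ)) ^ (s + j))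
      ≤ (‖k‖ ^ 2)⁻¹ * bracket k ^ (s + j + 5) * ((ν ^ (1 / 3 : ℝ))⁻¹) ^ (j + 2) := by
  have hk0 := norm_pos_iff.2 hk
  have hb := bracket_pos k
  have ha := rpow_third_le_bracket k
  have hc3 := rpow_third_pow_three hν.le
  have ha3 := rpow_third_pow_three hk0.le
  have hR : hypoScale ν k = ‖k‖ ^ (1 / 3 : ℝ) / ν ^ (1 / 3 : ℝ) := by
    rw [hypoScale, Real.div_rpow hk0.le hν.le]
  have ha0 : 0 < ‖k‖ ^ (1 / 3 : ℝ) := by positivity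
  have hc0 : 0 < ν ^ (1 / 3 : ℝ) := by positivity
  rw [hR]
  generalize ‖k‖ ^ (1 / 3 : ℝ) = a at *
  generalize ν ^ (1 / 3 : ℝ) = c at *
  have h1 := one_le_bracket k
  generalize bracket k = b at *
  rw [← ha3, ← hc3]
  calc 1 / (c ^ 3 * (a / c)) * (((b / c) ^ s)⁻¹ * (b / c) ^ (s + j))
      = (a ^ 6)⁻¹ * b ^ j * a ^ 5 * (c⁻¹) ^ (j + 2) := by
        rw [pow_add (b / c), inv_mul_cancel_left₀ (by positivity), div_pow, inv_pow, pow_add c]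
        field_simp
    _ ≤ (a ^ 6)⁻¹ * b ^ j * b ^ (s + 5) * (c⁻¹) ^ (j + 2) := by
        gcongr ?_ * ?_ * ?_ * ?_
        exact (pow_le_pow_left₀ ha0.le ha 5).trans (pow_le_pow_right₀ h1 (by omega))
    _ = _ := by ring

/-- The case of no derivatives: 1/(νR²) = a⁻⁶a⁴c⁻¹ with the same a and c. -/
theorem inv_mul_hypoScale_sq_le (hν : 0 < ν) (hk : k ≠ 0) :
    1 / (ν * hypoScale ν k) * (hypoScale ν k)⁻¹
      ≤ (‖k‖ ^ 2)⁻¹ * bracket k ^ 4 * (ν ^ (1 / 3 : ℝ))⁻¹ := by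
  have hk0 := norm_pos_iff.2 hk
  have hb := bracket_pos k
  have ha := rpow_third_le_bracket k
  have hc3 := rpow_third_pow_three hν.le
  have ha3 := rpow_third_pow_three hk0.le
  have hR : hypoScale ν k = ‖k‖ ^ (1 / 3 : ℝ) / ν ^ (1 / 3 : ℝ) := by
    rw [hypoScale, Real.div_rpow hk0.le hν.le]
  have ha0 : 0 < ‖k‖ ^ (1 / 3 : ℝ) := by positivity
  have hc0 : 0 < ν ^ (1 / 3 : ℝ) := by positivity
  rw [hR]
  generalize ‖k‖ ^ (1 / 3 : ℝ) = a at *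
  generalize ν ^ (1 / 3 : ℝ) = c at *
  generalize bracket k = b at *
  rw [← ha3, ← hc3]
  calc 1 / (c ^ 3 * (a / c)) * (a / c)⁻¹ = (a ^ 6)⁻¹ * a ^ 4 * c⁻¹ := by field_simp
    _ ≤ (a ^ 6)⁻¹ * b ^ 4 * c⁻¹ := by gcongr
    _ = _ := by rw [← pow_mul]

theorem inv_rpow_third_pow_le {κ₀ κ : ℝ} {N l p : ℕ} (hκ₀ : 0 < κ₀) (hκ : κ₀ ≤ κ) (hN : 1 ≤ N)
    (hp : p ≤ l + 1) :
    (((κ / N) ^ (1 / 3 : ℝ))⁻¹) ^ p ≤ (1 + κ₀⁻¹) ^ (l + 1) * (N : ℝ) ^ ((p : ℝ) / 3) := by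
  have hN0 : (0 : ℝ) < N := by exact_mod_cast hN
  have hκ0 := hκ₀.trans_le hκ
  have h1 : (((κ / N) ^ (1 / 3 : ℝ))⁻¹) ^ p = (κ⁻¹) ^ ((p : ℝ) / 3) * (N : ℝ) ^ ((p : ℝ) / 3) := by
    rw [← Real.inv_rpow (by positivity), ← Real.rpow_natCast, ← Real.rpow_mul (by positivity),
      ← Real.mul_rpow (by positivity) hN0.le]
    congr 1
    · field_simp
    · ring
  rw [h1]
  gcongr
  have h2 : κ⁻¹ ≤ 1 + κ₀⁻¹ := by
    have : κ⁻¹ ≤ κ₀⁻¹ := by gcongr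
    linarith
  have h3 : (1 : ℝ) ≤ 1 + κ₀⁻¹ := by
    have : 0 < κ₀⁻¹ := by positivity
    linarith
  calc (κ⁻¹) ^ ((p : ℝ) / 3) ≤ (1 + κ₀⁻¹) ^ ((p : ℝ) / 3) := by gcongr
    _ ≤ (1 + κ₀⁻¹) ^ ((l + 1 : ℕ) : ℝ) := by
        refine Real.rpow_le_rpow_of_exponent_le h3 ?_
        have : (p : ℝ) ≤ ((l + 1 : ℕ) : ℝ) := by exact_mod_cast hp
        have : (0 : ℝ) ≤ p := by positivity
        linarith
    _ = _ := Real.rpow_natCast _ _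

/-- For l = n + 1 and s = n - j, the factor ν^(-(j+2)/3) yields N^((l+1-s)/3). For l = 0 the
truncated l - 1 is 0, so only s = 0 occurs, with N^(1/3). -/
theorem derivBound_le {κ₀ κ ϑ : ℝ} {N : ℕ} (hκ₀ : 0 < κ₀) (hκ : κ₀ ≤ κ) (hN : 1 ≤ N)
    (hϑ : 0 ≤ ϑ) (hk : k ≠ 0) (l : ℕ) (g : 𝓢(Config d m, ℂ)) :
    derivBound (κ / N) ϑ k (l - 1) g l
      ≤ diffConst ϑ (l - 1) * 160 * (1 + κ₀⁻¹) ^ (l + 1) * ((‖k‖ ^ 2)⁻¹ * bracket k ^ (l + 4)) *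
        ∑ s ∈ Finset.range (l - 1 + 1), (N : ℝ) ^ (((l : ℝ) + 1 - (s : ℝ)) / 3) * besselNorm s g := by
  have hN0 : (0 : ℝ) < N := by exact_mod_cast hN
  have hν : 0 < κ / N := div_pos (hκ₀.trans_le hκ) hN0
  have hD := one_le_diffConst hϑ (l - 1)
  have hb := bracket_pos k
  cases l with
  | zero =>
    have h1 := inv_mul_hypoScale_sq_le hν hk
    have h2 := inv_rpow_third_pow_le (l := 0) (p := 1) hκ₀ hκ hN (by omega)
    have hg := besselNorm_nonneg 0 g
    rw [pow_one] at h2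
    simp only [derivBound, dataSize, zero_tsub, zero_add, Finset.range_one, Finset.sum_singleton, pow_zero, inv_one,
      one_mul]
    calc _ = diffConst ϑ 0 * 160 * (1 / (κ / N * hypoScale (κ / N) k) * (hypoScale (κ / N) k)⁻¹)
          * besselNorm 0 g := by ring
      _ ≤ diffConst ϑ 0 * 160 * ((‖k‖ ^ 2)⁻¹ * bracket k ^ 4 *
          ((1 + κ₀⁻¹) ^ (0 + 1) * (N : ℝ) ^ (((1 : ℕ) : ℝ) / 3))) * besselNorm 0 g := by
          gcongr ?_ * ?_ * ?_
          exact h1.trans (by gcongr)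
      _ = _ := by
          have e : (((0 : ℕ) : ℝ) + 1 - ((0 : ℕ) : ℝ)) / 3 = ((1 : ℕ) : ℝ) / 3 := by norm_num
          rw [e]
          ring
  | succ n =>
    simp only [Nat.add_sub_cancel] at hD ⊢
    rw [derivBound, dataSize, Finset.mul_sum, Finset.mul_sum, Finset.sum_mul, Finset.mul_sum]
    refine Finset.sum_le_sum fun s hs => ?_
    obtain ⟨j, rfl⟩ := Nat.exists_eq_add_of_le (Nat.lt_succ_iff.1 (Finset.mem_range.1 hs))
    have h1 := inv_mul_hypoScale_mul_le hν hk s j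
    have h2 := inv_rpow_third_pow_le (l := s + j + 1) (p := j + 2) hκ₀ hκ hN (by omega)
    have hg := besselNorm_nonneg s g
    calc _ = diffConst ϑ (s + j) * 160 * (1 / (κ / N * hypoScale (κ / N) k) *
          (((bracket k / (κ / N) ^ (1 / 3 : ℝ)) ^ s)⁻¹ *
            (bracket k / (κ / N) ^ (1 / 3 : ℝ)) ^ (s + j))) * besselNorm s g := by ring
      _ ≤ diffConst ϑ (s + j) * 160 * ((‖k‖ ^ 2)⁻¹ * bracket k ^ (s + j + 5) *
          ((1 + κ₀⁻¹) ^ (s + j + 1 + 1) * (N : ℝ) ^ (((j + 2 : ℕ) : ℝ) / 3))) *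
          besselNorm s g := by
          gcongr ?_ * ?_ * ?_
          exact h1.trans (by gcongr)
      _ = _ := by
          have e : ((((s + j + 1 : ℕ) : ℝ) + 1 - (s : ℝ)) / 3) = ((j + 2 : ℕ) : ℝ) / 3 := by
            push_cast; ring
          rw [e]
          ring

end Powers

/-! ### Assembly. -/

section Main

variable {d : ℕ}

/-- The constant in the regularity estimate. -/
def regularityConst {β : ℝ} (hβ : 0 < β) (V : EuclideanSpace ℝ (Fin d) → ℝ) (κ₀ : ℝ)
    (m₀ l : ℕ) : ℝ :=
  1 + (((m₀ + 1) * d) ^ l : ℕ) * ((∑ L ∈ Finset.range (m₀ + 1),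
    diffConst (perturbConst V κ₀ (levelConst hβ V κ₀ L) (l - 1)) (l - 1)) *
      160 * (1 + κ₀⁻¹) ^ (l + 1))

theorem propagator_spec {P : Params d} {κ₀ : ℝ} (hV : ContDiff ℝ ∞ P.V)
    (hVc : HasCompactSupport P.V) (hκ₀ : 0 < κ₀) (hκ : κ₀ ≤ P.κ) (hN : 1 ≤ P.N) (ht : 0 < P.tN)
    (hsmall : 10 * ((2 * Real.pi) ^ d)⁻¹ * baseConst d P.β_pos * potentialConst P.V ≤ κ₀)
    {m₀ m : ℕ} (hm : m ≤ m₀) (k : Config d m) :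
    (∀ f h : L2 d m, propagator P m₀ m k f = h ↔
      IsResolventSolution P (propagator P m₀ (m + 1)) k f h) ∧
    (k ≠ 0 → ∀ (l : ℕ) (g : 𝓢(Config d m, ℂ)),
      ∃ u : (Fin l → Fin (m + 1) × Fin d) → L2 d m,
        IsWeakIteratedGradient l (propagator P m₀ m k (g.toLp 2)) u ∧
        tensorNorm u ≤ regularityConst P.β_pos P.V κ₀ m₀ l * (‖k‖ ^ 2)⁻¹ * bracket k ^ (l + 4) *
          ∑ s ∈ Finset.range (max (l - 1) 2 + 1),
            (P.N : ℝ) ^ (((l : ℝ) + 1 - (s : ℝ)) / 3) * besselNorm s g) := by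
  obtain ⟨L, rfl⟩ := Nat.exists_eq_add_of_le hm
  have e1 : ∀ k, propagator P (m + L) m k = propagatorAux P (L + 1) m k := fun k => by
    rw [propagator]; congr 1; omega
  have e2 : propagator P (m + L) (m + 1) = propagatorAux P L (m + 1) := by
    funext k; rw [propagator]; congr 1; omega
  have hN0 : (0 : ℝ) < P.N := by exact_mod_cast hN
  have hν : 0 < P.κ / P.N := div_pos (hκ₀.trans_le hκ) hN0
  have hc := levelConst_nonneg P.β_pos P.V hκ₀ L
  have hs : 10 * ((2 * Real.pi) ^ d)⁻¹ * levelConst P.β_pos P.V κ₀ L 0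
      * potentialConst P.V ≤ κ₀ := by rwa [levelConst_apply_zero]
  have hreg := isRegularFamily_propagatorAux hV hVc hκ₀ hκ hN ht hsmall L m
  have hres := hreg.isResolventFamily hV hVc hc hκ₀ hκ hN ht hs
  rw [e1, e2]
  refine ⟨hres k, fun hk l g => ?_⟩
  obtain ⟨B, hB, hBn, hBd⟩ := hreg.exists_perturbation hV hVc hc hκ₀ hκ hN hs k
  obtain ⟨w, hw⟩ := (isResolventSolution_iff hB).1 ((hres k (g.toLp 2 volume) _).1 rfl)
  set ϑ := perturbConst P.V κ₀ (levelConst P.β_pos P.V κ₀ L) (l - 1) with hϑ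
  have hϑ0 : 0 ≤ ϑ := perturbConst_nonneg P.V hκ₀ hc _
  obtain ⟨u, hu, hub⟩ := hw.exists_iteratedGradient (re_resolventShift_pos ht).le hν hk hBn hϑ0
    (hBd (l - 1)) l (by omega)
  refine ⟨u, hu, hub.trans ?_⟩
  have h1 := derivBound_le hκ₀ hκ hN hϑ0 hk l g
  have hterm : ∀ s : ℕ, 0 ≤ (P.N : ℝ) ^ (((l : ℝ) + 1 - (s : ℝ)) / 3) * besselNorm s g := fun s =>
    mul_nonneg (by positivity) (besselNorm_nonneg s g)
  have h2 : ∑ s ∈ Finset.range (l - 1 + 1),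
        (P.N : ℝ) ^ (((l : ℝ) + 1 - (s : ℝ)) / 3) * besselNorm s g
      ≤ ∑ s ∈ Finset.range (max (l - 1) 2 + 1),
        (P.N : ℝ) ^ (((l : ℝ) + 1 - (s : ℝ)) / 3) * besselNorm s g :=
    Finset.sum_le_sum_of_subset_of_nonneg
      (Finset.range_subset_range.2 (by have := le_max_left (l - 1) 2; omega)) fun s _ _ => hterm s
  set S₁ := ∑ s ∈ Finset.range (l - 1 + 1),
    (P.N : ℝ) ^ (((l : ℝ) + 1 - (s : ℝ)) / 3) * besselNorm s g
  set S₂ := ∑ s ∈ Finset.range (max (l - 1) 2 + 1),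
    (P.N : ℝ) ^ (((l : ℝ) + 1 - (s : ℝ)) / 3) * besselNorm s g
  have hS₁ : 0 ≤ S₁ := Finset.sum_nonneg fun s _ => hterm s
  have hD : ∀ L', 0 ≤ diffConst (perturbConst P.V κ₀ (levelConst P.β_pos P.V κ₀ L') (l - 1))
      (l - 1) := fun L' => zero_le_one.trans (one_le_diffConst
        (perturbConst_nonneg P.V hκ₀ (levelConst_nonneg P.β_pos P.V hκ₀ L') _) _)
  -- The constant sums over all levels and so dominates the one for the present distance L to the
  -- truncation; this makes it independent of m.
  have h3 : diffConst ϑ (l - 1) ≤ ∑ L' ∈ Finset.range (m + L + 1),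
      diffConst (perturbConst P.V κ₀ (levelConst P.β_pos P.V κ₀ L') (l - 1)) (l - 1) :=
    Finset.single_le_sum (f := fun L' => diffConst (perturbConst P.V κ₀
      (levelConst P.β_pos P.V κ₀ L') (l - 1)) (l - 1)) (fun L' _ => hD L')
      (Finset.mem_range.2 (by omega))
  have hD0 := hD L
  rw [← hϑ] at hD0
  have h4 : ((((m + 1) * d) ^ l : ℕ) : ℝ) ≤ (((m + L + 1) * d) ^ l : ℕ) := by
    exact_mod_cast Nat.pow_le_pow_left (Nat.mul_le_mul_right d (by omega)) l
  have hb := bracket_pos k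
  set D := ∑ L' ∈ Finset.range (m + L + 1),
      diffConst (perturbConst P.V κ₀ (levelConst P.β_pos P.V κ₀ L') (l - 1)) (l - 1) with hDdef
  have hDD : 0 ≤ D := hD0.trans h3
  calc _ ≤ ((((m + L + 1) * d) ^ l : ℕ) : ℝ) * (D * 160 * (1 + κ₀⁻¹) ^ (l + 1) *
        ((‖k‖ ^ 2)⁻¹ * bracket k ^ (l + 4)) * S₂) := by
        refine mul_le_mul h4 (h1.trans ?_) ?_ (by positivity)
        · gcongr
        · have h5 : 0 ≤ tensorNorm u := Real.sqrt_nonneg _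
          unfold derivBound dataSize
          have hR := hypoScale_pos hν hk
          have hsum : 0 ≤ ∑ s ∈ Finset.range (l - 1 + 1),
              ((bracket k / (P.κ / P.N) ^ (1 / 3 : ℝ)) ^ s)⁻¹ * besselNorm s g :=
            Finset.sum_nonneg fun s _ => mul_nonneg (by positivity) (besselNorm_nonneg s g)
          split <;> positivity
    _ ≤ _ := by
        have hS₂ : 0 ≤ S₂ := hS₁.trans h2
        have h6 : 0 ≤ (‖k‖ ^ 2)⁻¹ * bracket k ^ (l + 4) * S₂ := by positivity
        rw [regularityConst, ← hDdef]
        linarith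

end Main

end

end RenormalizedHierarchy

theorem mainTheorem3 (d : ℕ) (hd : 1 ≤ d) (m₀ : ℕ) (hm₀ : 1 ≤ m₀) (β : ℝ) (hβ : 0 < β) :
    ∃ K : ℝ, 0 < K ∧
      ∀ V : EuclideanSpace ℝ (Fin d) → ℝ, ContDiff ℝ ∞ V → HasCompactSupport V →
      ∀ κ₀ : ℝ, 0 < κ₀ → K * RenormalizedHierarchy.potentialConst V ≤ κ₀ →
      ∀ ℓ : ℕ, ∃ C : ℝ, 0 < C ∧
        ∀ P : RenormalizedHierarchy.Params d, P.β = β → P.V = V → κ₀ ≤ P.κ → 1 ≤ P.N → 0 < P.tN →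
        ∀ m : ℕ, m ≤ m₀ → ∀ k : RenormalizedHierarchy.Config d m, (∀ i, ∑ j, k (j, i) = 0) →
          (∀ f h : RenormalizedHierarchy.L2 d m,
            RenormalizedHierarchy.propagator P m₀ m k f = h ↔
              RenormalizedHierarchy.IsResolventSolution P
                (RenormalizedHierarchy.propagator P m₀ (m + 1)) k f h) ∧
          (k ≠ 0 → ∀ g : 𝓢(RenormalizedHierarchy.Config d m, ℂ), HasCompactSupport g →
            ∃ u : (Fin ℓ → Fin (m + 1) × Fin d) → RenormalizedHierarchy.L2 d m,
              RenormalizedHierarchy.IsWeakIteratedGradient ℓ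
                (RenormalizedHierarchy.propagator P m₀ m k (g.toLp 2)) u ∧
              RenormalizedHierarchy.tensorNorm u ≤
                C * (‖k‖ ^ 2)⁻¹ * RenormalizedHierarchy.bracket k ^ (ℓ + 4) *
                  ∑ s ∈ Finset.range (max (ℓ - 1) 2 + 1),
                    (P.N : ℝ) ^ (((ℓ : ℝ) + 1 - (s : ℝ)) / 3) *
                      RenormalizedHierarchy.besselNorm s g) := by
  have hb := RenormalizedHierarchy.baseConst_pos d hβ
  have hpi := Real.pi_pos
  -- K comes from (2π)^(-d)·`baseConst`·C_0^V ≤ κ₀/10, that is, ‖B‖ ≤ ν/10. It involves only d and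
  -- β.
  refine ⟨10 * ((2 * Real.pi) ^ d)⁻¹ * RenormalizedHierarchy.baseConst d hβ, by positivity,
    fun V hV hVc κ₀ hκ₀ hsmall ℓ =>
      ⟨RenormalizedHierarchy.regularityConst hβ V κ₀ m₀ ℓ, ?_, ?_⟩⟩
  · unfold RenormalizedHierarchy.regularityConst
    have : 0 ≤ ∑ L ∈ Finset.range (m₀ + 1), RenormalizedHierarchy.diffConst
        (RenormalizedHierarchy.perturbConst V κ₀
          (RenormalizedHierarchy.levelConst hβ V κ₀ L) (ℓ - 1)) (ℓ - 1) :=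
      Finset.sum_nonneg fun L _ => zero_le_one.trans (RenormalizedHierarchy.one_le_diffConst
        (RenormalizedHierarchy.perturbConst_nonneg V hκ₀
          (RenormalizedHierarchy.levelConst_nonneg hβ V hκ₀ L) _) _)
    positivity
  · rintro P rfl rfl hκ hN ht m hm k -
    obtain ⟨h1, h2⟩ := RenormalizedHierarchy.propagator_spec hV hVc hκ₀ hκ hN ht hsmall hm k
    exact ⟨h1, fun hk g _ => h2 hk ℓ g⟩
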